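/- Let $\mathcal C$ be a braided monoidal category with tensor product $\otimes$, unit object $K$ and braiding $c$, and suppose that $\mathcal C$ has coequalizers (so idempotents split in $\mathcal C$). Associativity and unit constraints are suppressed. **Structures.** A unital magma $(A,\eta_A,\mu_A)$ is an object with a product having a two-sided unit; it is a monoid if $\mu_A$ is associative. For $f,g:D\to A$ with $D$ a comonoid and $A$ a unital magma, $f\ast g=\mu_A(f\otimes g)\delta_D$. A *weak Hopf quasigroup* is an object $H$ that is a unital magma and a comonoid $(H,\varepsilon_H,\delta_H)$, with a morphism $\lambda_H:H\to H$ (antipode) such that, writing $\Pi^L_H=id_H\ast\lambda_H$, $\Pi^R_H=\lambda_H\ast id_H$: - $\delta_H\mu_H=(\mu_H\otimes\mu_H)(H\otimes c_{H,H}\otimes H)(\delta_H\otimes\delta_H)$; - $\varepsilon_H\mu_H(\mu_H\otimes H)=\varepsilon_H\mu_H(H\otimes\mu_H)=(\varepsilon_H\mu_H\otimes\varepsilon_H\mu_H)(H\otimes\delta_H\otimes H)=(\varepsilon_H\mu_H\otimes\varepsilon_H\mu_H)(H\otimes c_{H,H}^{-1}\delta_H\otimes H)$; - $(\delta_H\otimes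 H)\delta_H\eta_H=(H\otimes\mu_H\otimes H)(\delta_H\eta_H\otimes\delta_H\eta_H)=(H\otimes\mu_Hc_{H,H}^{-1}\otimes H)(\delta_H\eta_H\otimes\delta_H\eta_H)$; - $\Pi^L_H=(\varepsilon_H\mu_H\otimes H)(H\otimes c_{H,H})(\delta_H\eta_H\otimes H)$ and $\Pi^R_H=(H\otimes\varepsilon_H\mu_H)(c_{H,H}\otimes H)(H\otimes\delta_H\eta_H)$; - $\lambda_H\ast\Pi^L_H=\Pi^R_H\ast\lambda_H=\lambda_H$; - $\mu_H(\lambda_H\otimes\mu_H)(\delta_H\otimes H)=\mu_H(\Pi^R_H\otimes H)$ and $\mu_H(H\otimes\mu_H)(H\otimes\lambda_H\otimes H)(\delta_H\otimes H)=\mu_H(\Pi^L_H\otimes H)$; - $\mu_H(\mu_H\otimes\lambda_H)(H\otimes\delta_H)=\mu_H(H\otimes\Pi^L_H)$ and $\mu_H(\mu_H\otimes H)(H\otimes\lambda_H\otimes H)(H\otimes\delta_H)=\mu_H(H\otimes\Pi^R_H)$. It is a *weak Hopf algebra* if $\mu_H$ is associative. A *Hopf quasigroup* is a unital magma and comonoid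 $H$ such that $\varepsilon_H$ and $\delta_H$ are morphisms of unital magmas, with $\lambda_H:H\to H$ such that $\mu_H(\lambda_H\otimes\mu_H)(\delta_H\otimes H)=\varepsilon_H\otimes H=\mu_H(H\otimes\mu_H)(H\otimes\lambda_H\otimes H)(\delta_H\otimes H)$ and $\mu_H(\mu_H\otimes H)(H\otimes\lambda_H\otimes H)(H\otimes\delta_H)=H\otimes\varepsilon_H=\mu_H(\mu_H\otimes\lambda_H)(H\otimes\delta_H)$. A *Hopf algebra* is a Hopf monoid in $\mathcal C$. A *right $H$-comodule magma* is a unital magma $B$ with a right $H$-comodule structure $\rho_B:B\to B\otimes H$ such that $\rho_B\mu_B=(\mu_B\otimes\mu_H)(B\otimes c_{H,B}\otimes H)(\rho_B\otimes\rho_B)$ and $(B\otimes\Pi^L_H)\rho_B\eta_B=\rho_B\eta_B$; if $H$ is a Hopf quasigroup or Hopf algebra the last condition reads $\rho_B\eta_B=\eta_B\otimes\eta_H$. It is a *right $H$-comodule monoid* if $B$ is a monoid. A *multiplicative total integral* is a morphism $h:H\to B$ of right $H$-comodules and of unital magmas. It is an *anchor morphism* if moreover $\mu_B(\mu_B(B\otimes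 h)\otimes h\lambda_H)(B\otimes\delta_H)=\mu_B(B\otimes h\Pi^L_H)$ and $\mu_B(\mu_B(B\otimes h\lambda_H)\otimes h)(B\otimes\delta_H)=\mu_B(B\otimes h\Pi^R_H)$. Given an action $\phi_M:M\otimes B\to M$ and a coaction $\rho_M:M\to M\otimes H$, put $q_M=\phi_M(M\otimes h\lambda_H)\rho_M$; in particular $q_B=\mu_B(B\otimes h\lambda_H)\rho_B$. The images of $q_M$ and $q_B$ (when these are idempotent) are denoted $M^{coH}$ and $B^{coH}$, with $q_M=i_Mp_M$, $p_Mi_M=id$, and similarly $i_B,p_B$. For $B=H$, $\rho_B=\delta_H$, $h=id_H$ one has $q_H=\Pi^L_H$, whose image is denoted $H_L$, with $\Pi_H^L=i_Lp_L$, $p_Li_L=id$. A *strong $(H,B,h)$-Hopf module* is a right $H$-comodule $(M,\rho_M)$ with $\phi_M:M\otimes B\to M$ such that $\phi_M(M\otimes\eta_B)=id_M$; $\phi_M(\phi_M(M\otimes i_B)\otimes B)=\phi_M(M\otimes\mu_B(i_B\otimes B))$; $\rho_M\phi_M=(\phi_M\otimes\mu_H)(M\otimes c_{H,B}\otimes H)(\rho_M\otimes\rho_B)$;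 $\phi_M(\phi_M(M\otimes h)\otimes h\lambda_H)(M\otimes\delta_H)=\phi_M(M\otimes h\Pi^L_H)$; and $\phi_M(\phi_M(M\otimes h\lambda_H)\otimes h)(M\otimes\delta_H)=\phi_M(M\otimes h\Pi^R_H)$. Let $\phi_{M^{coH}}:M^{coH}\otimes B^{coH}\to M^{coH}$ be the morphism with $i_M\phi_{M^{coH}}=\phi_M(i_M\otimes i_B)$, let $n:M^{coH}\otimes B\to M^{coH}\otimes_{B^{coH}}B$ be the coequalizer of $\phi_{M^{coH}}\otimes B$ and $M^{coH}\otimes\mu_B(i_B\otimes B)$, with the action $\phi_\otimes$ of $B$ determined by $\phi_\otimes(n\otimes B)=n(M^{coH}\otimes\mu_B)$, let $\omega_M$ be the isomorphism from it to $M$ with $\omega_Mn=\phi_M(i_M\otimes B)$, and let $\phi_M^{\omega}=\omega_M\phi_\otimes(\omega_M^{-1}\otimes B)$. The category $\mathcal{SM}^H_B(h)$ has as objects the strong $(H,B,h)$-Hopf modules and as morphisms the $H$-colinear $f:M\to N$ with $\phi_N^{\omega}(f\otimes B)=f\phi_M^{\omega}$. If $B$ is associative, $\mathcal M^H_B$ is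 the category of right $(H,B)$-Hopf modules, i.e. right $B$-modules and right $H$-comodules with $\rho_M\phi_M=(\phi_M\otimes\mu_H)(M\otimes c_{H,B}\otimes H)(\rho_M\otimes\rho_B)$, with $B$-linear and $H$-colinear morphisms. For a Hopf quasigroup $H$, Brzeziński's category $\mathcal M^H_H$ has as objects the right $H$-comodules $(M,\rho_M)$ with $\phi_M:M\otimes H\to M$ satisfying $\phi_M(M\otimes\eta_H)=id_M$, $\rho_M\phi_M=(\phi_M\otimes\mu_H)(M\otimes c_{H,H}\otimes H)(\rho_M\otimes\delta_H)$ and $\phi_M(\phi_M\otimes\lambda_H)(M\otimes\delta_H)=M\otimes\varepsilon_H=\phi_M(\phi_M(M\otimes\lambda_H)\otimes H)(M\otimes\delta_H)$, and as morphisms the $H$-colinear maps $f:M\to N$ with $f\,\phi_M(q_M\otimes\mu_H)(\rho_M\otimes H)=\phi_N(q_N\otimes\mu_H)(\rho_N\otimes H)(f\otimes H)$, where $q_M=\phi_M(M\otimes\lambda_H)\rho_M$. For a monoid $A$, $\mathcal C_A$ is the category of right $A$-modules. **Statement.** In each of the cases below $q_B$ splits; every strong Hopf module $M$ has a well-defined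 action $\phi_M^\omega$ (all the morphisms above exist, and $\phi_M^\omega$ does not depend on choices); there is a monoid structure on $B^{coH}$ with $i_B\eta_{B^{coH}}=\eta_B$ and $i_B\mu_{B^{coH}}=\mu_B(i_B\otimes i_B)$ (respectively, on $H_L$ with $\eta_{H_L}=p_L\eta_H$, $\mu_{H_L}=p_L\mu_H(i_L\otimes i_L)$) wherever modules over this object are mentioned; and: (i) Let $H$ be a Hopf algebra and $(B,\rho_B)$ a right $H$-comodule monoid such that $-\otimes B$ and $-\otimes H$ preserve coequalizers, and let $h:H\to B$ be a multiplicative total integral. Then $\mathcal M^H_B$, $\mathcal{SM}^H_B(h)$ and $\mathcal C_{B^{coH}}$ are equivalent. In particular, for any Hopf algebra $H$ such that $-\otimes H$ preserves coequalizers, $\mathcal M^H_H$, $\mathcal{SM}^H_H(id_H)$ and $\mathcal C$ are equivalent. (ii) Let $H$ be a weak Hopf algebra and $(B,\rho_B)$ a right $H$-comodule monoid such that $-\otimes B$ and $-\otimes H$ preserve coequalizers, and let $h:H\to B$ be a multiplicative total integral. Then $\mathcal M^H_B$, $\mathcal{SM}^H_B(h)$ and $\mathcal C_{B^{coH}}$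 are equivalent. In particular, for any weak Hopf algebra $H$ such that $-\otimes H$ preserves coequalizers, $\mathcal M^H_H$, $\mathcal{SM}^H_H(id_H)$ and $\mathcal C_{H_L}$ are equivalent. (iii) Let $H$ be a Hopf quasigroup and $(B,\rho_B)$ a right $H$-comodule magma such that $-\otimes B$ and $-\otimes H$ preserve coequalizers, and let $h:H\to B$ be an anchor morphism such that $\mu_B(\mu_B(B\otimes i_B)\otimes B)=\mu_B(B\otimes\mu_B(i_B\otimes B))$ and $\mu_B(i_B\otimes\mu_B)=\mu_B(\mu_B(i_B\otimes B)\otimes B)$. Then $\mathcal{SM}^H_B(h)$ and $\mathcal C_{B^{coH}}$ are equivalent. In particular, for any Hopf quasigroup $H$ such that $-\otimes H$ preserves coequalizers, Brzeziński's category $\mathcal M^H_H$ coincides with $\mathcal{SM}^H_H(id_H)$ and is equivalent to $\mathcal C$. (iv) Let $H$ be a weak Hopf quasigroup such that $-\otimes H$ preserves coequalizers. Then $\mathcal{SM}^H_H(id_H)$ and $\mathcal C_{H_L}$ are equivalent. -/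

import Mathlib

open CategoryTheory MonoidalCategory Limits
open scoped ComonObj

universe v u

namespace DoiHopf


section Magmas

variable {C : Type u} [Category.{v} C] [MonoidalCategory.{v} C]

/-- A unital (not necessarily associative) magma in a monoidal category. -/
class UnitalMagmaObj (A : C) where
  one : 𝟙_ C ⟶ A
  mul : A ⊗ A ⟶ A
  one_mul : one ▷ A ≫ mul = (λ_ A).hom
  mul_one : A ◁ one ≫ mul = (ρ_ A).hom

/-- The unit of a unital magma. -/
abbrev eta (A : C) [UnitalMagmaObj A] : 𝟙_ C ⟶ A := UnitalMagmaObj.one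

/-- The product of a unital magma. -/
abbrev mu (A : C) [UnitalMagmaObj A] : A ⊗ A ⟶ A := UnitalMagmaObj.mul

/-- Every monoid is a unital magma. -/
instance UnitalMagmaObj.ofMonObj (A : C) [MonObj A] : UnitalMagmaObj A where
  one := MonObj.one
  mul := MonObj.mul
  one_mul := MonObj.one_mul A
  mul_one := MonObj.mul_one A

/-- The convolution product of two morphisms from a comonoid to a unital magma. -/
def conv {D A : C} [ComonObj D] [UnitalMagmaObj A] (f g : D ⟶ A) : D ⟶ A :=
  Δ[D] ≫ (f ⊗ₘ g) ≫ mu A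

/-- The operations common to all kinds of (weak, nonassociative) Hopf structures: a unital magma
and a comonoid on the same object and an endomorphism, called the antipode. The axioms relating
them are imposed in `WeakHopfQuasigroup`, `WeakHopfAlgebra`, `HopfQuasigroup` and `HopfObj`. -/
class HopfSignature (H : C) extends UnitalMagmaObj H, ComonObj H where
  antipode : H ⟶ H

/-- The antipode. -/
abbrev lam (H : C) [HopfSignature H] : H ⟶ H := HopfSignature.antipode

/-- The target morphism `id * antipode`. -/
def PiL (H : C) [HopfSignature H] : H ⟶ H := conv (𝟙 H) (lam H)

/-- The source morphism `antipode * id`. -/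
def PiR (H : C) [HopfSignature H] : H ⟶ H := conv (lam H) (𝟙 H)

/-- `(X, ρ)` is a right comodule over the comonoid `H`. -/
structure IsComodule (H : C) [ComonObj H] {X : C} (ρ : X ⟶ X ⊗ H) : Prop where
  counit : ρ ≫ X ◁ ε[H] = (ρ_ X).inv
  coassoc : ρ ≫ ρ ▷ H ≫ (α_ X H H).hom = ρ ≫ X ◁ Δ[H]

/-- A splitting `q = i ∘ p`, `p ∘ i = id` of an endomorphism `q`; `obj` is the image of `q`. -/
structure Splitting {X : C} (q : X ⟶ X) where
  obj : C
  i : obj ⟶ X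
  p : X ⟶ obj
  p_i : p ≫ i = q
  i_p : i ≫ p = 𝟙 obj

/-- A right module over a monoid `A`. -/
structure RightMod (A : C) [MonObj A] where
  X : C
  act : X ⊗ A ⟶ X
  act_one : X ◁ MonObj.one ≫ act = (ρ_ X).hom
  act_mul : act ▷ A ≫ act = (α_ X A A).hom ≫ X ◁ MonObj.mul ≫ act

namespace RightMod

/-- Morphisms of right modules. -/
@[ext]
structure Hom {A : C} [MonObj A] (M N : RightMod A) where
  hom : M.X ⟶ N.X
  act_hom : hom ▷ A ≫ N.act = M.act ≫ hom

/-- The category of right `A`-modules. -/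
instance (A : C) [MonObj A] : Category (RightMod A) where
  Hom M N := Hom M N
  id M := ⟨𝟙 M.X, by simp⟩
  comp f g := ⟨f.hom ≫ g.hom, by
    rw [comp_whiskerRight, Category.assoc, g.act_hom, ← Category.assoc, f.act_hom,
      Category.assoc]⟩
  id_comp _ := Hom.ext (Category.id_comp _)
  comp_id _ := Hom.ext (Category.comp_id _)
  assoc _ _ _ := Hom.ext (Category.assoc _ _ _)

end RightMod

end Magmas

variable {C : Type u} [Category.{v} C] [MonoidalCategory.{v} C] [BraidedCategory.{v} C]

/-- The operations of a Hopf algebra. -/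
instance HopfSignature.ofHopfObj (H : C) [HopfObj H] : HopfSignature H where
  antipode := HopfObj.antipode

/-- A weak Hopf quasigroup in a braided monoidal category. -/
class WeakHopfQuasigroup (H : C) extends HopfSignature H where
  mul_comul : mu H ≫ Δ[H] = (Δ[H] ⊗ₘ Δ[H]) ≫ tensorμ H H H H ≫ (mu H ⊗ₘ mu H)
  counit_mul_assoc :
    mu H ▷ H ≫ mu H ≫ ε[H] = (α_ H H H).hom ≫ H ◁ mu H ≫ mu H ≫ ε[H]
  counit_mul_mul :
    mu H ▷ H ≫ mu H ≫ ε[H] =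
      (H ◁ Δ[H]) ▷ H ≫ (α_ H H H).inv ▷ H ≫ (α_ (H ⊗ H) H H).hom ≫
        ((mu H ≫ ε[H]) ⊗ₘ (mu H ≫ ε[H])) ≫ (λ_ (𝟙_ C)).hom
  counit_mul_mul_braid :
    mu H ▷ H ≫ mu H ≫ ε[H] =
      (H ◁ (Δ[H] ≫ (β_ H H).inv)) ▷ H ≫ (α_ H H H).inv ▷ H ≫ (α_ (H ⊗ H) H H).hom ≫
        ((mu H ≫ ε[H]) ⊗ₘ (mu H ≫ ε[H])) ≫ (λ_ (𝟙_ C)).hom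
  one_comul_comul :
    eta H ≫ Δ[H] ≫ Δ[H] ▷ H =
      (λ_ (𝟙_ C)).inv ≫ ((eta H ≫ Δ[H]) ⊗ₘ (eta H ≫ Δ[H])) ≫
        (α_ (H ⊗ H) H H).inv ≫ (α_ H H H).hom ▷ H ≫ (H ◁ mu H) ▷ H
  one_comul_comul_braid :
    eta H ≫ Δ[H] ≫ Δ[H] ▷ H =
      (λ_ (𝟙_ C)).inv ≫ ((eta H ≫ Δ[H]) ⊗ₘ (eta H ≫ Δ[H])) ≫
        (α_ (H ⊗ H) H H).inv ≫ (α_ H H H).hom ▷ H ≫ (H ◁ ((β_ H H).inv ≫ mu H)) ▷ H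
  piL_eq :
    PiL H = (λ_ H).inv ≫ (eta H ≫ Δ[H]) ▷ H ≫ (α_ H H H).hom ≫ H ◁ (β_ H H).hom ≫
      (α_ H H H).inv ≫ (mu H ≫ ε[H]) ▷ H ≫ (λ_ H).hom
  piR_eq :
    PiR H = (ρ_ H).inv ≫ H ◁ (eta H ≫ Δ[H]) ≫ (α_ H H H).inv ≫ (β_ H H).hom ▷ H ≫
      (α_ H H H).hom ≫ H ◁ (mu H ≫ ε[H]) ≫ (ρ_ H).hom
  antipode_conv_piL : conv (lam H) (PiL H) = lam H
  piR_conv_antipode : conv (PiR H) (lam H) = lam H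
  antipode_mul_mul :
    Δ[H] ▷ H ≫ (α_ H H H).hom ≫ (lam H ⊗ₘ mu H) ≫ mu H = PiR H ▷ H ≫ mu H
  mul_antipode_mul :
    Δ[H] ▷ H ≫ (α_ H H H).hom ≫ H ◁ (lam H ▷ H ≫ mu H) ≫ mu H = PiL H ▷ H ≫ mu H
  mul_mul_antipode :
    H ◁ Δ[H] ≫ (α_ H H H).inv ≫ (mu H ⊗ₘ lam H) ≫ mu H = H ◁ PiL H ≫ mu H
  mul_antipode_mul' :
    H ◁ Δ[H] ≫ (α_ H H H).inv ≫ (H ◁ lam H ≫ mu H) ▷ H ≫ mu H = H ◁ PiR H ≫ mu H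

/-- A weak Hopf algebra: a weak Hopf quasigroup whose product is associative. -/
class WeakHopfAlgebra (H : C) extends WeakHopfQuasigroup H where
  mul_assoc : mu H ▷ H ≫ mu H = (α_ H H H).hom ≫ H ◁ mu H ≫ mu H

/-- A Hopf quasigroup in a braided monoidal category. -/
class HopfQuasigroup (H : C) extends HopfSignature H where
  one_counit : eta H ≫ ε[H] = 𝟙 (𝟙_ C)
  mul_counit : mu H ≫ ε[H] = (ε[H] ⊗ₘ ε[H]) ≫ (λ_ (𝟙_ C)).hom
  one_comul : eta H ≫ Δ[H] = (λ_ (𝟙_ C)).inv ≫ (eta H ⊗ₘ eta H)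
  mul_comul : mu H ≫ Δ[H] = (Δ[H] ⊗ₘ Δ[H]) ≫ tensorμ H H H H ≫ (mu H ⊗ₘ mu H)
  antipode_mul_mul :
    Δ[H] ▷ H ≫ (α_ H H H).hom ≫ (lam H ⊗ₘ mu H) ≫ mu H = ε[H] ▷ H ≫ (λ_ H).hom
  mul_antipode_mul :
    Δ[H] ▷ H ≫ (α_ H H H).hom ≫ H ◁ (lam H ▷ H ≫ mu H) ≫ mu H =
      ε[H] ▷ H ≫ (λ_ H).hom
  mul_antipode_mul' :
    H ◁ Δ[H] ≫ (α_ H H H).inv ≫ (H ◁ lam H ≫ mu H) ▷ H ≫ mu H =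
      H ◁ ε[H] ≫ (ρ_ H).hom
  mul_mul_antipode :
    H ◁ Δ[H] ≫ (α_ H H H).inv ≫ (mu H ⊗ₘ lam H) ≫ mu H = H ◁ ε[H] ≫ (ρ_ H).hom

/-- `(B, ρ)` is a right comodule magma over the weak Hopf quasigroup `H`. If `B` is a monoid, this
says that `(B, ρ)` is a right `H`-comodule monoid. -/
structure IsComoduleMagma {H B : C} [HopfSignature H] [UnitalMagmaObj B] (ρ : B ⟶ B ⊗ H) :
    Prop where
  comodule : IsComodule H ρ
  mul_coact : mu B ≫ ρ = (ρ ⊗ₘ ρ) ≫ tensorμ B H B H ≫ (mu B ⊗ₘ mu H)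
  one_coact : eta B ≫ ρ ≫ B ◁ PiL H = eta B ≫ ρ

/-- `(B, ρ)` is a right comodule magma over the Hopf quasigroup (or Hopf algebra) `H`. If `B` is a
monoid, this says that `(B, ρ)` is a right `H`-comodule monoid. -/
structure IsHopfComoduleMagma {H B : C} [HopfSignature H] [UnitalMagmaObj B] (ρ : B ⟶ B ⊗ H) :
    Prop where
  comodule : IsComodule H ρ
  mul_coact : mu B ≫ ρ = (ρ ⊗ₘ ρ) ≫ tensorμ B H B H ≫ (mu B ⊗ₘ mu H)
  one_coact : eta B ≫ ρ = (λ_ (𝟙_ C)).inv ≫ (eta B ⊗ₘ eta H)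

/-- `h : H ⟶ B` is a multiplicative total integral: a morphism of right `H`-comodules and of
unital magmas. -/
structure IsMultiplicativeTotalIntegral {H B : C} [HopfSignature H] [UnitalMagmaObj B]
    (ρ : B ⟶ B ⊗ H) (h : H ⟶ B) : Prop where
  colinear : h ≫ ρ = Δ[H] ≫ h ▷ H
  one_hom : eta H ≫ h = eta B
  mul_hom : mu H ≫ h = (h ⊗ₘ h) ≫ mu B

/-- `h : H ⟶ B` is an anchor morphism. -/
structure IsAnchor {H B : C} [HopfSignature H] [UnitalMagmaObj B]
    (ρ : B ⟶ B ⊗ H) (h : H ⟶ B) : Prop extends IsMultiplicativeTotalIntegral ρ h where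
  mul_piL :
    B ◁ Δ[H] ≫ (α_ B H H).inv ≫ ((B ◁ h ≫ mu B) ⊗ₘ (lam H ≫ h)) ≫ mu B =
      B ◁ (PiL H ≫ h) ≫ mu B
  mul_piR :
    B ◁ Δ[H] ≫ (α_ B H H).inv ≫ ((B ◁ (lam H ≫ h) ≫ mu B) ⊗ₘ h) ≫ mu B =
      B ◁ (PiR H ≫ h) ≫ mu B

/-- An object `X` with an action `X ⊗ B ⟶ X` and a coaction `X ⟶ X ⊗ H`, before any axiom. -/
structure Triple (B H : C) where
  X : C
  act : X ⊗ B ⟶ X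
  coact : X ⟶ X ⊗ H

/-- The endomorphism `q = act ∘ (X ⊗ (h ∘ antipode)) ∘ coact` whose image is the object of
coinvariants of `X`. -/
def coinvMap {H B X : C} [HopfSignature H] (h : H ⟶ B) (act : X ⊗ B ⟶ X) (coact : X ⟶ X ⊗ H) :
    X ⟶ X :=
  coact ≫ X ◁ (lam H ≫ h) ≫ act

/-- A choice `(B^coH, i, p)` of the image of `q_B`, the object of coinvariants of `B`. -/
abbrev Coinvariants {H B : C} [HopfSignature H] [UnitalMagmaObj B] (ρ : B ⟶ B ⊗ H) (h : H ⟶ B) :=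
  Splitting (coinvMap h (mu B) ρ)

/-- The two partial associativity conditions on `B` (in the second and in the first variable along
the inclusion of the coinvariants). -/
structure CoinvariantsAssociate {H B : C} [HopfSignature H] [UnitalMagmaObj B]
    {ρ : B ⟶ B ⊗ H} {h : H ⟶ B} (S : Coinvariants ρ h) : Prop where
  middle : (B ◁ S.i ≫ mu B) ▷ B ≫ mu B = (α_ B S.obj B).hom ≫ B ◁ (S.i ▷ B ≫ mu B) ≫ mu B
  left : (α_ S.obj B B).hom ≫ (S.i ⊗ₘ mu B) ≫ mu B = (S.i ▷ B ≫ mu B) ▷ B ≫ mu B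

section StrongHopfModule

/-- A strong `(H, B, h)`-Hopf module. -/
structure StrongHopfModule {H B : C} [HopfSignature H] [UnitalMagmaObj B] {ρ : B ⟶ B ⊗ H}
    {h : H ⟶ B} (S : Coinvariants ρ h) extends Triple B H where
  comodule : IsComodule H coact
  act_one : X ◁ eta B ≫ act = (ρ_ X).hom
  act_coinv : (X ◁ S.i ≫ act) ▷ B ≫ act = (α_ X S.obj B).hom ≫ X ◁ (S.i ▷ B ≫ mu B) ≫ act
  act_coact : act ≫ coact = (coact ⊗ₘ ρ) ≫ tensorμ X H B H ≫ (act ⊗ₘ mu H)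
  act_piL :
    X ◁ Δ[H] ≫ (α_ X H H).inv ≫ ((X ◁ h ≫ act) ⊗ₘ (lam H ≫ h)) ≫ act =
      X ◁ (PiL H ≫ h) ≫ act
  act_piR :
    X ◁ Δ[H] ≫ (α_ X H H).inv ≫ ((X ◁ (lam H ≫ h) ≫ act) ⊗ₘ h) ≫ act =
      X ◁ (PiR H ≫ h) ≫ act

namespace StrongHopfModule

variable {H B : C} [HopfSignature H] [UnitalMagmaObj B] {ρ : B ⟶ B ⊗ H} {h : H ⟶ B}
  {S : Coinvariants ρ h} [HasCoequalizers C]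

/-- The data attached to a strong Hopf module `M`: its object of coinvariants `M^coH`, the action
of `B^coH` on it, the tensor product of `M^coH` and `B` over `B^coH` (a coequalizer) with the
action of `B` induced by the product of `B`, and the isomorphism `ω` from this tensor product
to `M`. -/
structure DeformationData (M : StrongHopfModule S) where
  split : Splitting (coinvMap h M.act M.coact)
  coinvAct : split.obj ⊗ S.obj ⟶ split.obj
  coinvAct_i : coinvAct ≫ split.i = (split.i ⊗ₘ S.i) ≫ M.act
  tensorAct :
    coequalizer (coinvAct ▷ B)
        ((α_ split.obj S.obj B).hom ≫ split.obj ◁ (S.i ▷ B ≫ mu B)) ⊗ B ⟶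
      coequalizer (coinvAct ▷ B)
        ((α_ split.obj S.obj B).hom ≫ split.obj ◁ (S.i ▷ B ≫ mu B))
  π_tensorAct :
    coequalizer.π (coinvAct ▷ B)
        ((α_ split.obj S.obj B).hom ≫ split.obj ◁ (S.i ▷ B ≫ mu B)) ▷ B ≫ tensorAct =
      (α_ split.obj B B).hom ≫ split.obj ◁ mu B ≫
        coequalizer.π (coinvAct ▷ B)
          ((α_ split.obj S.obj B).hom ≫ split.obj ◁ (S.i ▷ B ≫ mu B))
  ω :
    coequalizer (coinvAct ▷ B)
      ((α_ split.obj S.obj B).hom ≫ split.obj ◁ (S.i ▷ B ≫ mu B)) ≅ M.X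
  π_ω :
    coequalizer.π (coinvAct ▷ B)
        ((α_ split.obj S.obj B).hom ≫ split.obj ◁ (S.i ▷ B ≫ mu B)) ≫ ω.hom =
      split.i ▷ B ≫ M.act

/-- `ψ` is the action on `M` transported along `ω` from the tensor product of `M^coH` and `B`
over `B^coH`. -/
def IsDeformedAction (M : StrongHopfModule S) (ψ : M.X ⊗ B ⟶ M.X) : Prop :=
  ∃ D : DeformationData M, ψ = D.ω.inv ▷ B ≫ D.tensorAct ≫ D.ω.hom

open Classical in
/-- The deformed action on `M`. In the situations considered in the main theorem there is exactly
one deformed action on each strong Hopf module, as asserted there; the value in the remaining case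
is irrelevant. -/
noncomputable def deformedAct (M : StrongHopfModule S) : M.X ⊗ B ⟶ M.X :=
  if hM : ∃ ψ, IsDeformedAction M ψ then hM.choose else M.act

/-- Morphisms of strong Hopf modules: colinear morphisms that are quasilinear, which means linear
for the deformed actions. -/
@[ext]
structure Hom (M N : StrongHopfModule S) where
  hom : M.X ⟶ N.X
  colinear : hom ≫ N.coact = M.coact ≫ hom ▷ H
  quasilinear : hom ▷ B ≫ N.deformedAct = M.deformedAct ≫ hom

/-- The category of strong `(H, B, h)`-Hopf modules. -/
instance : Category (StrongHopfModule S) where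
  Hom M N := Hom M N
  id M := ⟨𝟙 M.X, by simp, by simp⟩
  comp f g := ⟨f.hom ≫ g.hom, by
    rw [Category.assoc, g.colinear, ← Category.assoc, f.colinear, Category.assoc,
      comp_whiskerRight], by
    rw [comp_whiskerRight, Category.assoc, g.quasilinear, ← Category.assoc, f.quasilinear,
      Category.assoc]⟩
  id_comp _ := Hom.ext (Category.id_comp _)
  comp_id _ := Hom.ext (Category.comp_id _)
  assoc _ _ _ := Hom.ext (Category.assoc _ _ _)

/-- The forgetful functor to the base category. -/
def forget (S : Coinvariants ρ h) : StrongHopfModule S ⥤ C where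
  obj M := M.X
  map f := f.hom

end StrongHopfModule

end StrongHopfModule

section HopfModule

/-- A right `(H, B)`-Hopf module (Doi-Hopf module), for `B` with an associative product. -/
structure HopfModule {H B : C} [HopfSignature H] [UnitalMagmaObj B] (ρ : B ⟶ B ⊗ H)
    extends Triple B H where
  comodule : IsComodule H coact
  act_one : X ◁ eta B ≫ act = (ρ_ X).hom
  act_mul : act ▷ B ≫ act = (α_ X B B).hom ≫ X ◁ mu B ≫ act
  act_coact : act ≫ coact = (coact ⊗ₘ ρ) ≫ tensorμ X H B H ≫ (act ⊗ₘ mu H)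

namespace HopfModule

variable {H B : C} [HopfSignature H] [UnitalMagmaObj B] {ρ : B ⟶ B ⊗ H}

/-- Morphisms of Hopf modules: `B`-linear and `H`-colinear morphisms. -/
@[ext]
structure Hom (M N : HopfModule ρ) where
  hom : M.X ⟶ N.X
  colinear : hom ≫ N.coact = M.coact ≫ hom ▷ H
  linear : hom ▷ B ≫ N.act = M.act ≫ hom

/-- The category of right `(H, B)`-Hopf modules. -/
instance : Category (HopfModule ρ) where
  Hom M N := Hom M N
  id M := ⟨𝟙 M.X, by simp, by simp⟩
  comp f g := ⟨f.hom ≫ g.hom, by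
    rw [Category.assoc, g.colinear, ← Category.assoc, f.colinear, Category.assoc,
      comp_whiskerRight], by
    rw [comp_whiskerRight, Category.assoc, g.linear, ← Category.assoc, f.linear,
      Category.assoc]⟩
  id_comp _ := Hom.ext (Category.id_comp _)
  comp_id _ := Hom.ext (Category.comp_id _)
  assoc _ _ _ := Hom.ext (Category.assoc _ _ _)

end HopfModule

end HopfModule

section QuasigroupHopfModule

/-- A Hopf module over a Hopf quasigroup, in the sense of Brzezinski. -/
structure QuasigroupHopfModule (H : C) [HopfSignature H] extends Triple H H where
  comodule : IsComodule H coact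
  act_one : X ◁ eta H ≫ act = (ρ_ X).hom
  act_coact : act ≫ coact = (coact ⊗ₘ Δ[H]) ≫ tensorμ X H H H ≫ (act ⊗ₘ mu H)
  act_antipode :
    X ◁ Δ[H] ≫ (α_ X H H).inv ≫ (act ⊗ₘ lam H) ≫ act = X ◁ ε[H] ≫ (ρ_ X).hom
  antipode_act :
    X ◁ Δ[H] ≫ (α_ X H H).inv ≫ (X ◁ lam H ≫ act) ▷ H ≫ act = X ◁ ε[H] ≫ (ρ_ X).hom

namespace QuasigroupHopfModule

variable {H : C} [HopfSignature H]

/-- The morphism `m ⊗ a ↦ (m₀ · S(m₁)) · (m₂ a)`. -/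
def quasiAct (M : QuasigroupHopfModule H) : M.X ⊗ H ⟶ M.X :=
  M.coact ▷ H ≫ (α_ M.X H H).hom ≫ (coinvMap (𝟙 H) M.act M.coact ⊗ₘ mu H) ≫ M.act

/-- Morphisms of Hopf modules over a Hopf quasigroup: quasilinear and colinear morphisms. -/
@[ext]
structure Hom (M N : QuasigroupHopfModule H) where
  hom : M.X ⟶ N.X
  colinear : hom ≫ N.coact = M.coact ≫ hom ▷ H
  quasilinear : hom ▷ H ≫ N.quasiAct = M.quasiAct ≫ hom

/-- The category of Hopf modules over a Hopf quasigroup. -/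
instance : Category (QuasigroupHopfModule H) where
  Hom M N := Hom M N
  id M := ⟨𝟙 M.X, by simp, by simp⟩
  comp f g := ⟨f.hom ≫ g.hom, by
    rw [Category.assoc, g.colinear, ← Category.assoc, f.colinear, Category.assoc,
      comp_whiskerRight], by
    rw [comp_whiskerRight, Category.assoc, g.quasilinear, ← Category.assoc, f.quasilinear,
      Category.assoc]⟩
  id_comp _ := Hom.ext (Category.id_comp _)
  comp_id _ := Hom.ext (Category.comp_id _)
  assoc _ _ _ := Hom.ext (Category.assoc _ _ _)

variable (H) in
/-- The forgetful functor to the base category. -/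
def forget : QuasigroupHopfModule H ⥤ C where
  obj M := M.X
  map f := f.hom

end QuasigroupHopfModule

end QuasigroupHopfModule

end DoiHopf

open DoiHopf

/-! Everything reduces to one theorem about a weak Hopf quasigroup `H`, an anchor morphism `h : H ⟶
B` and a comodule magma `B` that is associative along its coinvariants (`IsAnchoredMagma`). In
element notation, with braidings suppressed, put `q(m) = m₀·hλ(m₁)`. Two identities drive the
argument. First, `m = q(m₀)·h(m₁)` (`coact_coinvMap_act`), so the coinvariants generate `M`. Second,
`q(m)·b` coacts as `q(m)·b₀ ⊗ b₁` (`coinvMap_act_coact`). The second one rests on the target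
morphism: the second leg of `λ(x₂)₁ ⊗ x₁λ(x₂)₂` is fixed by `Π^L` (`antipodeComul_piL`), and
`Π^L(x)y = ε(Π^L(x)y₁)y₂` (`piL_mul`).

It follows that `q` is idempotent, that `q(q(m)·b) = q(m)·q_B(b)`, and that `n ⊗ b ↦ i(n)·b` induces
an isomorphism from the tensor product over `B^coH` to `M`, with inverse `m ↦ p(m₀) ⊗ h(m₁)`.
Transporting the product of `B` along it gives the choice-free formula `m ⊗ b ↦ q(m₀)·(h(m₁)b)`,
called `quasiAct`; hence the deformed action exists and is unique. It has the same `q` as the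
original action, so morphisms of strong Hopf modules restrict to coinvariants.

The coinvariants functor is an equivalence. It is faithful because every map out of `M` is
determined on the products `i(n)·b`. It is full because a linear `k` on coinvariants extends to `m ↦
k(p(m₀))·h(m₁)`. It is essentially surjective because the balanced tensor product of a module `N`
with `B` inherits a strong structure from `B`, and its coinvariants are the image of `n ↦ n ⊗ 1`.

For the special cases: a Hopf algebra is a Hopf quasigroup, and a Hopf quasigroup is a weak one with
`Π^L = ηε`. If `B` is associative, the anchor and associativity conditions are automatic, a Hopf
module is its own deformation, and every strong Hopf module becomes a Hopf module under its deformed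
action, the identity being an isomorphism. For `B = H` one has `q_H = Π^L`, whose image associates
with all of `H` in the required positions; for a Hopf quasigroup this image is the unit object. -/

namespace DoiHopf

/-! ### String-diagram calculus: every map carries a spare strand `Z` on its right. -/

section Boxes

variable {C : Type u} [Category.{v} C] [MonoidalCategory.{v} C]

/-- A morphism with two inputs and one output, acting on the first factors of an iterated tensor
product which is bracketed to the right. -/
def box21 {A B D : C} (f : A ⊗ B ⟶ D) (Z : C) : A ⊗ (B ⊗ Z) ⟶ D ⊗ Z :=
  (α_ A B Z).inv ≫ f ▷ Z

/-- A morphism with one input and two outputs, acting on the first factor. -/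
def box12 {A B D : C} (f : A ⟶ B ⊗ D) (Z : C) : A ⊗ Z ⟶ B ⊗ (D ⊗ Z) :=
  f ▷ Z ≫ (α_ B D Z).hom

/-- A morphism to the unit object, acting on the first factor. -/
def box10 {A : C} (f : A ⟶ 𝟙_ C) (Z : C) : A ⊗ Z ⟶ Z := f ▷ Z ≫ (λ_ Z).hom

/-- A morphism from the unit object, creating a first factor. -/
def box01 {A : C} (f : 𝟙_ C ⟶ A) (Z : C) : Z ⟶ A ⊗ Z := (λ_ Z).inv ≫ f ▷ Z

theorem box21_exchange {A B D : C} (f : A ⊗ B ⟶ D) {Y Z : C} (g : Y ⟶ Z) :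
    box21 f Y ≫ D ◁ g = A ◁ B ◁ g ≫ box21 f Z := by
  simp [box21, ← whisker_exchange]

theorem box12_exchange {A B D : C} (f : A ⟶ B ⊗ D) {Y Z : C} (g : Y ⟶ Z) :
    box12 f Y ≫ B ◁ D ◁ g = A ◁ g ≫ box12 f Z := by
  simp [box12, whisker_exchange_assoc]

theorem box10_exchange {A : C} (f : A ⟶ 𝟙_ C) {Y Z : C} (g : Y ⟶ Z) :
    box10 f Y ≫ g = A ◁ g ≫ box10 f Z := by
  simp [box10, whisker_exchange_assoc]

theorem box01_exchange {A : C} (f : 𝟙_ C ⟶ A) {Y Z : C} (g : Y ⟶ Z) :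
    box01 f Y ≫ A ◁ g = g ≫ box01 f Z := by
  simp [box01, ← whisker_exchange]

variable [BraidedCategory.{v} C]

/-- The braiding of the first two factors. -/
def braid (A B Z : C) : A ⊗ (B ⊗ Z) ⟶ B ⊗ (A ⊗ Z) :=
  (α_ A B Z).inv ≫ (β_ A B).hom ▷ Z ≫ (α_ B A Z).hom

/-- The inverse of `braid A B Z`. -/
def braidInv (A B Z : C) : B ⊗ (A ⊗ Z) ⟶ A ⊗ (B ⊗ Z) :=
  (α_ B A Z).inv ≫ (β_ A B).inv ▷ Z ≫ (α_ A B Z).hom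

theorem braid_inv (A B Z : C) : braid A B Z ≫ braidInv A B Z = 𝟙 _ := by
  simp [braid, braidInv]

theorem inv_braid (A B Z : C) : braidInv A B Z ≫ braid A B Z = 𝟙 _ := by
  simp [braid, braidInv]

theorem braid_left {A A' : C} (f : A ⟶ A') (B Z : C) :
    f ▷ (B ⊗ Z) ≫ braid A' B Z = braid A B Z ≫ B ◁ (f ▷ Z) := by
  simp only [braid, Category.assoc, ← associator_naturality_middle, ← comp_whiskerRight_assoc,
    ← BraidedCategory.braiding_naturality_left]
  simp [-BraidedCategory.braiding_naturality_left]

theorem braid_right {B B' : C} (f : B ⟶ B') (A Z : C) :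
    A ◁ (f ▷ Z) ≫ braid A B' Z = braid A B Z ≫ f ▷ (A ⊗ Z) := by
  simp only [braid, Category.assoc, ← associator_naturality_left, ← comp_whiskerRight_assoc,
    ← BraidedCategory.braiding_naturality_right]
  simp [-BraidedCategory.braiding_naturality_right]

theorem braid_exchange (A B : C) {Y Z : C} (g : Y ⟶ Z) :
    braid A B Y ≫ B ◁ A ◁ g = A ◁ B ◁ g ≫ braid A B Z := by
  simp only [braid, Category.assoc, ← associator_naturality_right]
  simp only [← whisker_exchange_assoc, ← associator_inv_naturality_right_assoc]

theorem braidInv_exchange (A B : C) {Y Z : C} (g : Y ⟶ Z) :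
    braidInv A B Y ≫ A ◁ B ◁ g = B ◁ A ◁ g ≫ braidInv A B Z := by
  simp only [braidInv, Category.assoc, ← associator_naturality_right]
  simp only [← whisker_exchange_assoc, ← associator_inv_naturality_right_assoc]

/-- The hexagon identities together with naturality: here and in the next three lemmas a strand
passes over or under a vertex. `exchange` only contains naturality in morphisms with one input and
one output, so these moves are applied by hand. -/
theorem box21_braid {A A' D : C} (f : A ⊗ A' ⟶ D) (B Z : C) :
    box21 f (B ⊗ Z) ≫ braid D B Z = A ◁ braid A' B Z ≫ braid A B (A' ⊗ Z) ≫ B ◁ box21 f Z := by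
  simp only [box21, Category.assoc, braid_left]
  simp [braid, BraidedCategory.braiding_tensor_left_hom]

theorem whiskerLeft_box21_braid {B B' D : C} (f : B ⊗ B' ⟶ D) (A Z : C) :
    A ◁ box21 f Z ≫ braid A D Z = braid A B (B' ⊗ Z) ≫ B ◁ braid A B' Z ≫ box21 f (A ⊗ Z) := by
  simp only [box21, whiskerLeft_comp, Category.assoc, braid_right]
  simp [braid, BraidedCategory.braiding_tensor_right_hom]

theorem box12_braid {A D E : C} (f : A ⟶ D ⊗ E) (B Z : C) :
    box12 f (B ⊗ Z) ≫ D ◁ braid E B Z ≫ braid D B (E ⊗ Z) = braid A B Z ≫ B ◁ box12 f Z := by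
  simp only [box12, whiskerLeft_comp, ← reassoc_of% braid_left, Category.assoc]
  simp [braid, BraidedCategory.braiding_tensor_left_hom]

theorem whiskerLeft_box12_braid {B D E : C} (f : B ⟶ D ⊗ E) (A Z : C) :
    A ◁ box12 f Z ≫ braid A D (E ⊗ Z) ≫ D ◁ braid A E Z = braid A B Z ≫ box12 f (A ⊗ Z) := by
  simp only [box12, whiskerLeft_comp, ← reassoc_of% braid_right, Category.assoc]
  simp [braid, BraidedCategory.braiding_tensor_right_hom]

theorem braid_whiskerLeft_box10 {A : C} (f : A ⟶ 𝟙_ C) (B Z : C) :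
    braid A B Z ≫ B ◁ box10 f Z = box10 f (B ⊗ Z) := by
  simp only [box10, whiskerLeft_comp, ← reassoc_of% braid_left]
  simp [braid]

theorem braid_box10 {B : C} (f : B ⟶ 𝟙_ C) (A Z : C) :
    braid A B Z ≫ box10 f (A ⊗ Z) = A ◁ box10 f Z := by
  simp only [box10, whiskerLeft_comp, ← reassoc_of% braid_right]
  simp [braid]

theorem box01_braid {A : C} (f : 𝟙_ C ⟶ A) (B Z : C) :
    box01 f (B ⊗ Z) ≫ braid A B Z = B ◁ box01 f Z := by
  simp only [box01, whiskerLeft_comp, Category.assoc, braid_left]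
  simp [braid]

theorem whiskerLeft_box01_braid {B : C} (f : 𝟙_ C ⟶ B) (A Z : C) :
    A ◁ box01 f Z ≫ braid A B Z = box01 f (A ⊗ Z) := by
  simp only [box01, whiskerLeft_comp, Category.assoc, braid_right]
  simp [braid]

/-- The interchange law, oriented so that operations on factors further to the right come first,
together with the collection of whiskerings and the naturality of the braiding. -/
theorem exchange :
    (∀ {X Y Z : C} (W : C) (f : X ⟶ Y) (g : Y ⟶ Z), W ◁ f ≫ W ◁ g = W ◁ (f ≫ g)) ∧
    (∀ {X Y Z V : C} (W : C) (f : X ⟶ Y) (g : Y ⟶ Z) (k : W ⊗ Z ⟶ V),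
      W ◁ f ≫ W ◁ g ≫ k = W ◁ (f ≫ g) ≫ k) ∧
    (∀ {W X Y Z : C} (f : W ⟶ X) (g : Y ⟶ Z), f ▷ Y ≫ X ◁ g = W ◁ g ≫ f ▷ Z) ∧
    (∀ {W X Y Z V : C} (f : W ⟶ X) (g : Y ⟶ Z) (k : X ⊗ Z ⟶ V),
      f ▷ Y ≫ X ◁ g ≫ k = W ◁ g ≫ f ▷ Z ≫ k) ∧
    (∀ {X Y Z : C} (f : X ⟶ Y) (g : Y ⟶ Z) (W : C), (f ≫ g) ▷ W = f ▷ W ≫ g ▷ W) ∧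
    (∀ (X Y : C), X ◁ 𝟙 Y = 𝟙 (X ⊗ Y)) ∧
    (∀ (X Y : C), 𝟙 X ▷ Y = 𝟙 (X ⊗ Y)) ∧
    (∀ {A B D : C} (f : A ⊗ B ⟶ D) {Y Z : C} (g : Y ⟶ Z),
      box21 f Y ≫ D ◁ g = A ◁ B ◁ g ≫ box21 f Z) ∧
    (∀ {A B D : C} (f : A ⊗ B ⟶ D) {Y Z V : C} (g : Y ⟶ Z) (k : D ⊗ Z ⟶ V),
      box21 f Y ≫ D ◁ g ≫ k = A ◁ B ◁ g ≫ box21 f Z ≫ k) ∧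
    (∀ {A B D : C} (f : A ⟶ B ⊗ D) {Y Z : C} (g : Y ⟶ Z),
      box12 f Y ≫ B ◁ D ◁ g = A ◁ g ≫ box12 f Z) ∧
    (∀ {A B D : C} (f : A ⟶ B ⊗ D) {Y Z V : C} (g : Y ⟶ Z) (k : B ⊗ (D ⊗ Z) ⟶ V),
      box12 f Y ≫ B ◁ D ◁ g ≫ k = A ◁ g ≫ box12 f Z ≫ k) ∧
    (∀ {A B D : C} (f : A ⟶ B ⊗ D) {Y Z W : C} (g : Y ⟶ Z) (k : D ⊗ Z ⟶ W),
      box12 f Y ≫ B ◁ (D ◁ g ≫ k) = A ◁ g ≫ box12 f Z ≫ B ◁ k) ∧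
    (∀ {A B D : C} (f : A ⟶ B ⊗ D) {Y Z W V : C} (g : Y ⟶ Z) (k : D ⊗ Z ⟶ W) (l : B ⊗ W ⟶ V),
      box12 f Y ≫ B ◁ (D ◁ g ≫ k) ≫ l = A ◁ g ≫ box12 f Z ≫ B ◁ k ≫ l) ∧
    (∀ (A B : C) {Y Z : C} (g : Y ⟶ Z), braid A B Y ≫ B ◁ A ◁ g = A ◁ B ◁ g ≫ braid A B Z) ∧
    (∀ (A B : C) {Y Z V : C} (g : Y ⟶ Z) (k : B ⊗ (A ⊗ Z) ⟶ V),
      braid A B Y ≫ B ◁ A ◁ g ≫ k = A ◁ B ◁ g ≫ braid A B Z ≫ k) ∧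
    (∀ (A B : C) {Y Z W : C} (g : Y ⟶ Z) (k : A ⊗ Z ⟶ W),
      braid A B Y ≫ B ◁ (A ◁ g ≫ k) = A ◁ B ◁ g ≫ braid A B Z ≫ B ◁ k) ∧
    (∀ (A B : C) {Y Z W V : C} (g : Y ⟶ Z) (k : A ⊗ Z ⟶ W) (l : B ⊗ W ⟶ V),
      braid A B Y ≫ B ◁ (A ◁ g ≫ k) ≫ l = A ◁ B ◁ g ≫ braid A B Z ≫ B ◁ k ≫ l) ∧
    (∀ (A B : C) {Y Z : C} (g : Y ⟶ Z),
      braidInv A B Y ≫ A ◁ B ◁ g = B ◁ A ◁ g ≫ braidInv A B Z) ∧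
    (∀ (A B : C) {Y Z V : C} (g : Y ⟶ Z) (k : A ⊗ (B ⊗ Z) ⟶ V),
      braidInv A B Y ≫ A ◁ B ◁ g ≫ k = B ◁ A ◁ g ≫ braidInv A B Z ≫ k) ∧
    (∀ (A B : C) {Y Z W : C} (g : Y ⟶ Z) (k : B ⊗ Z ⟶ W),
      braidInv A B Y ≫ A ◁ (B ◁ g ≫ k) = B ◁ A ◁ g ≫ braidInv A B Z ≫ A ◁ k) ∧
    (∀ (A B : C) {Y Z W V : C} (g : Y ⟶ Z) (k : B ⊗ Z ⟶ W) (l : A ⊗ W ⟶ V),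
      braidInv A B Y ≫ A ◁ (B ◁ g ≫ k) ≫ l = B ◁ A ◁ g ≫ braidInv A B Z ≫ A ◁ k ≫ l) ∧
    (∀ {A : C} (f : A ⟶ 𝟙_ C) {Y Z : C} (g : Y ⟶ Z), box10 f Y ≫ g = A ◁ g ≫ box10 f Z) ∧
    (∀ {A : C} (f : 𝟙_ C ⟶ A) {Y Z : C} (g : Y ⟶ Z), box01 f Y ≫ A ◁ g = g ≫ box01 f Z) ∧
    (∀ {A : C} (f : 𝟙_ C ⟶ A) {Y Z V : C} (g : Y ⟶ Z) (k : A ⊗ Z ⟶ V),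
      box01 f Y ≫ A ◁ g ≫ k = g ≫ box01 f Z ≫ k) ∧
    (∀ {A A' : C} (f : A ⟶ A') (B Z : C),
      braid A B Z ≫ B ◁ (f ▷ Z) = f ▷ (B ⊗ Z) ≫ braid A' B Z) ∧
    (∀ {A A' : C} (f : A ⟶ A') (B : C) {Z V : C} (k : B ⊗ (A' ⊗ Z) ⟶ V),
      braid A B Z ≫ B ◁ (f ▷ Z) ≫ k = f ▷ (B ⊗ Z) ≫ braid A' B Z ≫ k) ∧
    (∀ {A A' : C} (f : A ⟶ A') (B : C) {Z W : C} (k : A' ⊗ Z ⟶ W),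
      braid A B Z ≫ B ◁ (f ▷ Z ≫ k) = f ▷ (B ⊗ Z) ≫ braid A' B Z ≫ B ◁ k) ∧
    (∀ {A A' : C} (f : A ⟶ A') (B : C) {Z W V : C} (k : A' ⊗ Z ⟶ W) (l : B ⊗ W ⟶ V),
      braid A B Z ≫ B ◁ (f ▷ Z ≫ k) ≫ l = f ▷ (B ⊗ Z) ≫ braid A' B Z ≫ B ◁ k ≫ l) ∧
    (∀ {B B' : C} (f : B ⟶ B') (A Z : C),
      braid A B Z ≫ f ▷ (A ⊗ Z) = A ◁ (f ▷ Z) ≫ braid A B' Z) ∧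
    (∀ {B B' : C} (f : B ⟶ B') (A : C) {Z V : C} (k : B' ⊗ (A ⊗ Z) ⟶ V),
      braid A B Z ≫ f ▷ (A ⊗ Z) ≫ k = A ◁ (f ▷ Z) ≫ braid A B' Z ≫ k) ∧
    (∀ {B B' : C} (f : B ⟶ B') (A : C) {Z W : C} (k : A ⊗ Z ⟶ W),
      braid A B Z ≫ B ◁ k ≫ f ▷ W = A ◁ (f ▷ Z) ≫ braid A B' Z ≫ B' ◁ k) ∧
    (∀ {B B' : C} (f : B ⟶ B') (A : C) {Z W V : C} (k : A ⊗ Z ⟶ W) (l : B' ⊗ W ⟶ V),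
      braid A B Z ≫ B ◁ k ≫ f ▷ W ≫ l = A ◁ (f ▷ Z) ≫ braid A B' Z ≫ B' ◁ k ≫ l) := by
  and_intros <;> intros <;> first
    | (simp only [← whiskerLeft_comp, ← whiskerLeft_comp_assoc, whisker_exchange,
        whisker_exchange_assoc, comp_whiskerRight, whiskerLeft_id, id_whiskerRight]; done)
    | simp only [whiskerLeft_comp, Category.assoc, box21_exchange, reassoc_of% box21_exchange,
        box12_exchange, reassoc_of% box12_exchange, braid_exchange, reassoc_of% braid_exchange,
        braidInv_exchange, reassoc_of% braidInv_exchange, box01_exchange, reassoc_of% box01_exchange,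
        braid_left, reassoc_of% braid_left, braid_right, reassoc_of% braid_right, ← box10_exchange,
        whisker_exchange, whisker_exchange_assoc]

end Boxes

end DoiHopf

/-! ### Translation between ordinary identities and boxes. -/

namespace DoiHopf

section Translation

variable {C : Type u} [Category.{v} C] [MonoidalCategory.{v} C]

/-- The unit object is one of the strands `Z`, and whiskering by it is faithful. This is the way
back from the calculus. -/
theorem eq_of_whiskerRight {X Y : C} {f g : X ⟶ Y} (h : ∀ Z : C, f ▷ Z = g ▷ Z) : f = g :=
  (whiskerRight_iff f g).1 (h _)

theorem box12_comp {A B D E : C} (f : A ⟶ B) (g : B ⟶ D ⊗ E) (Z : C) :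
    box12 (f ≫ g) Z = f ▷ Z ≫ box12 g Z := by
  simp [box12]

theorem box21_comp {A B D E : C} (f : A ⊗ B ⟶ D) (g : D ⟶ E) (Z : C) :
    box21 (f ≫ g) Z = box21 f Z ≫ g ▷ Z := by
  simp [box21]

theorem box01_comp {A B : C} (f : 𝟙_ C ⟶ A) (g : A ⟶ B) (Z : C) :
    box01 (f ≫ g) Z = box01 f Z ≫ g ▷ Z := by
  simp [box01]

theorem box21_whiskerLeft_comp {A B D E : C} (f : B ⟶ D) (g : A ⊗ D ⟶ E) (Z : C) :
    box21 (A ◁ f ≫ g) Z = A ◁ f ▷ Z ≫ box21 g Z := by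
  simp [box21]

theorem box21_whiskerRight_comp {A B D E : C} (f : A ⟶ D) (g : D ⊗ B ⟶ E) (Z : C) :
    box21 (f ▷ B ≫ g) Z = f ▷ (B ⊗ Z) ≫ box21 g Z := by
  simp [box21]

theorem box21_tensorHom_comp {A B D E F : C} (f : A ⟶ D) (k : B ⟶ E) (g : D ⊗ E ⟶ F) (Z : C) :
    box21 ((f ⊗ₘ k) ≫ g) Z = f ▷ (B ⊗ Z) ≫ D ◁ k ▷ Z ≫ box21 g Z := by
  simp [box21, MonoidalCategory.tensorHom_def]

theorem box12_comp_whiskerRight {A B D E : C} (f : A ⟶ B ⊗ D) (g : B ⟶ E) (Z : C) :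
    box12 (f ≫ g ▷ D) Z = box12 f Z ≫ g ▷ (D ⊗ Z) := by
  simp [box12]

theorem box12_box10 {A B D : C} (f : A ⟶ B ⊗ D) (g : B ⟶ 𝟙_ C) (Z : C) :
    box12 f Z ≫ box10 g (D ⊗ Z) = (f ≫ g ▷ D ≫ (λ_ D).hom) ▷ Z := by
  simp [box12, box10]

theorem whiskerRight_conv {D A : C} [ComonObj D] [UnitalMagmaObj A] (f g : D ⟶ A) (Z : C) :
    conv f g ▷ Z = box12 Δ[D] Z ≫ D ◁ g ▷ Z ≫ f ▷ (A ⊗ Z) ≫ box21 (mu A) Z := by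
  simp [conv, box12, box21, tensorHom_def']

/-- Serves every compatibility between a product or action and a coproduct or coaction. -/
theorem box21_tensorμ_comp [BraidedCategory.{v} C] {A B D E H K Q R : C}
    (r₁ : A ⟶ D ⊗ H) (r₂ : B ⟶ E ⊗ K) (g : D ⊗ E ⟶ Q) (m : H ⊗ K ⟶ R) (Z : C) :
    box21 ((r₁ ⊗ₘ r₂) ≫ tensorμ D H E K ≫ (g ⊗ₘ m)) Z ≫ (α_ Q R Z).hom =
      A ◁ box12 r₂ Z ≫ box12 r₁ (E ⊗ (K ⊗ Z)) ≫
        D ◁ (braid H E (K ⊗ Z) ≫ E ◁ box21 m Z) ≫ box21 g (R ⊗ Z) := by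
  simp [tensorμ, tensorHom_def', box12, box21, braid]

theorem box21_comp_assoc {A B P Q R : C} (f : A ⊗ B ⟶ P) (r : P ⟶ Q ⊗ R) (Z : C) :
    box21 (f ≫ r) Z ≫ (α_ Q R Z).hom = box21 f Z ≫ box12 r Z := by
  simp [box21, box12]

/-- The product of the outputs of two morphisms with values in a tensor product. -/
theorem box21_box12 [BraidedCategory.{v} C] {A B D E H K P Q R : C} {f : A ⊗ B ⟶ P}
    {r : P ⟶ Q ⊗ R} {r₁ : A ⟶ D ⊗ H} {r₂ : B ⟶ E ⊗ K} {g : D ⊗ E ⟶ Q} {m : H ⊗ K ⟶ R}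
    (e : f ≫ r = (r₁ ⊗ₘ r₂) ≫ tensorμ D H E K ≫ (g ⊗ₘ m)) (Z : C) :
    box21 f Z ≫ box12 r Z = A ◁ box12 r₂ Z ≫ box12 r₁ (E ⊗ (K ⊗ Z)) ≫
      D ◁ (braid H E (K ⊗ Z) ≫ E ◁ box21 m Z) ≫ box21 g (R ⊗ Z) := by
  rw [← box21_comp_assoc, e, box21_tensorμ_comp]

variable {H B X : C}

theorem IsComodule.box_counit [ComonObj H] {r : X ⟶ X ⊗ H} (hr : IsComodule H r) (Z : C) :
    box12 r Z ≫ X ◁ box10 ε[H] Z = 𝟙 (X ⊗ Z) := by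
  have e := congrArg (fun f => f ▷ Z ≫ (ρ_ X).hom ▷ Z) hr.counit
  simpa [box12, box10] using e

theorem IsComodule.box_coassoc [ComonObj H] {r : X ⟶ X ⊗ H} (hr : IsComodule H r) (Z : C) :
    box12 r Z ≫ box12 r (H ⊗ Z) = box12 r Z ≫ X ◁ box12 Δ[H] Z := by
  have e := congrArg (fun f => f ▷ Z ≫ (α_ X (H ⊗ H) Z).hom ≫ X ◁ (α_ H H Z).hom) hr.coassoc
  simpa [box12] using e

theorem isComodule_comul [ComonObj H] : IsComodule H Δ[H] :=
  ⟨ComonObj.comul_counit H, by simp⟩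

theorem box_counit_comul [ComonObj H] (Z : C) :
    box12 Δ[H] Z ≫ box10 ε[H] (H ⊗ Z) = 𝟙 (H ⊗ Z) := by
  rw [box12_box10, ComonObj.counit_comul_assoc, Iso.inv_hom_id, id_whiskerRight]

theorem box_comul_counit [ComonObj H] (Z : C) :
    box12 Δ[H] Z ≫ H ◁ box10 ε[H] Z = 𝟙 (H ⊗ Z) :=
  isComodule_comul.box_counit Z

theorem box_coassoc [ComonObj H] (Z : C) :
    box12 Δ[H] Z ≫ box12 Δ[H] (H ⊗ Z) = box12 Δ[H] Z ≫ H ◁ box12 Δ[H] Z :=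
  isComodule_comul.box_coassoc Z

theorem box_one_mul [UnitalMagmaObj B] (Z : C) :
    box01 (eta B) (B ⊗ Z) ≫ box21 (mu B) Z = 𝟙 (B ⊗ Z) := by
  have e := congrArg (fun f => (λ_ B).inv ▷ Z ≫ f ▷ Z) (UnitalMagmaObj.one_mul (A := B))
  simpa [box01, box21] using e

theorem box_act_one [UnitalMagmaObj B] {a : X ⊗ B ⟶ X} (e : X ◁ eta B ≫ a = (ρ_ X).hom) (Z : C) :
    X ◁ box01 (eta B) Z ≫ box21 a Z = 𝟙 (X ⊗ Z) := by
  have e := congrArg (fun f => (ρ_ X).inv ▷ Z ≫ f ▷ Z) e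
  simpa [box01, box21] using e

theorem box_mul_one [UnitalMagmaObj B] (Z : C) :
    B ◁ box01 (eta B) Z ≫ box21 (mu B) Z = 𝟙 (B ⊗ Z) :=
  box_act_one UnitalMagmaObj.mul_one Z

end Translation

end DoiHopf

/-! ### Counital maps of a weak Hopf quasigroup. -/

namespace DoiHopf

namespace WeakHopfQuasigroup

variable {C : Type u} [Category.{v} C] [MonoidalCategory.{v} C]

section Counital

variable (H : C) [HopfSignature H]

/-- The morphism `x ⊗ y ↦ ε(x y₁) y₂`. -/
def counitT : H ⊗ H ⟶ H := H ◁ Δ[H] ≫ (α_ H H H).inv ≫ (mu H ≫ ε[H]) ▷ H ≫ (λ_ H).hom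

theorem box_counitT (Z : C) :
    box21 (counitT H) Z =
      H ◁ box12 Δ[H] Z ≫ box21 (mu H) (H ⊗ Z) ≫ box10 ε[H] (H ⊗ Z) := by
  simp [counitT, box21, box12, box10]

variable [BraidedCategory.{v} C]

/-- The morphism `x ⊗ y ↦ y₁ ε(x y₂)`. -/
def counitR : H ⊗ H ⟶ H :=
  H ◁ Δ[H] ≫ (α_ H H H).inv ≫ (β_ H H).hom ▷ H ≫ (α_ H H H).hom ≫ H ◁ (mu H ≫ ε[H]) ≫ (ρ_ H).hom

/-- The morphism `x ⊗ y ↦ ε(x₁ y) x₂`. -/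
def counitL : H ⊗ H ⟶ H :=
  Δ[H] ▷ H ≫ (α_ H H H).hom ≫ H ◁ (β_ H H).hom ≫ (α_ H H H).inv ≫ (mu H ≫ ε[H]) ▷ H ≫ (λ_ H).hom

theorem box_counitR (Z : C) :
    box21 (counitR H) Z =
      H ◁ box12 Δ[H] Z ≫ braid H H (H ⊗ Z) ≫ H ◁ (box21 (mu H) Z ≫ box10 ε[H] Z) := by
  simp [counitR, box21, box12, box10, braid]

theorem box_counitL (Z : C) :
    box21 (counitL H) Z =
      box12 Δ[H] (H ⊗ Z) ≫ H ◁ braid H H Z ≫ box21 (mu H) (H ⊗ Z) ≫ box10 ε[H] (H ⊗ Z) := by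
  simp [counitL, box21, box12, box10, braid]

/-- Coassociativity in the argument of which one leg survives; the same reason gives the two lemmas
that follow. -/
theorem counitT_comul (Z : C) :
    box21 (counitT H) Z ≫ box12 Δ[H] Z = H ◁ box12 Δ[H] Z ≫ box21 (counitT H) (H ⊗ Z) := by
  simp only [box_counitT, Category.assoc, exchange, box_coassoc]

theorem counitR_comul (Z : C) :
    box21 (counitR H) Z ≫ box12 Δ[H] Z =
      H ◁ box12 Δ[H] Z ≫ braid H H (H ⊗ Z) ≫ H ◁ box21 (counitR H) Z := by
  calc
    _ = H ◁ box12 Δ[H] Z ≫ (braid H H (H ⊗ Z) ≫ box12 Δ[H] (H ⊗ (H ⊗ Z))) ≫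
        H ◁ H ◁ (box21 (mu H) Z ≫ box10 ε[H] Z) := by
      simp only [box_counitR, Category.assoc, exchange]
    _ = _ := by
      rw [← whiskerLeft_box12_braid]
      simp only [box_counitR, Category.assoc, exchange, box_coassoc]

theorem counitL_comul (Z : C) :
    box21 (counitL H) Z ≫ box12 Δ[H] Z =
      box12 Δ[H] (H ⊗ Z) ≫ H ◁ braid H H Z ≫ box21 (counitL H) (H ⊗ Z) := by
  calc
    _ = box12 Δ[H] (H ⊗ Z) ≫ H ◁ (braid H H Z ≫ H ◁ box12 Δ[H] Z) ≫
        box21 (mu H) (H ⊗ (H ⊗ Z)) ≫ box10 ε[H] (H ⊗ (H ⊗ Z)) := by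
      simp only [box_counitL, Category.assoc, exchange]
    _ = _ := by
      rw [← box12_braid]
    _ = (box12 Δ[H] (H ⊗ Z) ≫ box12 Δ[H] (H ⊗ (H ⊗ Z))) ≫
        H ◁ (H ◁ braid H H Z ≫ braid H H (H ⊗ Z)) ≫
        box21 (mu H) (H ⊗ (H ⊗ Z)) ≫ box10 ε[H] (H ⊗ (H ⊗ Z)) := by
      rw [box_coassoc]
      simp only [Category.assoc, exchange]
    _ = _ := by
      simp only [box_counitL, Category.assoc, exchange]

end Counital

variable [BraidedCategory.{v} C] (H : C) [WeakHopfQuasigroup H]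

theorem box_mul_comul (Z : C) : box21 (mu H) Z ≫ box12 Δ[H] Z =
    H ◁ box12 Δ[H] Z ≫ box12 Δ[H] (H ⊗ (H ⊗ Z)) ≫
      H ◁ (braid H H (H ⊗ Z) ≫ H ◁ box21 (mu H) Z) ≫ box21 (mu H) (H ⊗ Z) :=
  box21_box12 mul_comul Z

theorem box_counit_mul_assoc (Z : C) :
    box21 (mu H) (H ⊗ Z) ≫ box21 (mu H) Z ≫ box10 ε[H] Z =
      H ◁ box21 (mu H) Z ≫ box21 (mu H) Z ≫ box10 ε[H] Z := by
  have e := congrArg (fun f => (α_ H H (H ⊗ Z)).inv ≫ (α_ (H ⊗ H) H Z).inv ≫ f ▷ Z ≫ (λ_ Z).hom)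
    (counit_mul_assoc (H := H))
  simpa [box21, box10] using e

theorem box_counitT_mul (Z : C) :
    box21 (counitT H) (H ⊗ Z) ≫ box21 (mu H) Z ≫ box10 ε[H] Z =
      box21 (mu H) (H ⊗ Z) ≫ box21 (mu H) Z ≫ box10 ε[H] Z := by
  have e := congrArg (fun f => (α_ H H (H ⊗ Z)).inv ≫ (α_ (H ⊗ H) H Z).inv ≫ f ▷ Z ≫ (λ_ Z).hom)
    (counit_mul_mul (H := H))
  simp only [MonoidalCategory.tensorHom_def] at e
  rw [box_counitT]
  simp at e
  simp [box21, box10, box12, e]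
  monoidal

/-- The map `f ≫ g` is scalar-valued and slides across the strand `B`, so an inverse crossing with
one of its inputs can be traded for a crossing with the other. -/
theorem braidInv_box20 {A A' D : C} (f : A ⊗ A' ⟶ D) (g : D ⟶ 𝟙_ C) (B Z : C) :
    A ◁ braidInv A' B Z ≫ box21 f (B ⊗ Z) ≫ box10 g (B ⊗ Z) =
      braid A B (A' ⊗ Z) ≫ B ◁ (box21 f Z ≫ box10 g Z) := by
  rw [← braid_whiskerLeft_box10, reassoc_of% box21_braid, ← whiskerLeft_comp_assoc, inv_braid]
  simp only [whiskerLeft_comp, whiskerLeft_id, Category.id_comp]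

theorem braid_box20 {A A' D : C} (f : A ⊗ A' ⟶ D) (g : D ⟶ 𝟙_ C) (B Z : C) :
    A ◁ braid B A' Z ≫ box21 f (B ⊗ Z) ≫ box10 g (B ⊗ Z) =
      braidInv B A (A' ⊗ Z) ≫ B ◁ (box21 f Z ≫ box10 g Z) := by
  rw [whiskerLeft_comp, ← braid_box10, reassoc_of% whiskerLeft_box21_braid, reassoc_of% inv_braid]

theorem box_counitR_mul (Z : C) :
    box21 (counitR H) (H ⊗ Z) ≫ box21 (mu H) Z ≫ box10 ε[H] Z =
      box21 (mu H) (H ⊗ Z) ≫ box21 (mu H) Z ≫ box10 ε[H] Z := by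
  have e := congrArg (fun f => (α_ H H (H ⊗ Z)).inv ≫ (α_ (H ⊗ H) H Z).inv ≫ f ▷ Z ≫ (λ_ Z).hom)
    (counit_mul_mul_braid (H := H))
  simp only [MonoidalCategory.tensorHom_def] at e
  rw [box_counitR, ← braidInv_box20]
  simp at e
  simp [box21, box10, box12, braidInv, e]
  monoidal

/-- After sliding scalars, both this and `box_counitR_mul` read `ε(xy₂)ε(y₁z)`, so they express the
same braided counit axiom. -/
theorem box_counitL_mul (Z : C) :
    H ◁ box21 (counitL H) Z ≫ box21 (mu H) Z ≫ box10 ε[H] Z =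
      H ◁ box21 (mu H) Z ≫ box21 (mu H) Z ≫ box10 ε[H] Z := by
  rw [← box_counit_mul_assoc, ← box_counitR_mul, box_counitR, box_counitL, braid_box20,
    ← braidInv_box20]
  simp only [Category.assoc, exchange]

/-- Expand `y` as `1y`. Then `ε(xy₁)y₂ = ε(x(1₁y₁))1₂y₂ = ε(x1₁)ε(1₂y₁)1₃y₂`, and the last counit
cancels to leave `ε(x1₁)1₂y`. -/
theorem counitT_eq (Z : C) :
    box21 (counitT H) Z =
      H ◁ box01 (eta H) (H ⊗ Z) ≫ box21 (counitT H) (H ⊗ Z) ≫ box21 (mu H) Z := by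
  calc
    _ = H ◁ (box01 (eta H) (H ⊗ Z) ≫ (box21 (mu H) Z ≫ box12 Δ[H] Z)) ≫ box21 (mu H) (H ⊗ Z) ≫
        box10 ε[H] (H ⊗ Z) := by
      rw [reassoc_of% box_one_mul, box_counitT]
    _ = H ◁ (box01 (eta H) (H ⊗ Z) ≫ H ◁ box12 Δ[H] Z ≫ box12 Δ[H] (H ⊗ (H ⊗ Z)) ≫
        H ◁ (braid H H (H ⊗ Z) ≫ H ◁ box21 (mu H) Z)) ≫
        (box21 (counitT H) (H ⊗ (H ⊗ Z)) ≫ box21 (mu H) (H ⊗ Z) ≫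
        box10 ε[H] (H ⊗ Z)) := by
      rw [box_counitT_mul, box_mul_comul, box_counit_mul_assoc]
      simp only [Category.assoc, exchange]
    _ = H ◁ box01 (eta H) (H ⊗ Z) ≫ box21 (counitT H) (H ⊗ Z) ≫
         (box21 (mu H) Z ≫ box12 Δ[H] Z) ≫ box10 ε[H] (H ⊗ Z) := by
      rw [box_mul_comul]
      simp only [Category.assoc, exchange, reassoc_of% counitT_comul]
    _ = _ := by rw [Category.assoc, box_counit_comul, Category.comp_id]

/-- Again from `y = 1y`, with the braided counit axiom in place of the plain one. -/
theorem counitR_eq (Z : C) :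
    box21 (counitR H) Z =
      H ◁ box01 (eta H) (H ⊗ Z) ≫ box21 (counitR H) (H ⊗ Z) ≫ box21 (mu H) Z := by
  calc
    _ = H ◁ (box01 (eta H) (H ⊗ Z) ≫ (box21 (mu H) Z ≫ box12 Δ[H] Z)) ≫ braid H H (H ⊗ Z) ≫
        H ◁ (box21 (mu H) Z ≫ box10 ε[H] Z) := by
      rw [reassoc_of% box_one_mul, box_counitR]
    _ = H ◁ (box01 (eta H) (H ⊗ Z) ≫ H ◁ box12 Δ[H] Z ≫ box12 Δ[H] (H ⊗ (H ⊗ Z)) ≫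
        H ◁ braid H H (H ⊗ Z)) ≫ (H ◁ box21 (mu H) (H ⊗ (H ⊗ Z)) ≫ braid H H (H ⊗ (H ⊗ Z))) ≫
        H ◁ (H ◁ box21 (mu H) Z ≫ box21 (mu H) Z ≫ box10 ε[H] Z) := by
      rw [box_mul_comul]
      simp only [Category.assoc, exchange]
    _ = H ◁ (box01 (eta H) (H ⊗ Z) ≫ H ◁ box12 Δ[H] Z ≫ box12 Δ[H] (H ⊗ (H ⊗ Z)) ≫
        H ◁ braid H H (H ⊗ Z)) ≫ braid H H _ ≫ H ◁ (braid H H _ ≫ H ◁ box21 (counitR H) _) ≫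
        box21 (mu H) _ ≫ H ◁ (box21 (mu H) Z ≫ box10 ε[H] Z) := by
      rw [← box_counit_mul_assoc, ← box_counitR_mul, whiskerLeft_box21_braid]
      simp only [Category.assoc, exchange]
    _ = H ◁ (box01 (eta H) (H ⊗ Z) ≫ H ◁ box12 Δ[H] Z ≫ box12 Δ[H] (H ⊗ (H ⊗ Z))) ≫
        braid H H _ ≫ H ◁ (H ◁ braid H H _ ≫ braid H H _ ≫ H ◁ box21 (counitR H) _) ≫
        box21 (mu H) _ ≫ H ◁ (box21 (mu H) Z ≫ box10 ε[H] Z) := by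
      simp only [Category.assoc, exchange]
    _ = H ◁ (box01 (eta H) (H ⊗ Z) ≫ H ◁ box12 Δ[H] Z) ≫
        (H ◁ box12 Δ[H] (H ⊗ (H ⊗ Z)) ≫ braid H H _ ≫ H ◁ box21 (counitR H) _) ≫
        H ◁ (braid H H _) ≫
        box21 (mu H) _ ≫ H ◁ (box21 (mu H) Z ≫ box10 ε[H] Z) := by
      rw [← box21_braid]
      simp only [Category.assoc, exchange]
    _ = H ◁ box01 (eta H) (H ⊗ Z) ≫ box21 (counitR H) (H ⊗ Z) ≫
         (box21 (mu H) Z ≫ box12 Δ[H] Z) ≫ H ◁ box10 ε[H] Z := by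
      rw [← counitR_comul, box_mul_comul]
      simp only [Category.assoc, exchange]
    _ = _ := by rw [Category.assoc, box_comul_counit, Category.comp_id]

/-- The mirror argument, starting from `x = x1`. -/
theorem counitL_eq (Z : C) :
    box21 (counitL H) Z =
      H ◁ (box01 (eta H) (H ⊗ Z) ≫ box21 (counitL H) Z) ≫ box21 (mu H) Z := by
  calc
    _ = H ◁ box01 (eta H) (H ⊗ Z) ≫ (box21 (mu H) (H ⊗ Z) ≫ box12 Δ[H] (H ⊗ Z)) ≫
        H ◁ braid H H Z ≫ box21 (mu H) (H ⊗ Z) ≫ box10 ε[H] (H ⊗ Z) := by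
      rw [Category.assoc, reassoc_of% box_mul_one, box_counitL]
    _ = H ◁ box01 (eta H) (H ⊗ Z) ≫ H ◁ box12 Δ[H] (H ⊗ Z) ≫ box12 Δ[H] _ ≫
      H ◁ braid H H _ ≫ H ◁ H ◁ (box21 (mu H) (H ⊗ Z) ≫ braid H H Z) ≫
      (box21 (mu H) _ ≫ box21 (mu H) (H ⊗ Z) ≫ box10 ε[H] (H ⊗ Z)) := by
      rw [box_mul_comul]
      simp only [Category.assoc, exchange]
    _ = H ◁ (box01 (eta H) (H ⊗ Z) ≫ box12 Δ[H] (H ⊗ Z) ≫ H ◁ braid H H Z) ≫ box12 Δ[H] _ ≫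
      H ◁ (braid H H _ ≫ H ◁ (braid H H _ ≫ H ◁ box21 (mu H) _) ≫ box21 (counitL H) _) ≫
      box21 (mu H) _ ≫ box10 ε[H] _ := by
      rw [box21_braid, box_counit_mul_assoc, ← box_counitL_mul]
      simp only [exchange]
    _ = H ◁ (box01 (eta H) (H ⊗ Z) ≫ box12 Δ[H] (H ⊗ Z) ≫ H ◁ braid H H Z) ≫ box12 Δ[H] _ ≫
      H ◁ ((braid H H _ ≫ H ◁ braid H H _ ≫ box21 (counitL H) _) ≫ H ◁ box21 (mu H) _) ≫
      box21 (mu H) _ ≫ box10 ε[H] _ := by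
      simp only [Category.assoc, exchange]
    _ = H ◁ (box01 (eta H) (H ⊗ Z) ≫ (box21 (counitL H) Z ≫ box12 Δ[H] Z)) ≫ box12 Δ[H] _ ≫
      H ◁ (braid H H (H ⊗ Z) ≫ H ◁ box21 (mu H) Z) ≫ box21 (mu H) (H ⊗ Z) ≫ box10 ε[H] _ := by
      rw [counitL_comul, ← whiskerLeft_box21_braid]
      simp only [Category.assoc, exchange]
    _ = H ◁ (box01 (eta H) (H ⊗ Z) ≫ box21 (counitL H) Z) ≫
         (box21 (mu H) Z ≫ box12 Δ[H] Z) ≫ box10 ε[H] (H ⊗ Z) := by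
      rw [box_mul_comul]
      simp only [Category.assoc, exchange]
    _ = _ := by rw [Category.assoc, box_counit_comul, Category.comp_id]

end WeakHopfQuasigroup

end DoiHopf

/-! ### The target morphism and the coproduct of the antipode. -/

namespace DoiHopf

namespace WeakHopfQuasigroup

variable {C : Type u} [Category.{v} C] [MonoidalCategory.{v} C]

theorem whiskerRight_piL (H : C) [HopfSignature H] (Z : C) :
    PiL H ▷ Z = box12 Δ[H] Z ≫ H ◁ lam H ▷ Z ≫ box21 (mu H) Z := by
  rw [PiL, whiskerRight_conv, id_whiskerRight, Category.id_comp]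

variable [BraidedCategory.{v} C]

/-- A pair created from the unit may be created on either side of `B`; crossing with one leg undoes
the crossing with the other. -/
theorem box01_box12_braid {A A' D : C} (f : 𝟙_ C ⟶ D) (g : D ⟶ A ⊗ A') (B Z : C) :
    box01 f (B ⊗ Z) ≫ box12 g (B ⊗ Z) ≫ A ◁ braid A' B Z =
      B ◁ (box01 f Z ≫ box12 g Z) ≫ braidInv A B (A' ⊗ Z) := by
  rw [whiskerLeft_comp, ← box01_braid, Category.assoc, Category.assoc, ← reassoc_of% box12_braid,
    braid_inv, Category.comp_id]

variable (H : C) [WeakHopfQuasigroup H]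

theorem whiskerRight_piL' (Z : C) :
    PiL H ▷ Z = box01 (eta H) (H ⊗ Z) ≫ box21 (counitL H) Z := by
  rw [piL_eq]
  simp [box01, box21, counitL]

theorem whiskerRight_piR (Z : C) :
    PiR H ▷ Z = H ◁ box01 (eta H) Z ≫ box21 (counitR H) Z := by
  rw [piR_eq]
  simp [box01, box21, counitR]

theorem mul_piL (Z : C) : H ◁ PiL H ▷ Z ≫ box21 (mu H) Z = box21 (counitL H) Z := by
  rw [whiskerRight_piL', ← counitL_eq H Z]

theorem piR_mul (Z : C) : PiR H ▷ (H ⊗ Z) ≫ box21 (mu H) Z = box21 (counitR H) Z := by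
  rw [whiskerRight_piR, Category.assoc, ← counitR_eq H Z]

theorem box_one_comul_comul (Z : C) :
    box01 (eta H) Z ≫ box12 Δ[H] Z ≫ box12 Δ[H] (H ⊗ Z) =
      box01 (eta H) Z ≫ box12 Δ[H] Z ≫ box01 (eta H) (H ⊗ (H ⊗ Z)) ≫ box12 Δ[H] (H ⊗ (H ⊗ Z)) ≫
        H ◁ box21 (mu H) (H ⊗ Z) := by
  have e := congrArg (fun f => (λ_ Z).inv ≫ f ▷ Z ≫ (α_ _ _ _).hom ≫ (α_ _ _ _).hom)
    (one_comul_comul (H := H))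
  simp only [MonoidalCategory.tensorHom_def'] at e
  simp at e
  simp [box21, box01, box12, e]
  monoidal

theorem box_one_comul_comul_braid (Z : C) :
    box01 (eta H) Z ≫ box12 Δ[H] Z ≫ box12 Δ[H] (H ⊗ Z) =
      box01 (eta H) Z ≫ box12 Δ[H] Z ≫ box01 (eta H) (H ⊗ (H ⊗ Z)) ≫ box12 Δ[H] (H ⊗ (H ⊗ Z)) ≫
        H ◁ (braidInv H H (H ⊗ Z) ≫ box21 (mu H) (H ⊗ Z)) := by
  have e := congrArg (fun f => (λ_ Z).inv ≫ f ▷ Z ≫ (α_ _ _ _).hom ≫ (α_ _ _ _).hom)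
    (one_comul_comul_braid (H := H))
  simp only [MonoidalCategory.tensorHom_def'] at e
  simp at e
  simp [box21, box01, box12, braidInv, e]
  monoidal

/-- As `Π^L(x) = ε(1₁x)1₂`, this is the braided unit axiom with its middle leg removed by the
counit. -/
theorem one_comul_piL (Z : C) :
    box01 (eta H) Z ≫ box12 Δ[H] Z ≫ H ◁ PiL H ▷ Z = box01 (eta H) Z ≫ box12 Δ[H] Z := by
  calc
    _ = box01 (eta H) Z ≫ box12 Δ[H] Z ≫
        H ◁ ((box01 (eta H) (H ⊗ Z) ≫ box12 Δ[H] (H ⊗ Z) ≫ H ◁ braid H H Z) ≫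
          box21 (mu H) (H ⊗ Z) ≫ box10 ε[H] (H ⊗ Z)) := by
      rw [whiskerRight_piL', box_counitL]
      simp only [Category.assoc]
    _ = (box01 (eta H) Z ≫ box12 Δ[H] Z ≫ box12 Δ[H] (H ⊗ Z)) ≫ H ◁ box10 ε[H] (H ⊗ Z) := by
      rw [box01_box12_braid, box_one_comul_comul_braid]
      simp only [Category.assoc, exchange]
    _ = _ := by
      rw [Category.assoc, Category.assoc, box_comul_counit, Category.comp_id]

theorem box01_piL (Z : C) : box01 (eta H) Z ≫ PiL H ▷ Z = box01 (eta H) Z := by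
  calc
    _ = box01 (eta H) Z ≫ box12 Δ[H] Z ≫ H ◁ (H ◁ box01 (eta H) Z ≫ braid H H Z) ≫
        box21 (mu H) (H ⊗ Z) ≫ box10 ε[H] (H ⊗ Z) := by
      rw [whiskerRight_piL', box_counitL]
      simp only [exchange]
    _ = _ := by
      rw [whiskerLeft_box01_braid, reassoc_of% box_mul_one, box_counit_comul, Category.comp_id]

/-- The morphism `x ↦ ε(x 1₁) 1₂`. -/
def barPiR : H ⟶ H := (ρ_ H).inv ≫ H ◁ eta H ≫ counitT H

theorem whiskerRight_barPiR (Z : C) :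
    barPiR H ▷ Z = H ◁ box01 (eta H) Z ≫ box21 (counitT H) Z := by
  simp [barPiR, box01, box21]

theorem one_comul_barPiR (Z : C) :
    box01 (eta H) Z ≫ box12 Δ[H] Z ≫ H ◁ barPiR H ▷ Z = box01 (eta H) Z ≫ box12 Δ[H] Z := by
  calc
    _ = (box01 (eta H) Z ≫ box12 Δ[H] Z ≫ box12 Δ[H] (H ⊗ Z)) ≫ H ◁ box10 ε[H] (H ⊗ Z) := by
      rw [whiskerRight_barPiR, box_counitT, box_one_comul_comul]
      simp only [Category.assoc, exchange]
    _ = _ := by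
      rw [Category.assoc, Category.assoc, box_comul_counit, Category.comp_id]

/-- The value `Π^L(x) = ε(1₁x)1₂` is a second leg of `δ(1)`, and these are fixed by `barPiR`. -/
theorem piL_barPiR (Z : C) : PiL H ▷ Z ≫ barPiR H ▷ Z = PiL H ▷ Z := by
  calc
    _ = (box01 (eta H) (H ⊗ Z) ≫ box12 Δ[H] (H ⊗ Z) ≫ H ◁ barPiR H ▷ (H ⊗ Z)) ≫ H ◁ braid H H Z ≫
        box21 (mu H) (H ⊗ Z) ≫ box10 ε[H] (H ⊗ Z) := by
      rw [whiskerRight_piL', box_counitL]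
      simp only [Category.assoc, exchange]
    _ = _ := by
      rw [one_comul_barPiR, whiskerRight_piL', box_counitL]
      simp only [Category.assoc]

/-- By `counitT_eq` the right side is `barPiR(Π^L(x))y`. Multiplication by a target element thereby
becomes a scalar acting through the coproduct of `y`. -/
theorem piL_mul (Z : C) :
    PiL H ▷ (H ⊗ Z) ≫ box21 (mu H) Z = PiL H ▷ (H ⊗ Z) ≫ box21 (counitT H) Z := by
  rw [counitT_eq, ← Category.assoc (H ◁ _), ← whiskerRight_barPiR, ← Category.assoc,
    piL_barPiR]

/-- From `δ(Π^L(x)) = ε(1₁x)1₂ ⊗ 1₃`: the second leg is the last leg of an iterated coproduct of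
`1`, where `one_comul_piL` applies. -/
theorem piL_comul_piL (Z : C) :
    PiL H ▷ Z ≫ box12 Δ[H] Z ≫ H ◁ PiL H ▷ Z = PiL H ▷ Z ≫ box12 Δ[H] Z := by
  have e : PiL H ▷ Z ≫ box12 Δ[H] Z =
      box01 (eta H) (H ⊗ Z) ≫ (box12 Δ[H] (H ⊗ Z) ≫ box12 Δ[H] (H ⊗ (H ⊗ Z))) ≫
      H ◁ (H ◁ braid H H Z ≫ braid H H (H ⊗ Z)) ≫ box21 (mu H) _ ≫ box10 ε[H] _ := by
    rw [whiskerRight_piL', Category.assoc, counitL_comul, box_counitL]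
    simp only [Category.assoc, exchange]
  rw [← Category.assoc, e]
  calc
    _ = (box01 (eta H) (H ⊗ Z) ≫ box12 Δ[H] (H ⊗ Z) ≫ H ◁ PiL H ▷ (H ⊗ Z)) ≫
      box12 Δ[H] (H ⊗ (H ⊗ Z)) ≫
      H ◁ (H ◁ braid H H Z ≫ braid H H (H ⊗ Z)) ≫ box21 (mu H) _ ≫ box10 ε[H] _ := by
      simp only [Category.assoc, exchange]
    _ = _ := by
      rw [one_comul_piL]
      simp only [Category.assoc]

theorem box_antipode_mul_mul (Z : C) :
    box12 Δ[H] (H ⊗ Z) ≫ H ◁ box21 (mu H) Z ≫ lam H ▷ (H ⊗ Z) ≫ box21 (mu H) Z =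
      PiR H ▷ (H ⊗ Z) ≫ box21 (mu H) Z := by
  have e := congrArg (fun f => (α_ H H Z).inv ≫ f ▷ Z) (antipode_mul_mul (H := H))
  simpa [MonoidalCategory.tensorHom_def', box12, box21] using e

/-- The morphism `x ↦ λ(x₂)₁ ⊗ x₁ λ(x₂)₂`. -/
def antipodeComul : H ⟶ H ⊗ H :=
  Δ[H] ≫ H ◁ (lam H ≫ Δ[H]) ≫ (α_ H H H).inv ≫ (β_ H H).hom ▷ H ≫ (α_ H H H).hom ≫ H ◁ mu H

theorem box_antipodeComul (Z : C) :
    box12 (antipodeComul H) Z = box12 Δ[H] Z ≫ H ◁ (lam H ▷ Z ≫ box12 Δ[H] Z) ≫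
      braid H H (H ⊗ Z) ≫ H ◁ box21 (mu H) Z := by
  simp [antipodeComul, box12, box21, braid]

/-- Multiplicativity of `δ` applied to `x₁λ(x₂)`. -/
theorem antipodeComul_mul (Z : C) :
    box12 Δ[H] Z ≫ H ◁ box12 (antipodeComul H) Z ≫ box21 (mu H) (H ⊗ Z) =
      PiL H ▷ Z ≫ box12 Δ[H] Z := by
  calc
    _ = (box12 Δ[H] Z ≫ box12 Δ[H] (H ⊗ Z)) ≫ H ◁ (H ◁ (lam H ▷ Z ≫ box12 Δ[H] Z) ≫
      braid H H (H ⊗ Z) ≫ H ◁ box21 (mu H) Z) ≫ box21 (mu H) (H ⊗ Z) := by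
      rw [box_antipodeComul, box_coassoc]
      simp only [Category.assoc, exchange]
    _ = _ := by
      simp only [whiskerRight_piL, Category.assoc, box_mul_comul, exchange]

/-- Since `Π^R(x)y = y₁ε(xy₂)`, the factor `x₁` meets the second leg under a counit;
multiplicativity of `δ` turns this into a counit on one leg of a coproduct, which cancels. -/
theorem piR_mul_antipodeComul (Z : C) :
    box12 Δ[H] Z ≫ H ◁ box12 (antipodeComul H) Z ≫ PiR H ▷ (H ⊗ (H ⊗ Z)) ≫ box21 (mu H) (H ⊗ Z) =
      box12 (antipodeComul H) Z := by
  have e : box12 (antipodeComul H) Z ≫ box12 Δ[H] (H ⊗ Z) =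
      box12 Δ[H] Z ≫ H ◁ (lam H ▷ Z ≫ box12 Δ[H] Z ≫ H ◁ box12 Δ[H] Z) ≫ braid H H _ ≫
        H ◁ (braid H H (H ⊗ Z) ≫ H ◁ box21 (mu H) Z) := by
    calc
      _ = box12 Δ[H] Z ≫ H ◁ (lam H ▷ Z ≫ box12 Δ[H] Z) ≫
          (braid H H (H ⊗ Z) ≫ box12 Δ[H] _) ≫ H ◁ H ◁ box21 (mu H) Z := by
        rw [box_antipodeComul]
        simp only [Category.assoc, exchange]
      _ = _ := by
        rw [← whiskerLeft_box12_braid, ← box_coassoc]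
        simp only [Category.assoc, exchange]
  calc
    _ = box12 Δ[H] Z ≫ H ◁ (box12 (antipodeComul H) Z ≫ box12 Δ[H] (H ⊗ Z)) ≫ braid H H _ ≫
        H ◁ (box21 (mu H) _ ≫ box10 ε[H] _) := by
      rw [piR_mul, box_counitR]
      simp only [exchange]
    _ = (box12 Δ[H] Z ≫ H ◁ box12 Δ[H] Z) ≫
        H ◁ (H ◁ (lam H ▷ Z ≫ box12 Δ[H] Z ≫ H ◁ box12 Δ[H] Z) ≫ braid H H _) ≫ braid H H _ ≫
        H ◁ (H ◁ (braid H H (H ⊗ Z) ≫ H ◁ box21 (mu H) Z) ≫ box21 (mu H) _ ≫ box10 ε[H] _) := by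
      rw [e]
      simp only [Category.assoc, exchange]
    _ = box12 Δ[H] Z ≫ H ◁ (lam H ▷ Z ≫ box12 Δ[H] Z ≫ H ◁ box12 Δ[H] Z) ≫
        (box12 Δ[H] _ ≫ H ◁ braid H H _ ≫ braid H H _) ≫
        H ◁ (H ◁ (braid H H (H ⊗ Z) ≫ H ◁ box21 (mu H) Z) ≫ box21 (mu H) _ ≫ box10 ε[H] _) := by
      rw [← box_coassoc]
      simp only [Category.assoc, exchange]
    _ = box12 Δ[H] Z ≫ H ◁ (lam H ▷ Z ≫ box12 Δ[H] Z) ≫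
      braid H H (H ⊗ Z) ≫ H ◁ ((box21 (mu H) Z ≫ box12 Δ[H] Z) ≫ box10 ε[H] _) := by
      rw [box12_braid, box_mul_comul]
      simp only [Category.assoc, exchange]
    _ = _ := by
      rw [Category.assoc, box_counit_comul, Category.comp_id, box_antipodeComul]

/-- Using `Π^R(x)y = λ(x₁)(x₂y)`, the two preceding lemmas rewrite the map as `x ↦ λ(x₁)·δ(Π^L(x₂))`
with the product on the first leg, and `piL_comul_piL` fixes the second leg. This replaces
anticomultiplicativity of the antipode, which is never needed. -/
theorem antipodeComul_piL (Z : C) :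
    box12 (antipodeComul H) Z ≫ H ◁ PiL H ▷ Z = box12 (antipodeComul H) Z := by
  have e : box12 (antipodeComul H) Z = box12 Δ[H] Z ≫ H ◁ (PiL H ▷ Z ≫ box12 Δ[H] Z) ≫
      lam H ▷ _ ≫ box21 (mu H) (H ⊗ Z) := by
    calc
      _ = box12 Δ[H] Z ≫ H ◁ box12 (antipodeComul H) Z ≫ PiR H ▷ (H ⊗ (H ⊗ Z)) ≫
          box21 (mu H) (H ⊗ Z) := (piR_mul_antipodeComul H Z).symm
      _ = (box12 Δ[H] Z ≫ box12 Δ[H] _) ≫ H ◁ (H ◁ box12 (antipodeComul H) Z ≫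
          box21 (mu H) (H ⊗ Z)) ≫ lam H ▷ _ ≫ box21 (mu H) (H ⊗ Z) := by
        rw [← box_antipode_mul_mul]
        simp only [Category.assoc, exchange]
      _ = _ := by
        rw [box_coassoc, ← antipodeComul_mul]
        simp only [Category.assoc, exchange]
  rw [e]
  calc
    _ = box12 Δ[H] Z ≫ H ◁ (PiL H ▷ Z ≫ box12 Δ[H] Z ≫ H ◁ PiL H ▷ Z) ≫
      lam H ▷ _ ≫ box21 (mu H) (H ⊗ Z) := by
        simp only [Category.assoc, exchange]
    _ = _ := by
      rw [piL_comul_piL]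

end WeakHopfQuasigroup

end DoiHopf

/-! ### Associativity along the image of the target morphism. -/

namespace DoiHopf

namespace WeakHopfQuasigroup

variable {C : Type u} [Category.{v} C] [MonoidalCategory.{v} C] [BraidedCategory.{v} C]
  (H : C) [WeakHopfQuasigroup H]

theorem piL_mul_comul (Z : C) :
    PiL H ▷ (H ⊗ Z) ≫ box21 (mu H) Z ≫ box12 Δ[H] Z =
      H ◁ box12 Δ[H] Z ≫ PiL H ▷ _ ≫ box21 (mu H) _ := by
  rw [piL_mul, reassoc_of% piL_mul, counitT_comul]
  simp only [exchange]

/-- Write each side as `(ε ⊗ id)δ` of itself. By `piL_mul_comul` the element `Π^L(x)` stays in the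
first legs, and under `ε` the product may be reassociated. -/
theorem piL_mul_mul (Z : C) :
    PiL H ▷ (H ⊗ (H ⊗ Z)) ≫ box21 (mu H) (H ⊗ Z) ≫ box21 (mu H) Z =
      H ◁ box21 (mu H) Z ≫ PiL H ▷ (H ⊗ Z) ≫ box21 (mu H) Z := by
  calc
    _ = PiL H ▷ (H ⊗ (H ⊗ Z)) ≫ box21 (mu H) (H ⊗ Z) ≫ (box21 (mu H) Z ≫ box12 Δ[H] Z) ≫
        box10 ε[H] _ := by
      rw [Category.assoc, box_counit_comul, Category.comp_id]
    _ = H ◁ H ◁ box12 Δ[H] Z ≫ (PiL H ▷ _ ≫ box21 (mu H) _ ≫ box12 Δ[H] _) ≫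
        H ◁ (braid H H _ ≫ H ◁ box21 (mu H) _) ≫ box21 (mu H) _ ≫ box10 ε[H] _ := by
      rw [box_mul_comul]
      simp only [Category.assoc, exchange]
    _ = H ◁ (H ◁ box12 Δ[H] Z ≫ box12 Δ[H] _ ≫ H ◁ (braid H H _ ≫ H ◁ box21 (mu H) _)) ≫
        PiL H ▷ _ ≫ (box21 (mu H) _ ≫ box21 (mu H) _ ≫ box10 ε[H] _) := by
      rw [piL_mul_comul]
      simp only [Category.assoc, exchange]
    _ = H ◁ box21 (mu H) Z ≫ (PiL H ▷ (H ⊗ Z) ≫ box21 (mu H) Z ≫ box12 Δ[H] Z) ≫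
        box10 ε[H] _ := by
      rw [box_counit_mul_assoc, piL_mul_comul]
      simp only [Category.assoc, exchange, box_mul_comul]
    _ = _ := by
      rw [Category.assoc, Category.assoc, box_counit_comul, Category.comp_id]

/-- The method of `piL_mul_mul`, now with `δ(xΠ^L(y)) = x₁Π^L(y) ⊗ x₂`. -/
theorem mul_piL_mul (Z : C) :
    H ◁ PiL H ▷ (H ⊗ Z) ≫ box21 (mu H) (H ⊗ Z) ≫ box21 (mu H) Z =
      H ◁ (PiL H ▷ (H ⊗ Z) ≫ box21 (mu H) Z) ≫ box21 (mu H) Z := by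
  calc
    _ = box21 (counitL H) (H ⊗ Z) ≫ (box21 (mu H) Z ≫ box12 Δ[H] Z) ≫ box10 ε[H] _ := by
      rw [Category.assoc, box_counit_comul, Category.comp_id, reassoc_of% mul_piL]
    _ = H ◁ H ◁ box12 Δ[H] Z ≫ (box21 (counitL H) _ ≫ box12 Δ[H] _) ≫
        H ◁ (braid H H _ ≫ H ◁ box21 (mu H) _) ≫ box21 (mu H) _ ≫ box10 ε[H] _ := by
      rw [box_mul_comul]
      simp only [Category.assoc, exchange]
    _ = H ◁ H ◁ box12 Δ[H] Z ≫ box12 Δ[H] _ ≫ H ◁ (braid H H _ ≫ PiL H ▷ _ ≫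
        H ◁ (braid H H _ ≫ H ◁ box21 (mu H) _)) ≫ (box21 (mu H) _ ≫ box21 (mu H) _ ≫
        box10 ε[H] _) := by
      rw [counitL_comul, ← mul_piL]
      simp only [Category.assoc, exchange]
    _ = H ◁ H ◁ box12 Δ[H] Z ≫ box12 Δ[H] _ ≫ H ◁ (H ◁ PiL H ▷ _ ≫
        (braid H H _ ≫ H ◁ braid H H _ ≫ box21 (mu H) _) ≫ H ◁ box21 (mu H) _) ≫
        box21 (mu H) _ ≫ box10 ε[H] _ := by
      rw [box_counit_mul_assoc]
      simp only [Category.assoc, exchange]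
    _ = H ◁ (PiL H ▷ (H ⊗ Z) ≫ box21 (mu H) Z) ≫ (box21 (mu H) Z ≫ box12 Δ[H] Z) ≫
        box10 ε[H] _ := by
      rw [← whiskerLeft_box21_braid, box_mul_comul]
      simp only [Category.assoc, exchange]
      simp only [piL_mul_comul]
    _ = _ := by
      rw [Category.assoc, box_counit_comul, Category.comp_id]

end WeakHopfQuasigroup

/-! ### Modules satisfying the anchor identities. -/

/-- The properties shared by all the actions considered here: an action and a coaction on `X`
which satisfy all the axioms of a strong Hopf module except the associativity along the
coinvariants. -/
structure IsAnchoredModule {C : Type u} [Category.{v} C] [MonoidalCategory.{v} C]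
    [BraidedCategory.{v} C] {H B X : C} [HopfSignature H] [UnitalMagmaObj B]
    (ρ : B ⟶ B ⊗ H) (h : H ⟶ B) (act : X ⊗ B ⟶ X) (coact : X ⟶ X ⊗ H) : Prop where
  comodule : IsComodule H coact
  act_one : X ◁ eta B ≫ act = (ρ_ X).hom
  act_coact : act ≫ coact = (coact ⊗ₘ ρ) ≫ tensorμ X H B H ≫ (act ⊗ₘ mu H)
  act_piL :
    X ◁ Δ[H] ≫ (α_ X H H).inv ≫ ((X ◁ h ≫ act) ⊗ₘ (lam H ≫ h)) ≫ act =
      X ◁ (PiL H ≫ h) ≫ act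
  act_piR :
    X ◁ Δ[H] ≫ (α_ X H H).inv ≫ ((X ◁ (lam H ≫ h) ≫ act) ⊗ₘ h) ≫ act =
      X ◁ (PiR H ≫ h) ≫ act

theorem StrongHopfModule.isAnchoredModule {C : Type u} [Category.{v} C] [MonoidalCategory.{v} C]
    [BraidedCategory.{v} C] {H B : C} [HopfSignature H] [UnitalMagmaObj B]
    {ρ : B ⟶ B ⊗ H} {h : H ⟶ B} {S : Coinvariants ρ h} (M : StrongHopfModule S) :
    IsAnchoredModule ρ h M.act M.coact :=
  ⟨M.comodule, M.act_one, M.act_coact, M.act_piL, M.act_piR⟩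

theorem IsAnchor.isAnchoredModule {C : Type u} [Category.{v} C] [MonoidalCategory.{v} C]
    [BraidedCategory.{v} C] {H B : C} [HopfSignature H] [UnitalMagmaObj B]
    {ρ : B ⟶ B ⊗ H} {h : H ⟶ B} (hh : IsAnchor ρ h) (hρ : IsComoduleMagma ρ) :
    IsAnchoredModule ρ h (mu B) ρ :=
  ⟨hρ.comodule, UnitalMagmaObj.mul_one, hρ.mul_coact, hh.mul_piL, hh.mul_piR⟩

section Integral

variable {C : Type u} [Category.{v} C] [MonoidalCategory.{v} C]
  {H B X : C} [HopfSignature H] [UnitalMagmaObj B] {ρ : B ⟶ B ⊗ H} {h : H ⟶ B}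

namespace IsMultiplicativeTotalIntegral

theorem box_colinear (hh : IsMultiplicativeTotalIntegral ρ h) (Z : C) :
    h ▷ Z ≫ box12 ρ Z = box12 Δ[H] Z ≫ h ▷ (H ⊗ Z) := by
  rw [← box12_comp, hh.colinear, box12_comp_whiskerRight]

theorem box_one (hh : IsMultiplicativeTotalIntegral ρ h) (Z : C) :
    box01 (eta H) Z ≫ h ▷ Z = box01 (eta B) Z := by
  rw [← box01_comp, hh.one_hom]

theorem box_mul (hh : IsMultiplicativeTotalIntegral ρ h) (Z : C) :
    box21 (mu H) Z ≫ h ▷ Z = H ◁ h ▷ Z ≫ h ▷ (B ⊗ Z) ≫ box21 (mu B) Z := by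
  rw [← box21_comp, hh.mul_hom, box21_tensorHom_comp, whisker_exchange_assoc]

end IsMultiplicativeTotalIntegral

end Integral

theorem whiskerRight_coinvMap {C : Type u} [Category.{v} C] [MonoidalCategory.{v} C]
    {H B X : C} [HopfSignature H] (h : H ⟶ B) (act : X ⊗ B ⟶ X) (coact : X ⟶ X ⊗ H) (Z : C) :
    coinvMap h act coact ▷ Z = box12 coact Z ≫ X ◁ (lam H ▷ Z ≫ h ▷ Z) ≫ box21 act Z := by
  simp [coinvMap, box12, box21]

namespace IsAnchoredModule

variable {C : Type u} [Category.{v} C] [MonoidalCategory.{v} C] [BraidedCategory.{v} C]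
  {H B X : C}

section

variable [HopfSignature H] [UnitalMagmaObj B] {ρ : B ⟶ B ⊗ H} {h : H ⟶ B}
  {act : X ⊗ B ⟶ X} {coact : X ⟶ X ⊗ H}

variable (hX : IsAnchoredModule ρ h act coact)

include hX

theorem box_counit (Z : C) : box12 coact Z ≫ X ◁ box10 ε[H] Z = 𝟙 (X ⊗ Z) :=
  hX.comodule.box_counit Z

theorem box_coassoc (Z : C) :
    box12 coact Z ≫ box12 coact (H ⊗ Z) = box12 coact Z ≫ X ◁ box12 Δ[H] Z :=
  hX.comodule.box_coassoc Z

theorem box_act_one (Z : C) : X ◁ box01 (eta B) Z ≫ box21 act Z = 𝟙 (X ⊗ Z) :=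
  DoiHopf.box_act_one hX.act_one Z

theorem box_act_coact (Z : C) :
    box21 act Z ≫ box12 coact Z = X ◁ box12 ρ Z ≫ box12 coact (B ⊗ (H ⊗ Z)) ≫
      X ◁ (braid H B (H ⊗ Z) ≫ B ◁ box21 (mu H) Z) ≫ box21 act (H ⊗ Z) :=
  box21_box12 hX.act_coact Z

theorem box_act_piL (Z : C) :
    X ◁ box12 Δ[H] Z ≫ X ◁ (H ◁ (lam H ▷ Z ≫ h ▷ Z) ≫ h ▷ (B ⊗ Z)) ≫ box21 act (B ⊗ Z) ≫
      box21 act Z = X ◁ (PiL H ▷ Z ≫ h ▷ Z) ≫ box21 act Z := by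
  have e := congrArg (fun f => (α_ X H Z).inv ≫ f ▷ Z) hX.act_piL
  simpa [MonoidalCategory.tensorHom_def', box12, box21] using e

theorem box_act_piR (Z : C) :
    X ◁ box12 Δ[H] Z ≫ X ◁ (H ◁ h ▷ Z ≫ lam H ▷ (B ⊗ Z) ≫ h ▷ (B ⊗ Z)) ≫ box21 act (B ⊗ Z) ≫
      box21 act Z = X ◁ (PiR H ▷ Z ≫ h ▷ Z) ≫ box21 act Z := by
  have e := congrArg (fun f => (α_ X H Z).inv ≫ f ▷ Z) hX.act_piR
  simpa [MonoidalCategory.tensorHom_def', box12, box21] using e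

end

end IsAnchoredModule

end DoiHopf

/-! ### The projection onto coinvariants and the deformed action. -/

namespace DoiHopf

/-- The deformed action `m ⊗ b ↦ (m₀ · h(λ(m₁))) · (h(m₂) b)` in closed form. -/
def quasiAct {C : Type u} [Category.{v} C] [MonoidalCategory.{v} C] {H B X : C}
    [HopfSignature H] [UnitalMagmaObj B] (h : H ⟶ B) (act : X ⊗ B ⟶ X) (coact : X ⟶ X ⊗ H) :
    X ⊗ B ⟶ X :=
  coact ▷ B ≫ (α_ X H B).hom ≫ (coinvMap h act coact ⊗ₘ (h ▷ B ≫ mu B)) ≫ act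

theorem box_quasiAct {C : Type u} [Category.{v} C] [MonoidalCategory.{v} C] {H B X : C}
    [HopfSignature H] [UnitalMagmaObj B] (h : H ⟶ B) (act : X ⊗ B ⟶ X) (coact : X ⟶ X ⊗ H)
    (Z : C) :
    box21 (quasiAct h act coact) Z = box12 coact (B ⊗ Z) ≫
      X ◁ (h ▷ (B ⊗ Z) ≫ box21 (mu B) Z) ≫ coinvMap h act coact ▷ (B ⊗ Z) ≫ box21 act Z := by
  simp [quasiAct, box12, box21, MonoidalCategory.tensorHom_def']

namespace IsAnchoredModule

variable {C : Type u} [Category.{v} C] [MonoidalCategory.{v} C] [BraidedCategory.{v} C]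
  {H B X : C} [WeakHopfQuasigroup H] [UnitalMagmaObj B] {ρ : B ⟶ B ⊗ H} {h : H ⟶ B}
  {act : X ⊗ B ⟶ X} {coact : X ⟶ X ⊗ H}

section

variable (hX : IsAnchoredModule ρ h act coact) (hh : IsMultiplicativeTotalIntegral ρ h)

include hX hh

/-- Coact on `m = m·1` and cancel the counit. As `1 = h(1)` and `h` is colinear, `m =
m₀·h(1₁)ε(m₁1₂)`, which is `m₀·hΠ^R(m₁)`. -/
theorem coact_piR_act (Z : C) :
    box12 coact Z ≫ X ◁ (PiR H ▷ Z ≫ h ▷ Z) ≫ box21 act Z = 𝟙 (X ⊗ Z) := by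
  symm
  calc
    _ = X ◁ box01 (eta B) Z ≫ (box21 act Z ≫ box12 coact Z) ≫ X ◁ box10 ε[H] Z := by
      rw [Category.assoc, hX.box_counit, Category.comp_id, hX.box_act_one]
    _ = X ◁ (box01 (eta H) Z ≫ (h ▷ Z ≫ box12 ρ Z)) ≫ box12 coact (B ⊗ (H ⊗ Z)) ≫
      X ◁ (braid H B (H ⊗ Z) ≫ B ◁ (box21 (mu H) Z ≫ box10 ε[H] Z)) ≫ box21 act Z := by
      rw [hX.box_act_coact, reassoc_of% hh.box_one]
      simp only [Category.assoc, exchange]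
    _ = _ := by
      rw [hh.box_colinear, WeakHopfQuasigroup.whiskerRight_piR,
        WeakHopfQuasigroup.box_counitR]
      simp only [Category.assoc, exchange]

/-- By coassociativity `q(m₀)·h(m₁) = (m₀·hλ(m₁))·h(m₂)`; the second anchor identity reduces this to
`coact_piR_act`. Every `m` is thus recovered from coinvariants and values of `h`. -/
theorem coact_coinvMap_act (Z : C) :
    box12 coact Z ≫ X ◁ h ▷ Z ≫ coinvMap h act coact ▷ (B ⊗ Z) ≫ box21 act Z = 𝟙 (X ⊗ Z) := by
  calc
    _ = (box12 coact Z ≫ box12 coact (H ⊗ Z)) ≫ X ◁ (H ◁ h ▷ Z ≫ lam H ▷ _ ≫ h ▷ _) ≫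
        box21 act _ ≫ box21 act Z := by
      rw [whiskerRight_coinvMap]
      simp only [Category.assoc, exchange]
    _ = _ := by
      rw [hX.box_coassoc, Category.assoc, hX.box_act_piR, hX.coact_piR_act hh]

/-- The coaction on `q(m)` is `m₀·h` applied to the first leg of `antipodeComul` at `m₁`, with the
second leg kept, and that leg is fixed by `Π^L`. -/
theorem coinvMap_coact_piL (Z : C) :
    coinvMap h act coact ▷ Z ≫ box12 coact Z ≫ X ◁ PiL H ▷ Z =
      coinvMap h act coact ▷ Z ≫ box12 coact Z := by
  have e : coinvMap h act coact ▷ Z ≫ box12 coact Z = box12 coact Z ≫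
      X ◁ (box12 (WeakHopfQuasigroup.antipodeComul H) Z ≫ h ▷ _) ≫ box21 act _ := by
    calc
      _ = box12 coact Z ≫ X ◁ (lam H ▷ Z ≫ (h ▷ Z ≫ box12 ρ Z)) ≫ box12 coact _ ≫
          X ◁ (braid H B (H ⊗ Z) ≫ B ◁ box21 (mu H) Z) ≫ box21 act (H ⊗ Z) := by
        rw [whiskerRight_coinvMap, Category.assoc, Category.assoc, hX.box_act_coact]
        simp only [Category.assoc, exchange]
      _ = (box12 coact Z ≫ box12 coact (H ⊗ Z)) ≫
          X ◁ (H ◁ (lam H ▷ Z ≫ box12 Δ[H] Z ≫ h ▷ _) ≫ braid H B (H ⊗ Z) ≫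
          B ◁ box21 (mu H) Z) ≫ box21 act (H ⊗ Z) := by
        rw [hh.box_colinear]
        simp only [Category.assoc, exchange]
      _ = _ := by
        rw [hX.box_coassoc, WeakHopfQuasigroup.box_antipodeComul]
        simp only [Category.assoc, exchange]
  rw [← Category.assoc, e]
  calc
    _ = box12 coact Z ≫ X ◁ ((box12 (WeakHopfQuasigroup.antipodeComul H) Z ≫
        H ◁ PiL H ▷ Z) ≫ h ▷ _) ≫ box21 act _ := by
      simp only [Category.assoc, exchange]
    _ = _ := by
      rw [WeakHopfQuasigroup.antipodeComul_piL]

/-- With `n = q(m)`, the coaction on `n·b` is `n₀·b₀ ⊗ n₁b₁`. As `n₁` is a target element, `n₁b₁`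
becomes `ε(n₁b₁)b₂`, and the counit reassembles `n·b₀`. -/
theorem coinvMap_act_coact (hρ : IsComodule H ρ) (Z : C) :
    coinvMap h act coact ▷ (B ⊗ Z) ≫ box21 act Z ≫ box12 coact Z =
      X ◁ box12 ρ Z ≫ coinvMap h act coact ▷ (B ⊗ (H ⊗ Z)) ≫ box21 act (H ⊗ Z) := by
  -- Allows `Π^L` to be inserted on, or removed from, the second leg of the coaction on `q(m)`,
  -- whatever follows.
  have e (W V : C) (k : H ⊗ (B ⊗ (H ⊗ Z)) ⟶ W) (l : X ⊗ W ⟶ V) :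
      coinvMap h act coact ▷ _ ≫ box12 coact _ ≫ X ◁ k ≫ l =
      coinvMap h act coact ▷ _ ≫ box12 coact _ ≫ X ◁ (PiL H ▷ _ ≫ k) ≫ l := by
    rw [whiskerLeft_comp, Category.assoc, reassoc_of% hX.coinvMap_coact_piL hh]
  calc
    _ = X ◁ box12 ρ Z ≫ coinvMap h act coact ▷ _ ≫ box12 coact _ ≫
        X ◁ (braid H B (H ⊗ Z) ≫ B ◁ box21 (mu H) Z) ≫ box21 act (H ⊗ Z) := by
      rw [hX.box_act_coact, whisker_exchange_assoc]
    _ = X ◁ box12 ρ Z ≫ coinvMap h act coact ▷ _ ≫ box12 coact _ ≫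
        X ◁ (PiL H ▷ _ ≫ braid H B (H ⊗ Z) ≫
          B ◁ box21 (WeakHopfQuasigroup.counitT H) Z) ≫ box21 act (H ⊗ Z) := by
      rw [e, reassoc_of% braid_left, ← whiskerLeft_comp, WeakHopfQuasigroup.piL_mul]
      simp only [exchange]
    _ = X ◁ (box12 ρ Z ≫ B ◁ box12 Δ[H] Z) ≫ coinvMap h act coact ▷ _ ≫ box12 coact _ ≫
        X ◁ (braid H B _ ≫ B ◁ (box21 (mu H) _ ≫ box10 ε[H] _)) ≫ box21 act (H ⊗ Z) := by
      rw [← e, WeakHopfQuasigroup.box_counitT]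
      simp only [exchange]
    _ = X ◁ box12 ρ Z ≫ coinvMap h act coact ▷ _ ≫ (box21 act _ ≫ box12 coact _) ≫
        X ◁ box10 ε[H] _ := by
      rw [← hρ.box_coassoc, hX.box_act_coact]
      simp only [Category.assoc, exchange]
    _ = _ := by
      rw [Category.assoc, hX.box_counit, Category.comp_id]

theorem coinvMap_coact (hρ : IsComodule H ρ) (Z : C) :
    coinvMap h act coact ▷ Z ≫ box12 coact Z =
      X ◁ (box01 (eta H) Z ≫ box12 Δ[H] Z ≫ h ▷ _) ≫ coinvMap h act coact ▷ _ ≫ box21 act _ := by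
  calc
    _ = X ◁ box01 (eta B) Z ≫ (coinvMap h act coact ▷ (B ⊗ Z) ≫ box21 act Z ≫ box12 coact Z) := by
      rw [whisker_exchange_assoc, reassoc_of% hX.box_act_one]
    _ = _ := by
      rw [hX.coinvMap_act_coact hh hρ, ← whiskerLeft_comp_assoc, ← hh.box_one, Category.assoc,
        hh.box_colinear]

/-- By `coinvMap_coact`, `q(q(m)) = (q(m)·h(1₁))·hλ(1₂)`; the first anchor identity turns this into
`q(m)·hΠ^L(1) = q(m)`. -/
theorem coinvMap_coinvMap (hρ : IsComodule H ρ) :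
    coinvMap h act coact ≫ coinvMap h act coact = coinvMap h act coact := by
  refine eq_of_whiskerRight fun Z => ?_
  calc
    _ = (coinvMap h act coact ▷ Z ≫ box12 coact Z) ≫ X ◁ (lam H ▷ Z ≫ h ▷ Z) ≫ box21 act Z := by
      rw [comp_whiskerRight, Category.assoc, ← whiskerRight_coinvMap]
    _ = coinvMap h act coact ▷ Z ≫ X ◁ box01 (eta H) Z ≫ (X ◁ box12 Δ[H] Z ≫
        X ◁ (H ◁ (lam H ▷ Z ≫ h ▷ Z) ≫ h ▷ (B ⊗ Z)) ≫ box21 act (B ⊗ Z) ≫ box21 act Z) := by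
      rw [hX.coinvMap_coact hh hρ]
      simp only [Category.assoc, exchange]
    _ = coinvMap h act coact ▷ Z ≫ X ◁ ((box01 (eta H) Z ≫ PiL H ▷ Z) ≫ h ▷ Z) ≫ box21 act Z := by
      rw [hX.box_act_piL]
      simp only [Category.assoc, exchange]
    _ = _ := by
      rw [WeakHopfQuasigroup.box01_piL, hh.box_one, hX.box_act_one, Category.comp_id]

end

section

variable (hX : IsAnchoredModule ρ h act coact) (hB : IsAnchoredModule ρ h (mu B) ρ)
  (hh : IsMultiplicativeTotalIntegral ρ h)
  (hA : ∀ Z : C, X ◁ coinvMap h (mu B) ρ ▷ (B ⊗ Z) ≫ box21 act (B ⊗ Z) ≫ box21 act Z =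
    X ◁ (coinvMap h (mu B) ρ ▷ (B ⊗ Z) ≫ box21 (mu B) Z) ≫ box21 act Z)

include hX hB hh hA

/-- Put `b = q(b₀)h(b₁)`. Associativity along coinvariants moves `q(b₀)` next to `m`, the anchor
identity on `X` produces `hΠ^L`, and the same two moves backwards inside `B` leave `m·(b₀hλ(b₁))`.
-/
theorem act_act_antipode (Z : C) :
    X ◁ (box12 ρ Z ≫ B ◁ (lam H ▷ Z ≫ h ▷ Z)) ≫ box21 act (B ⊗ Z) ≫ box21 act Z =
      X ◁ coinvMap h (mu B) ρ ▷ Z ≫ box21 act Z := by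
  -- The substitution `b₀ = q(b₀₀)h(b₀₁)`, made in the first leg of the coaction.
  have e (Y : C) : box12 ρ Y = box12 ρ Y ≫ (box12 ρ (H ⊗ Y) ≫ B ◁ h ▷ (H ⊗ Y) ≫
      coinvMap h (mu B) ρ ▷ (B ⊗ (H ⊗ Y)) ≫ box21 (mu B) (H ⊗ Y)) := by
    rw [hB.coact_coinvMap_act hh, Category.comp_id]
  calc
    _ = X ◁ (box12 ρ Z ≫ box12 ρ (H ⊗ Z)) ≫ X ◁ B ◁ (H ◁ (lam H ▷ Z ≫ h ▷ Z) ≫ h ▷ (B ⊗ Z)) ≫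
        (X ◁ (coinvMap h (mu B) ρ ▷ _ ≫ box21 (mu B) _) ≫ box21 act (B ⊗ Z)) ≫ box21 act Z := by
      conv_lhs => rw [e]
      simp only [Category.assoc, exchange]
    _ = X ◁ box12 ρ Z ≫ X ◁ coinvMap h (mu B) ρ ▷ _ ≫ box21 act _ ≫ (X ◁ box12 Δ[H] Z ≫
        X ◁ (H ◁ (lam H ▷ Z ≫ h ▷ Z) ≫ h ▷ (B ⊗ Z)) ≫ box21 act (B ⊗ Z) ≫ box21 act Z) := by
      rw [← hA, hB.box_coassoc]
      simp only [Category.assoc, exchange]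
    _ = X ◁ (box12 ρ Z ≫ B ◁ (PiL H ▷ Z ≫ h ▷ Z)) ≫
        (X ◁ coinvMap h (mu B) ρ ▷ _ ≫ box21 act _ ≫ box21 act Z) := by
      rw [hX.box_act_piL]
      simp only [Category.assoc, exchange]
    _ = X ◁ (box12 ρ Z ≫ coinvMap h (mu B) ρ ▷ _ ≫ (B ◁ (PiL H ▷ Z ≫ h ▷ Z) ≫
        box21 (mu B) Z)) ≫ box21 act Z := by
      rw [hA]
      simp only [Category.assoc, exchange]
    _ = X ◁ ((box12 ρ Z ≫ (box12 ρ (H ⊗ Z) ≫ B ◁ h ▷ (H ⊗ Z) ≫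
      coinvMap h (mu B) ρ ▷ (B ⊗ (H ⊗ Z)) ≫ box21 (mu B) (H ⊗ Z))) ≫
      B ◁ (lam H ▷ Z ≫ h ▷ Z) ≫ box21 (mu B) Z) ≫ box21 act Z := by
      rw [← hB.box_act_piL, ← Category.assoc (box12 ρ Z) (box12 ρ _), hB.box_coassoc]
      simp only [Category.assoc, exchange]
    _ = _ := by
      rw [← e, ← whiskerRight_coinvMap]

theorem coinvMap_act_coinvMap (Z : C) :
    coinvMap h act coact ▷ (B ⊗ Z) ≫ box21 act Z ≫ coinvMap h act coact ▷ Z =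
      X ◁ coinvMap h (mu B) ρ ▷ Z ≫ coinvMap h act coact ▷ (B ⊗ Z) ≫ box21 act Z := by
  calc
    _ = (coinvMap h act coact ▷ (B ⊗ Z) ≫ box21 act Z ≫ box12 coact Z) ≫
        X ◁ (lam H ▷ Z ≫ h ▷ Z) ≫ box21 act Z := by
      rw [Category.assoc, Category.assoc, ← whiskerRight_coinvMap]
    _ = coinvMap h act coact ▷ (B ⊗ Z) ≫ (X ◁ (box12 ρ Z ≫ B ◁ (lam H ▷ Z ≫ h ▷ Z)) ≫
        box21 act (B ⊗ Z) ≫ box21 act Z) := by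
      rw [hX.coinvMap_act_coact hh hB.comodule]
      simp only [Category.assoc, exchange]
    _ = _ := by
      rw [hX.act_act_antipode hB hh hA, whisker_exchange_assoc]

/-- Acting by `b'` on `q(m)·b` gives `(q(m)·q_B(b₀))·(h(b₁)b')`. Both partial associativities bring
this to `q(m)·((q_B(b₀)h(b₁))b') = q(m)·(bb')`. -/
theorem coinvMap_act_quasiAct
    (hl : ∀ Z : C, coinvMap h (mu B) ρ ▷ _ ≫ box21 (mu B) (B ⊗ Z) ≫ box21 (mu B) Z =
      B ◁ box21 (mu B) Z ≫ coinvMap h (mu B) ρ ▷ _ ≫ box21 (mu B) Z) (Z : C) :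
    coinvMap h act coact ▷ (B ⊗ (B ⊗ Z)) ≫ box21 act (B ⊗ Z) ≫ box21 (quasiAct h act coact) Z =
      X ◁ box21 (mu B) Z ≫ coinvMap h act coact ▷ (B ⊗ Z) ≫ box21 act Z := by
  calc
    _ = (coinvMap h act coact ▷ (B ⊗ (B ⊗ Z)) ≫ box21 act (B ⊗ Z) ≫ box12 coact (B ⊗ Z)) ≫
      X ◁ (h ▷ (B ⊗ Z) ≫ box21 (mu B) Z) ≫ coinvMap h act coact ▷ (B ⊗ Z) ≫ box21 act Z := by
      rw [box_quasiAct]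
      simp only [Category.assoc]
    _ = X ◁ (box12 ρ (B ⊗ Z) ≫ B ◁ (h ▷ (B ⊗ Z) ≫ box21 (mu B) Z)) ≫
      (coinvMap h act coact ▷ _ ≫ box21 act _ ≫ coinvMap h act coact ▷ (B ⊗ Z)) ≫ box21 act Z := by
      rw [hX.coinvMap_act_coact hh hB.comodule]
      simp only [Category.assoc, exchange]
    _ = X ◁ (box12 ρ (B ⊗ Z) ≫ B ◁ (h ▷ (B ⊗ Z) ≫ box21 (mu B) Z)) ≫
      coinvMap h act coact ▷ _ ≫ (X ◁ coinvMap h (mu B) ρ ▷ _ ≫ box21 act _ ≫ box21 act Z) := by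
      rw [hX.coinvMap_act_coinvMap hB hh hA]
      simp only [Category.assoc, exchange]
    _ = X ◁ (box12 ρ (B ⊗ Z) ≫ B ◁ h ▷ (B ⊗ Z) ≫ (B ◁ box21 (mu B) Z ≫
        coinvMap h (mu B) ρ ▷ _ ≫ box21 (mu B) Z)) ≫ coinvMap h act coact ▷ _ ≫ box21 act Z := by
      rw [hA]
      simp only [Category.assoc, exchange]
    _ = _ := by
      rw [← hl, reassoc_of% hB.coact_coinvMap_act hh]

theorem coinvMap_quasiAct
    (hl : ∀ Z : C, coinvMap h (mu B) ρ ▷ _ ≫ box21 (mu B) (B ⊗ Z) ≫ box21 (mu B) Z =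
      B ◁ box21 (mu B) Z ≫ coinvMap h (mu B) ρ ▷ _ ≫ box21 (mu B) Z) (Z : C) :
    coinvMap h act coact ▷ (B ⊗ Z) ≫ box21 (quasiAct h act coact) Z =
      coinvMap h act coact ▷ (B ⊗ Z) ≫ box21 act Z := by
  have e := congrArg (fun f => X ◁ box01 (eta B) (B ⊗ Z) ≫ f)
    (hX.coinvMap_act_quasiAct hB hh hA hl Z)
  rw [whisker_exchange_assoc, reassoc_of% hX.box_act_one, ← whiskerLeft_comp_assoc, box_one_mul,
    whiskerLeft_id, Category.id_comp] at e
  exact e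

omit hB hA in
-- Multiplicativity of `h` gives `q(m₀)·(h(m₁)hλ(m₂)) = q(m₀)·hΠ^L(m₁)`, and the anchor identity
-- then yields `m₀·hλ(m₁)`. Maps linear only for deformed actions therefore still commute with `q`.
theorem coinvMap_quasiAct_coact :
    coinvMap h (quasiAct h act coact) coact = coinvMap h act coact := by
  refine eq_of_whiskerRight fun Z => ?_
  calc
    _ = (box12 coact Z ≫ box12 coact (H ⊗ Z)) ≫ X ◁ (H ◁ (lam H ▷ Z ≫ h ▷ Z) ≫ h ▷ (B ⊗ Z) ≫
        box21 (mu B) Z) ≫ coinvMap h act coact ▷ (B ⊗ Z) ≫ box21 act Z := by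
      rw [whiskerRight_coinvMap, box_quasiAct]
      simp only [Category.assoc, exchange]
    _ = box12 coact Z ≫ X ◁ (box12 Δ[H] Z ≫ H ◁ lam H ▷ Z ≫ (H ◁ h ▷ Z ≫ h ▷ (B ⊗ Z) ≫
        box21 (mu B) Z)) ≫ coinvMap h act coact ▷ (B ⊗ Z) ≫ box21 act Z := by
      rw [hX.box_coassoc]
      simp only [Category.assoc, exchange]
    _ = box12 coact Z ≫ coinvMap h act coact ▷ _ ≫ (X ◁ (PiL H ▷ Z ≫ h ▷ Z) ≫ box21 act Z) := by
      rw [← hh.box_mul, WeakHopfQuasigroup.whiskerRight_piL]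
      simp only [Category.assoc, exchange]
    _ = (box12 coact Z ≫ box12 coact (H ⊗ Z)) ≫ X ◁ (H ◁ (lam H ▷ Z ≫ h ▷ Z) ≫ h ▷ (B ⊗ Z)) ≫
        coinvMap h act coact ▷ _ ≫ box21 act (B ⊗ Z) ≫ box21 act Z := by
      rw [← hX.box_act_piL, hX.box_coassoc]
      simp only [Category.assoc, exchange]
    _ = box12 coact Z ≫ (box12 coact (H ⊗ Z) ≫ X ◁ h ▷ _ ≫ coinvMap h act coact ▷ _ ≫ box21 act _)
        ≫ X ◁ (lam H ▷ Z ≫ h ▷ Z) ≫ box21 act Z := by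
      simp only [Category.assoc, exchange]
    _ = _ := by
      rw [hX.coact_coinvMap_act hh, Category.id_comp, whiskerRight_coinvMap]

end

end IsAnchoredModule

end DoiHopf

/-! ### Splittings and the action of the coinvariants. -/

namespace DoiHopf

section Splitting

variable {C : Type u} [Category.{v} C] {X : C} {q : X ⟶ X}

namespace Splitting

variable (σ : Splitting q)

theorem i_comp : σ.i ≫ q = σ.i := by
  have e := congrArg (σ.i ≫ ·) σ.p_i
  simpa [reassoc_of% σ.i_p] using e.symm

theorem comp_p : q ≫ σ.p = σ.p := by
  have e := congrArg (· ≫ σ.p) σ.p_i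
  simpa [σ.i_p] using e.symm

theorem eq_of_comp_i {Y : C} {f g : Y ⟶ σ.obj} (e : f ≫ σ.i = g ≫ σ.i) : f = g := by
  have e' := congrArg (· ≫ σ.p) e
  simpa [σ.i_p] using e'

/-- The coequalizer of `q` and the identity is an image of `q`; idempotency is exactly what lets `q`
factor through it. -/
theorem nonempty_of_idem [HasCoequalizers C] (hq : q ≫ q = q) : Nonempty (Splitting q) := by
  have e : q ≫ q = 𝟙 X ≫ q := by rw [hq, Category.id_comp]
  refine ⟨⟨coequalizer q (𝟙 X), coequalizer.desc q e, coequalizer.π q (𝟙 X),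
    coequalizer.π_desc q e, ?_⟩⟩
  ext
  rw [coequalizer.π_desc_assoc, coequalizer.condition, Category.id_comp, Category.comp_id]

variable [MonoidalCategory.{v} C]

theorem i_p_whiskerRight (Z : C) : σ.i ▷ Z ≫ σ.p ▷ Z = 𝟙 _ := by
  rw [← comp_whiskerRight, σ.i_p, id_whiskerRight]

theorem p_i_whiskerRight (Z : C) : σ.p ▷ Z ≫ σ.i ▷ Z = q ▷ Z := by
  rw [← comp_whiskerRight, σ.p_i]

theorem i_comp_whiskerRight (Z : C) : σ.i ▷ Z ≫ q ▷ Z = σ.i ▷ Z := by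
  rw [← comp_whiskerRight, σ.i_comp]

theorem eq_of_comp_i_whiskerRight {Y Z : C} {f g : Y ⟶ σ.obj ⊗ Z} (e : f ≫ σ.i ▷ Z = g ≫ σ.i ▷ Z) :
    f = g := by
  have e' := congrArg (· ≫ σ.p ▷ Z) e
  simpa only [Category.assoc, σ.i_p_whiskerRight, Category.comp_id] using e'

end Splitting

end Splitting

variable {C : Type u} [Category.{v} C] [MonoidalCategory.{v} C] [BraidedCategory.{v} C]
  {H B X : C}

/-- The axioms of a strong Hopf module. -/
structure IsStrongModule [HopfSignature H] [UnitalMagmaObj B] {ρ : B ⟶ B ⊗ H} {h : H ⟶ B}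
    (S : Coinvariants ρ h) (act : X ⊗ B ⟶ X) (coact : X ⟶ X ⊗ H) : Prop extends
    IsAnchoredModule ρ h act coact where
  act_coinv : (X ◁ S.i ≫ act) ▷ B ≫ act = (α_ X S.obj B).hom ≫ X ◁ (S.i ▷ B ≫ mu B) ≫ act

theorem StrongHopfModule.isStrongModule [HopfSignature H] [UnitalMagmaObj B] {ρ : B ⟶ B ⊗ H}
    {h : H ⟶ B} {S : Coinvariants ρ h} (M : StrongHopfModule S) :
    IsStrongModule S M.act M.coact :=
  ⟨M.isAnchoredModule, M.act_coinv⟩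

/-- The standing assumptions: `B` is a comodule magma, `h` is an anchor morphism, and `B` is
associative along its coinvariants. -/
structure IsAnchoredMagma [HopfSignature H] [UnitalMagmaObj B] {ρ : B ⟶ B ⊗ H} {h : H ⟶ B}
    (S : Coinvariants ρ h) : Prop where
  comoduleMagma : IsComoduleMagma ρ
  anchor : IsAnchor ρ h
  associate : CoinvariantsAssociate S

theorem IsStrongModule.box_act_coinv [HopfSignature H] [UnitalMagmaObj B] {ρ : B ⟶ B ⊗ H}
    {h : H ⟶ B} {S : Coinvariants ρ h} {act : X ⊗ B ⟶ X} {coact : X ⟶ X ⊗ H}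
    (hX : IsStrongModule S act coact) (Z : C) :
    X ◁ S.i ▷ (B ⊗ Z) ≫ box21 act (B ⊗ Z) ≫ box21 act Z =
      X ◁ (S.i ▷ (B ⊗ Z) ≫ box21 (mu B) Z) ≫ box21 act Z := by
  have e := congrArg (fun f => X ◁ (α_ S.obj B Z).inv ≫ (α_ X (S.obj ⊗ B) Z).inv ≫
    (α_ X S.obj B).inv ▷ Z ≫ f ▷ Z) hX.act_coinv
  simpa [box21] using e

namespace IsAnchoredMagma

variable [HopfSignature H] [UnitalMagmaObj B] {ρ : B ⟶ B ⊗ H} {h : H ⟶ B}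
  {S : Coinvariants ρ h} (hS : IsAnchoredMagma S)

include hS

theorem isStrongModule : IsStrongModule S (mu B) ρ :=
  ⟨hS.anchor.isAnchoredModule hS.comoduleMagma, hS.associate.middle⟩

theorem box_left (Z : C) :
    S.i ▷ _ ≫ box21 (mu B) (B ⊗ Z) ≫ box21 (mu B) Z =
      S.obj ◁ box21 (mu B) Z ≫ S.i ▷ _ ≫ box21 (mu B) Z := by
  have e := congrArg (fun f => S.obj ◁ (α_ B B Z).inv ≫ (α_ S.obj (B ⊗ B) Z).inv ≫
    (α_ S.obj B B).inv ▷ Z ≫ f ▷ Z) hS.associate.left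
  simpa [box21, MonoidalCategory.tensorHom_def'] using e.symm

theorem box_left' (Z : C) :
    coinvMap h (mu B) ρ ▷ _ ≫ box21 (mu B) (B ⊗ Z) ≫ box21 (mu B) Z =
      B ◁ box21 (mu B) Z ≫ coinvMap h (mu B) ρ ▷ _ ≫ box21 (mu B) Z := by
  simp only [← S.p_i, comp_whiskerRight, Category.assoc, hS.box_left]
  simp only [exchange]

end IsAnchoredMagma

section

variable [WeakHopfQuasigroup H] [UnitalMagmaObj B] {ρ : B ⟶ B ⊗ H} {h : H ⟶ B}
  {S : Coinvariants ρ h}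

/-- The action of the coinvariants of `B` on the coinvariants of `X`. -/
def coinvAction (S : Coinvariants ρ h) {act : X ⊗ B ⟶ X} {coact : X ⟶ X ⊗ H}
    (σ : Splitting (coinvMap h act coact)) : σ.obj ⊗ S.obj ⟶ σ.obj :=
  (σ.i ⊗ₘ S.i) ≫ act ≫ σ.p

theorem box_coinvAction {act : X ⊗ B ⟶ X} {coact : X ⟶ X ⊗ H}
    (σ : Splitting (coinvMap h act coact)) (Z : C) :
    box21 (coinvAction S σ) Z =
      σ.obj ◁ S.i ▷ Z ≫ σ.i ▷ (B ⊗ Z) ≫ box21 act Z ≫ σ.p ▷ Z := by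
  simp [coinvAction, box21, MonoidalCategory.tensorHom_def']

/-- With `1 = h(1)`, colinearity and multiplicativity of `h` give `q_B(1) = hΠ^L(1)`. -/
theorem IsAnchoredMagma.box01_coinvMap (hS : IsAnchoredMagma S) (Z : C) :
    box01 (eta B) Z ≫ coinvMap h (mu B) ρ ▷ Z = box01 (eta B) Z := by
  have hh := hS.anchor.toIsMultiplicativeTotalIntegral
  calc
    _ = box01 (eta H) Z ≫ box12 Δ[H] Z ≫ H ◁ lam H ▷ Z ≫ H ◁ h ▷ Z ≫ h ▷ (B ⊗ Z) ≫
        box21 (mu B) Z := by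
      rw [whiskerRight_coinvMap, ← reassoc_of% hh.box_one, reassoc_of% hh.box_colinear]
      simp only [exchange]
    _ = _ := by
      rw [← hh.box_mul, ← hh.box_one]
      nth_rw 2 [← WeakHopfQuasigroup.box01_piL]
      rw [WeakHopfQuasigroup.whiskerRight_piL]
      simp only [Category.assoc]

namespace IsStrongModule

variable {act : X ⊗ B ⟶ X} {coact : X ⟶ X ⊗ H} (hX : IsStrongModule S act coact)
  (hS : IsAnchoredMagma S) (σ : Splitting (coinvMap h act coact))

include hX

theorem box_act_coinvMap (Z : C) :
    X ◁ coinvMap h (mu B) ρ ▷ (B ⊗ Z) ≫ box21 act (B ⊗ Z) ≫ box21 act Z =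
      X ◁ (coinvMap h (mu B) ρ ▷ (B ⊗ Z) ≫ box21 (mu B) Z) ≫ box21 act Z := by
  simp only [← S.p_i, comp_whiskerRight, whiskerLeft_comp, Category.assoc, hX.box_act_coinv]

include hS

theorem i_act_coact (Z : C) :
    σ.i ▷ (B ⊗ Z) ≫ box21 act Z ≫ box12 coact Z =
      σ.obj ◁ box12 ρ Z ≫ σ.i ▷ (B ⊗ (H ⊗ Z)) ≫ box21 act (H ⊗ Z) := by
  rw [← σ.i_comp, comp_whiskerRight, Category.assoc, hX.coinvMap_act_coact
    hS.anchor.toIsMultiplicativeTotalIntegral hS.comoduleMagma.comodule, ← whisker_exchange_assoc,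
    comp_whiskerRight, Category.assoc]

theorem i_act_coinvMap (Z : C) :
    σ.i ▷ (B ⊗ Z) ≫ box21 act Z ≫ coinvMap h act coact ▷ Z =
      σ.obj ◁ coinvMap h (mu B) ρ ▷ Z ≫ σ.i ▷ (B ⊗ Z) ≫ box21 act Z := by
  rw [← σ.i_comp, comp_whiskerRight, Category.assoc, hX.coinvMap_act_coinvMap
    hS.isStrongModule.toIsAnchoredModule hS.anchor.toIsMultiplicativeTotalIntegral
    hX.box_act_coinvMap, ← whisker_exchange_assoc, Category.assoc]

theorem i_act_quasiAct (Z : C) :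
    σ.i ▷ (B ⊗ (B ⊗ Z)) ≫ box21 act (B ⊗ Z) ≫ box21 (quasiAct h act coact) Z =
      σ.obj ◁ box21 (mu B) Z ≫ σ.i ▷ (B ⊗ Z) ≫ box21 act Z := by
  rw [← σ.i_comp, comp_whiskerRight, Category.assoc, hX.coinvMap_act_quasiAct
    hS.isStrongModule.toIsAnchoredModule hS.anchor.toIsMultiplicativeTotalIntegral
    hX.box_act_coinvMap hS.box_left', ← whisker_exchange_assoc, comp_whiskerRight, Category.assoc]

theorem i_quasiAct (Z : C) :
    σ.i ▷ (B ⊗ Z) ≫ box21 (quasiAct h act coact) Z = σ.i ▷ (B ⊗ Z) ≫ box21 act Z := by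
  rw [← σ.i_comp, comp_whiskerRight, Category.assoc, hX.coinvMap_quasiAct
    hS.isStrongModule.toIsAnchoredModule hS.anchor.toIsMultiplicativeTotalIntegral
    hX.box_act_coinvMap hS.box_left', Category.assoc]

theorem coinvAction_i (Z : C) :
    box21 (coinvAction S σ) Z ≫ σ.i ▷ Z = σ.obj ◁ S.i ▷ Z ≫ σ.i ▷ (B ⊗ Z) ≫ box21 act Z := by
  rw [box_coinvAction, Category.assoc, Category.assoc, Category.assoc, σ.p_i_whiskerRight,
    hX.i_act_coinvMap hS, ← whiskerLeft_comp_assoc, S.i_comp_whiskerRight]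

/-- Apply `i` to both sides and use `q(i(n)·b) = i(n)·q_B(b)`. -/
theorem i_act_p (Z : C) :
    σ.i ▷ (B ⊗ Z) ≫ box21 act Z ≫ σ.p ▷ Z = σ.obj ◁ S.p ▷ Z ≫ box21 (coinvAction S σ) Z := by
  refine σ.eq_of_comp_i_whiskerRight ?_
  rw [Category.assoc, Category.assoc, Category.assoc, σ.p_i_whiskerRight, hX.i_act_coinvMap hS,
    hX.coinvAction_i hS, ← whiskerLeft_comp_assoc, S.p_i_whiskerRight]

theorem coinvAction_coinvAction (Z : C) :
    box21 (coinvAction S σ) (S.obj ⊗ Z) ≫ box21 (coinvAction S σ) Z =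
      σ.obj ◁ box21 (coinvAction S S) Z ≫ box21 (coinvAction S σ) Z := by
  refine σ.eq_of_comp_i_whiskerRight ?_
  calc
    _ = σ.obj ◁ S.obj ◁ S.i ▷ Z ≫ (box21 (coinvAction S σ) _ ≫ σ.i ▷ _) ≫ box21 act Z := by
      rw [Category.assoc, hX.coinvAction_i hS]
      simp only [Category.assoc, exchange]
    _ = σ.obj ◁ S.obj ◁ S.i ▷ Z ≫ σ.i ▷ _ ≫ (X ◁ S.i ▷ _ ≫ box21 act _ ≫ box21 act Z) := by
      rw [hX.coinvAction_i hS]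
      simp only [Category.assoc, exchange]
    _ = σ.obj ◁ (box21 (coinvAction S S) Z ≫ S.i ▷ Z) ≫ σ.i ▷ _ ≫ box21 act Z := by
      rw [hX.box_act_coinv, hS.isStrongModule.coinvAction_i hS]
      simp only [exchange]
    _ = _ := by
      rw [Category.assoc, hX.coinvAction_i hS]
      simp only [exchange]

theorem box01_coinvAction (Z : C) :
    σ.obj ◁ box01 (eta B ≫ S.p) Z ≫ box21 (coinvAction S σ) Z = 𝟙 _ := by
  refine σ.eq_of_comp_i_whiskerRight ?_
  rw [Category.assoc, hX.coinvAction_i hS, ← whiskerLeft_comp_assoc, box01_comp, Category.assoc,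
    S.p_i_whiskerRight, hS.box01_coinvMap, whisker_exchange_assoc, hX.box_act_one,
    Category.comp_id, Category.id_comp]

/-- The section of `σ.i ▷ B ≫ act` given by the coaction. -/
theorem coact_i_act (Z : C) :
    box12 coact Z ≫ X ◁ h ▷ Z ≫ σ.p ▷ (B ⊗ Z) ≫ σ.i ▷ (B ⊗ Z) ≫ box21 act Z = 𝟙 (X ⊗ Z) := by
  rw [reassoc_of% σ.p_i_whiskerRight, hX.coact_coinvMap_act hS.anchor.toIsMultiplicativeTotalIntegral]

/-- The map `n ⊗ b ↦ i(n)·b` has the section of `coact_i_act`, so identities on `X` may be checked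
on its values, without using that a tensor functor preserves epimorphisms. -/
theorem eq_of_i_act {Y Z : C} {f g : X ⊗ Z ⟶ Y}
    (e : σ.i ▷ (B ⊗ Z) ≫ box21 act Z ≫ f = σ.i ▷ (B ⊗ Z) ≫ box21 act Z ≫ g) : f = g := by
  have e' := congrArg (fun k => box12 coact Z ≫ X ◁ h ▷ Z ≫ σ.p ▷ (B ⊗ Z) ≫ k) e
  have s := hX.coact_i_act hS σ Z
  simpa only [reassoc_of% s] using e'

omit hX in
theorem box01_mul (Z : C) :
    box01 (eta B ≫ S.p) (S.obj ⊗ Z) ≫ box21 (coinvAction S S) Z = 𝟙 _ := by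
  refine S.eq_of_comp_i_whiskerRight ?_
  calc
    _ = S.i ▷ Z ≫ box01 (eta B) _ ≫ box21 (mu B) Z := by
      rw [Category.assoc, hS.isStrongModule.coinvAction_i hS, box01_comp, Category.assoc,
        ← whisker_exchange_assoc, reassoc_of% S.p_i_whiskerRight, reassoc_of% box01_exchange,
        reassoc_of% hS.box01_coinvMap]
    _ = _ := by
      rw [box_one_mul, Category.id_comp, Category.comp_id]

end IsStrongModule

end

end DoiHopf

/-! ### The monoid of coinvariants, the deformed action and the balanced tensor product. -/

namespace DoiHopf

section

variable {C : Type u} [Category.{v} C] [MonoidalCategory.{v} C]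

theorem whiskerRight_eq_of_box21 {A B D : C} {f g : A ⊗ B ⟶ D} {Z : C}
    (e : box21 f Z = box21 g Z) : f ▷ Z = g ▷ Z := by
  simpa [box21] using e

theorem assoc_of_box {A B D E F G : C} {f : A ⊗ B ⟶ D} {g : D ⊗ E ⟶ F} {k : B ⊗ E ⟶ G}
    {l : A ⊗ G ⟶ F} {Z : C} (e : box21 f (E ⊗ Z) ≫ box21 g Z = A ◁ box21 k Z ≫ box21 l Z) :
    (f ▷ E ≫ g) ▷ Z = ((α_ A B E).hom ≫ A ◁ k ≫ l) ▷ Z := by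
  have e := congrArg (fun t => (α_ A B E).hom ▷ Z ≫ (α_ A (B ⊗ E) Z).hom ≫
    A ◁ (α_ B E Z).hom ≫ t) e
  simpa [box21] using e

theorem act_one_of_box {X B : C} {η : 𝟙_ C ⟶ B} {a : X ⊗ B ⟶ X} {Z : C}
    (e : X ◁ box01 η Z ≫ box21 a Z = 𝟙 (X ⊗ Z)) : (X ◁ η ≫ a) ▷ Z = (ρ_ X).hom ▷ Z := by
  have e := congrArg (fun t => (α_ X (𝟙_ C) Z).hom ≫ X ◁ (λ_ Z).hom ≫ t) e
  simpa [box21, box01] using e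

theorem one_act_of_box {X B : C} {η : 𝟙_ C ⟶ B} {a : B ⊗ X ⟶ X} {Z : C}
    (e : box01 η (X ⊗ Z) ≫ box21 a Z = 𝟙 (X ⊗ Z)) : (η ▷ X ≫ a) ▷ Z = (λ_ X).hom ▷ Z := by
  have e := congrArg (fun t => (λ_ X).hom ▷ Z ≫ t) e
  simpa [box21, box01] using e

end

variable {C : Type u} [Category.{v} C] [MonoidalCategory.{v} C] [BraidedCategory.{v} C]
  {H B : C} [WeakHopfQuasigroup H] [UnitalMagmaObj B] {ρ : B ⟶ B ⊗ H} {h : H ⟶ B}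
  {S : Coinvariants ρ h}

theorem IsAnchoredModule.nonempty_splitting [HasCoequalizers C] {X : C} {act : X ⊗ B ⟶ X}
    {coact : X ⟶ X ⊗ H} (hX : IsAnchoredModule ρ h act coact)
    (hh : IsMultiplicativeTotalIntegral ρ h) (hρ : IsComodule H ρ) :
    Nonempty (Splitting (coinvMap h act coact)) :=
  Splitting.nonempty_of_idem (hX.coinvMap_coinvMap hh hρ)

/-- The monoid structure on the coinvariants of `B`. -/
abbrev IsAnchoredMagma.monObj (hS : IsAnchoredMagma S) : MonObj S.obj where
  one := eta B ≫ S.p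
  mul := coinvAction S S
  one_mul := eq_of_whiskerRight fun _ => one_act_of_box (IsStrongModule.box01_mul hS _)
  mul_one := eq_of_whiskerRight fun _ => act_one_of_box (hS.isStrongModule.box01_coinvAction hS S _)
  mul_assoc := eq_of_whiskerRight fun _ =>
    assoc_of_box (hS.isStrongModule.coinvAction_coinvAction hS S _)

theorem IsAnchoredMagma.one_i (hS : IsAnchoredMagma S) : (eta B ≫ S.p) ≫ S.i = eta B := by
  refine eq_of_whiskerRight fun Z => ?_
  have e := congrArg (fun f => (λ_ Z).hom ≫ f) (hS.box01_coinvMap Z)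
  simpa [box01, S.p_i] using e

theorem IsStrongModule.coinvAction_comp_i {X : C} {act : X ⊗ B ⟶ X} {coact : X ⟶ X ⊗ H}
    (hX : IsStrongModule S act coact) (hS : IsAnchoredMagma S)
    (σ : Splitting (coinvMap h act coact)) :
    coinvAction S σ ≫ σ.i = (σ.i ⊗ₘ S.i) ≫ act := by
  refine eq_of_whiskerRight fun Z => whiskerRight_eq_of_box21 ?_
  rw [box21_comp, hX.coinvAction_i hS, box21_tensorHom_comp, whisker_exchange_assoc]

/-- The module of coinvariants. -/
def IsStrongModule.coinvModule {X : C} {act : X ⊗ B ⟶ X} {coact : X ⟶ X ⊗ H}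
    (hX : IsStrongModule S act coact) (hS : IsAnchoredMagma S)
    (σ : Splitting (coinvMap h act coact)) :
    letI := hS.monObj
    RightMod S.obj :=
  letI := hS.monObj
  { X := σ.obj
    act := coinvAction S σ
    act_one := eq_of_whiskerRight fun _ => act_one_of_box (hX.box01_coinvAction hS σ _)
    act_mul := eq_of_whiskerRight fun _ =>
      assoc_of_box (hX.coinvAction_coinvAction hS σ _) }

/-- Whatever the choices, the transported action sends `(i(n)·b) ⊗ b'` to `i(n)·(bb')`, and so does
`quasiAct`; the elements `i(n)·b` suffice to compare them. -/
theorem StrongHopfModule.IsDeformedAction.eq_quasiAct [HasCoequalizers C]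
    (hS : IsAnchoredMagma S) {M : StrongHopfModule S} {ψ : M.X ⊗ B ⟶ M.X}
    (hψ : M.IsDeformedAction ψ) : ψ = quasiAct h M.act M.coact := by
  obtain ⟨D, rfl⟩ := hψ
  set ψ := D.ω.inv ▷ B ≫ D.tensorAct ≫ D.ω.hom with hψ
  have e : (D.split.i ▷ B ≫ M.act) ▷ B ≫ ψ =
      (α_ D.split.obj B B).hom ≫ D.split.obj ◁ mu B ≫ D.split.i ▷ B ≫ M.act := by
    rw [← D.π_ω, hψ, comp_whiskerRight, Category.assoc, hom_inv_whiskerRight_assoc,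
      reassoc_of% D.π_tensorAct, D.π_ω]
  refine eq_of_whiskerRight fun Z => whiskerRight_eq_of_box21
    (M.isStrongModule.eq_of_i_act hS D.split ?_)
  rw [M.isStrongModule.i_act_quasiAct hS]
  have e' := congrArg (fun t => D.split.obj ◁ (α_ B B Z).inv ≫ (α_ D.split.obj (B ⊗ B) Z).inv ≫
    (α_ D.split.obj B B).inv ▷ Z ≫ t ▷ Z) e
  simpa [box21] using e'

/-! ### The tensor product over the coinvariants -/

section Tensor

variable [HasCoequalizers C] (S) {N : C} (a : N ⊗ S.obj ⟶ N)

/-- The tensor product of a module over the coinvariants of `B` with `B`. -/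
noncomputable abbrev balancedTensor : C :=
  coequalizer (a ▷ B) ((α_ N S.obj B).hom ≫ N ◁ (S.i ▷ B ≫ mu B))

/-- The projection to `balancedTensor`. -/
noncomputable abbrev balancedπ : N ⊗ B ⟶ balancedTensor S a :=
  coequalizer.π (a ▷ B) ((α_ N S.obj B).hom ≫ N ◁ (S.i ▷ B ≫ mu B))

theorem box_balancedπ (Z : C) : box21 a (B ⊗ Z) ≫ box21 (balancedπ S a) Z =
    N ◁ (S.i ▷ (B ⊗ Z) ≫ box21 (mu B) Z) ≫ box21 (balancedπ S a) Z := by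
  have e := congrArg (fun t => N ◁ (α_ S.obj B Z).inv ≫ (α_ N (S.obj ⊗ B) Z).inv ≫
    (α_ N S.obj B).inv ▷ Z ≫ t ▷ Z)
    (coequalizer.condition (a ▷ B) ((α_ N S.obj B).hom ≫ N ◁ (S.i ▷ B ≫ mu B)))
  simpa [box21] using e

/-- The universal property of `balancedTensor`. -/
theorem exists_balanced_desc {Y : C} (f : N ⊗ B ⟶ Y)
    (hf : ∀ Z : C, box21 a (B ⊗ Z) ≫ box21 f Z = N ◁ (S.i ▷ (B ⊗ Z) ≫ box21 (mu B) Z) ≫ box21 f Z) :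
    ∃ g : balancedTensor S a ⟶ Y, balancedπ S a ≫ g = f := by
  refine ⟨coequalizer.desc f (eq_of_whiskerRight fun Z => ?_), coequalizer.π_desc _ _⟩
  rw [Category.assoc]
  refine assoc_of_box ?_
  rw [hf, box21_whiskerRight_comp]

theorem eq_of_balancedπ {Y : C} {f g : balancedTensor S a ⟶ Y}
    (e : ∀ Z : C, box21 (balancedπ S a) Z ≫ f ▷ Z = box21 (balancedπ S a) Z ≫ g ▷ Z) : f = g := by
  refine coequalizer.hom_ext (eq_of_whiskerRight fun Z => whiskerRight_eq_of_box21 ?_)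
  rw [box21_comp, box21_comp, e]

theorem epi_map_balancedπ {D : Type*} [Category* D] (G : C ⥤ D)
    [PreservesColimitsOfShape WalkingParallelPair G] : Epi (G.map (balancedπ S a)) :=
  epi_of_isColimit_cofork (isColimitOfHasCoequalizerOfPreservesColimit G _ _)

/-- The action of `B` on the balanced tensor product. -/
theorem exists_tensorAct [PreservesColimitsOfShape WalkingParallelPair (tensorRight B)]
    (hS : IsAnchoredMagma S) :
    ∃ t : balancedTensor S a ⊗ B ⟶ balancedTensor S a,
      balancedπ S a ▷ B ≫ t = (α_ N B B).hom ≫ N ◁ mu B ≫ balancedπ S a := by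
  have e : (a ▷ B) ▷ B ≫ (α_ N B B).hom ≫ N ◁ mu B ≫ balancedπ S a =
      ((α_ N S.obj B).hom ≫ N ◁ (S.i ▷ B ≫ mu B)) ▷ B ≫ (α_ N B B).hom ≫ N ◁ mu B ≫
        balancedπ S a := by
    refine eq_of_whiskerRight fun Z => ?_
    have e : box21 a (B ⊗ (B ⊗ Z)) ≫ N ◁ box21 (mu B) Z ≫ box21 (balancedπ S a) Z =
        N ◁ (S.i ▷ _ ≫ box21 (mu B) _ ≫ box21 (mu B) Z) ≫ box21 (balancedπ S a) Z := by
      rw [reassoc_of% box21_exchange, box_balancedπ, hS.box_left]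
      simp only [exchange]
    have e' := congrArg (fun u => (α_ ((N ⊗ S.obj) ⊗ B) B Z).hom ≫ (α_ (N ⊗ S.obj) B (B ⊗ Z)).hom ≫
      (α_ N S.obj (B ⊗ (B ⊗ Z))).hom ≫ u) e
    simpa [box21] using e'
  obtain ⟨t, ht⟩ := Cofork.IsColimit.desc' (isColimitCoforkMapOfIsColimit (tensorRight B)
    (coequalizer.condition (a ▷ B) ((α_ N S.obj B).hom ≫ N ◁ (S.i ▷ B ≫ mu B)))
    (coequalizerIsCoequalizer _ _)) ((α_ N B B).hom ≫ N ◁ mu B ≫ balancedπ S a) e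
  exact ⟨t, ht⟩

end Tensor

end DoiHopf

/-! ### The comparison isomorphism and the fully faithful functor of coinvariants. -/

namespace DoiHopf

variable {C : Type u} [Category.{v} C] [MonoidalCategory.{v} C] [BraidedCategory.{v} C]
  [HasCoequalizers C]
  {H B : C} [WeakHopfQuasigroup H] [UnitalMagmaObj B] {ρ : B ⟶ B ⊗ H} {h : H ⟶ B}
  {S : Coinvariants ρ h}

/-- The comparison of the balanced tensor product with the original module is an isomorphism. -/
theorem IsStrongModule.exists_balanced_iso {X : C} {act : X ⊗ B ⟶ X} {coact : X ⟶ X ⊗ H}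
    (hX : IsStrongModule S act coact) (hS : IsAnchoredMagma S)
    (σ : Splitting (coinvMap h act coact)) :
    ∃ ω : balancedTensor S (coinvAction S σ) ≅ X,
      balancedπ S (coinvAction S σ) ≫ ω.hom = σ.i ▷ B ≫ act := by
  obtain ⟨w, hw⟩ := exists_balanced_desc S (coinvAction S σ) (σ.i ▷ B ≫ act) (fun Z => by
    calc
      _ = (box21 (coinvAction S σ) (B ⊗ Z) ≫ σ.i ▷ _) ≫ box21 act Z := by
        rw [box21_whiskerRight_comp, Category.assoc]
      _ = σ.obj ◁ S.i ▷ _ ≫ σ.i ▷ _ ≫ box21 act _ ≫ box21 act Z := by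
        rw [hX.coinvAction_i hS]
        simp only [Category.assoc]
      _ = σ.i ▷ _ ≫ (X ◁ S.i ▷ _ ≫ box21 act _ ≫ box21 act Z) := by
        rw [whisker_exchange_assoc]
      _ = _ := by
        rw [hX.box_act_coinv, box21_whiskerRight_comp]
        simp only [exchange])
  have hw' (Z : C) : box21 (balancedπ S (coinvAction S σ)) Z ≫ w ▷ Z = σ.i ▷ (B ⊗ Z) ≫ box21 act Z := by
    rw [← box21_comp, hw, box21_whiskerRight_comp]
  -- The inverse `m ↦ p(m₀) ⊗ h(m₁)`, read off from `m = q(m₀)·h(m₁)`.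
  let v : X ⟶ balancedTensor S (coinvAction S σ) :=
    coact ≫ X ◁ h ≫ σ.p ▷ B ≫ balancedπ S (coinvAction S σ)
  have hv (Z : C) : v ▷ Z = box12 coact Z ≫ X ◁ h ▷ Z ≫ σ.p ▷ (B ⊗ Z) ≫
      box21 (balancedπ S (coinvAction S σ)) Z := by
    simp [v, box12, box21]
  refine ⟨⟨w, v, eq_of_balancedπ S _ fun Z => ?_, eq_of_whiskerRight fun Z => ?_⟩, hw⟩
  · calc
      _ = (σ.i ▷ (B ⊗ Z) ≫ box21 act Z ≫ box12 coact Z) ≫ X ◁ h ▷ Z ≫ σ.p ▷ (B ⊗ Z) ≫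
          box21 (balancedπ S (coinvAction S σ)) Z := by
        rw [comp_whiskerRight, reassoc_of% hw' Z, hv]
        simp only [Category.assoc]
      _ = σ.obj ◁ (box12 ρ Z ≫ B ◁ h ▷ Z) ≫ (σ.i ▷ _ ≫ box21 act _ ≫ σ.p ▷ _) ≫
          box21 (balancedπ S (coinvAction S σ)) Z := by
        rw [hX.i_act_coact hS]
        simp only [Category.assoc, exchange]
      _ = σ.obj ◁ (box12 ρ Z ≫ B ◁ h ▷ Z ≫ S.p ▷ _) ≫ (box21 (coinvAction S σ) _ ≫
          box21 (balancedπ S (coinvAction S σ)) Z) := by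
        rw [hX.i_act_p hS]
        simp only [Category.assoc, exchange]
      _ = σ.obj ◁ (box12 ρ Z ≫ B ◁ h ▷ Z ≫ S.p ▷ _ ≫ S.i ▷ _ ≫ box21 (mu B) Z) ≫
          box21 (balancedπ S (coinvAction S σ)) Z := by
        rw [box_balancedπ]
        simp only [Category.assoc, exchange]
      _ = _ := by
        rw [hS.isStrongModule.coact_i_act hS, whiskerLeft_id, Category.id_comp, id_whiskerRight,
          Category.comp_id]
  · rw [comp_whiskerRight, hv, Category.assoc, Category.assoc, Category.assoc, hw',
      hX.coact_i_act hS, id_whiskerRight]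

namespace StrongHopfModule

theorem nonempty_splitting (hS : IsAnchoredMagma S) (M : StrongHopfModule S) :
    Nonempty (Splitting (coinvMap h M.act M.coact)) :=
  M.isAnchoredModule.nonempty_splitting hS.anchor.toIsMultiplicativeTotalIntegral
    hS.comoduleMagma.comodule

variable [PreservesColimitsOfShape WalkingParallelPair (tensorRight B)]

theorem exists_isDeformedAction (hS : IsAnchoredMagma S) (M : StrongHopfModule S) :
    ∃ ψ, M.IsDeformedAction ψ := by
  obtain ⟨σ⟩ := M.nonempty_splitting hS
  obtain ⟨ω, hω⟩ := M.isStrongModule.exists_balanced_iso hS σ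
  obtain ⟨t, ht⟩ := exists_tensorAct S (coinvAction S σ) hS
  exact ⟨_, ⟨σ, coinvAction S σ, M.isStrongModule.coinvAction_comp_i hS σ, t, ht, ω, hω⟩, rfl⟩

theorem existsUnique_isDeformedAction (hS : IsAnchoredMagma S) (M : StrongHopfModule S) :
    ∃! ψ, M.IsDeformedAction ψ := by
  obtain ⟨ψ, hψ⟩ := M.exists_isDeformedAction hS
  exact ⟨ψ, hψ, fun ψ' hψ' => (hψ'.eq_quasiAct hS).trans (hψ.eq_quasiAct hS).symm⟩

theorem deformedAct_eq (hS : IsAnchoredMagma S) (M : StrongHopfModule S) :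
    M.deformedAct = quasiAct h M.act M.coact := by
  rw [deformedAct, dif_pos (M.exists_isDeformedAction hS)]
  exact (M.exists_isDeformedAction hS).choose_spec.eq_quasiAct hS

theorem Hom.quasi (hS : IsAnchoredMagma S) {M N : StrongHopfModule S} (f : M ⟶ N) :
    f.hom ▷ B ≫ quasiAct h N.act N.coact = quasiAct h M.act M.coact ≫ f.hom := by
  rw [← deformedAct_eq hS, ← deformedAct_eq hS, f.quasilinear]

theorem Hom.box_quasi (hS : IsAnchoredMagma S) {M N : StrongHopfModule S} (f : M ⟶ N) (Z : C) :
    f.hom ▷ (B ⊗ Z) ≫ box21 (quasiAct h N.act N.coact) Z =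
      box21 (quasiAct h M.act M.coact) Z ≫ f.hom ▷ Z := by
  rw [← box21_whiskerRight_comp, f.quasi hS, box21_comp]

/-- Both projections can be computed with the deformed actions, for which `f` is linear. -/
theorem Hom.coinvMap_comm (hS : IsAnchoredMagma S) {M N : StrongHopfModule S} (f : M ⟶ N) :
    f.hom ≫ coinvMap h N.act N.coact = coinvMap h M.act M.coact ≫ f.hom := by
  have hh := hS.anchor.toIsMultiplicativeTotalIntegral
  rw [← M.isAnchoredModule.coinvMap_quasiAct_coact hh, ← N.isAnchoredModule.coinvMap_quasiAct_coact hh,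
    coinvMap, coinvMap, reassoc_of% f.colinear, ← whisker_exchange_assoc, f.quasi hS]
  simp only [Category.assoc]

/-- A choice of the object of coinvariants of a strong Hopf module. -/
noncomputable def coinv (hS : IsAnchoredMagma S) (M : StrongHopfModule S) :
    Splitting (coinvMap h M.act M.coact) :=
  (M.nonempty_splitting hS).some

theorem coinv_comp_i (hS : IsAnchoredMagma S) {M N : StrongHopfModule S} (f : M ⟶ N) :
    ((M.coinv hS).i ≫ f.hom ≫ (N.coinv hS).p) ≫ (N.coinv hS).i = (M.coinv hS).i ≫ f.hom := by
  rw [Category.assoc, Category.assoc, (N.coinv hS).p_i, f.coinvMap_comm hS, reassoc_of% (M.coinv hS).i_comp]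

theorem i_act_hom (hS : IsAnchoredMagma S) {M N : StrongHopfModule S} (f : M ⟶ N) (Z : C) :
    (M.coinv hS).i ▷ (B ⊗ Z) ≫ box21 M.act Z ≫ f.hom ▷ Z =
      ((M.coinv hS).i ≫ f.hom ≫ (N.coinv hS).p) ▷ _ ≫ (N.coinv hS).i ▷ _ ≫ box21 N.act Z := by
  rw [← reassoc_of% M.isStrongModule.i_quasiAct hS, ← f.box_quasi hS, ← comp_whiskerRight_assoc,
    ← coinv_comp_i hS, comp_whiskerRight, Category.assoc, N.isStrongModule.i_quasiAct hS]

theorem coinvAction_hom (hS : IsAnchoredMagma S) {M N : StrongHopfModule S} (f : M ⟶ N) :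
    ((M.coinv hS).i ≫ f.hom ≫ (N.coinv hS).p) ▷ S.obj ≫ coinvAction S (N.coinv hS) =
      coinvAction S (M.coinv hS) ≫ (M.coinv hS).i ≫ f.hom ≫ (N.coinv hS).p := by
  refine eq_of_whiskerRight fun Z => whiskerRight_eq_of_box21
    ((N.coinv hS).eq_of_comp_i_whiskerRight ?_)
  have e : box21 (coinvAction S (M.coinv hS) ≫
      (M.coinv hS).i ≫ f.hom ≫ (N.coinv hS).p) Z ≫ (N.coinv hS).i ▷ Z =
      (box21 (coinvAction S (M.coinv hS)) Z ≫ (M.coinv hS).i ▷ Z) ≫ f.hom ▷ Z := by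
    rw [box21_comp, Category.assoc, ← comp_whiskerRight, coinv_comp_i hS,
      comp_whiskerRight, Category.assoc]
  rw [e, M.isStrongModule.coinvAction_i hS, box21_whiskerRight_comp, Category.assoc,
    N.isStrongModule.coinvAction_i hS, Category.assoc, Category.assoc, i_act_hom,
    ← whisker_exchange_assoc]

/-- The functor of coinvariants. -/
noncomputable def coinvFunctor (hS : IsAnchoredMagma S) :
    letI := hS.monObj
    StrongHopfModule S ⥤ RightMod S.obj :=
  letI := hS.monObj
  { obj M := M.isStrongModule.coinvModule hS (M.coinv hS)
    map {M N} f :=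
      { hom := (M.coinv hS).i ≫ f.hom ≫ (N.coinv hS).p
        act_hom := coinvAction_hom hS f }
    map_id M := RightMod.Hom.ext (by
      refine (M.coinv hS).eq_of_comp_i ((coinv_comp_i hS (𝟙 M)).trans ?_)
      exact (Category.comp_id _).trans (Category.id_comp _).symm)
    map_comp {M N P} f g := RightMod.Hom.ext (by
      refine (P.coinv hS).eq_of_comp_i ((coinv_comp_i hS (f ≫ g)).trans ?_)
      have e : ((M.coinv hS).i ≫ f.hom ≫ (N.coinv hS).p) ≫
          (((N.coinv hS).i ≫ g.hom ≫ (P.coinv hS).p) ≫ (P.coinv hS).i) =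
          (M.coinv hS).i ≫ f.hom ≫ g.hom := by
        have e := congrArg (· ≫ g.hom) (coinv_comp_i hS f)
        rw [coinv_comp_i hS]
        simpa using e
      exact e.symm.trans (Category.assoc _ _ _).symm) }

theorem coinvFunctor_faithful (hS : IsAnchoredMagma S) :
    letI := hS.monObj
    (coinvFunctor hS).Faithful :=
  letI := hS.monObj
  { map_injective {M N f g} e := by
      refine Hom.ext (eq_of_whiskerRight fun Z => M.isStrongModule.eq_of_i_act hS (M.coinv hS) ?_)
      have e' : (M.coinv hS).i ≫ f.hom ≫ (N.coinv hS).p =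
        (M.coinv hS).i ≫ g.hom ≫ (N.coinv hS).p := congrArg RightMod.Hom.hom e
      rw [i_act_hom, i_act_hom, e'] }

theorem coinvFunctor_full (hS : IsAnchoredMagma S) :
    letI := hS.monObj
    (coinvFunctor hS).Full :=
  letI := hS.monObj
  { map_surjective {M N} g := by
      let σ := M.coinv hS
      let τ := N.coinv hS
      let k : σ.obj ⟶ τ.obj := g.hom
      have hk (Z : C) : box21 (coinvAction S σ) Z ≫ k ▷ Z = k ▷ _ ≫ box21 (coinvAction S τ) Z := by
        rw [← box21_comp, ← box21_whiskerRight_comp]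
        exact congrArg (fun t => box21 t Z) g.act_hom.symm
      -- Forced by `m = q(m₀)·h(m₁)`: the only possible extension of `k` is `m ↦ k(p(m₀))·h(m₁)`.
      let f : M.X ⟶ N.X := M.coact ≫ M.X ◁ h ≫ σ.p ▷ B ≫ k ▷ B ≫ τ.i ▷ B ≫ N.act
      have hf (Z : C) : f ▷ Z = box12 M.coact Z ≫ M.X ◁ h ▷ Z ≫ σ.p ▷ _ ≫ k ▷ _ ≫ τ.i ▷ _ ≫
          box21 N.act Z := by
        simp [f, box12, box21]
      -- On generators `f(i(n)·b) = k(n)·b`; colinearity, quasilinearity and the restriction to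
      -- coinvariants all follow from this.
      have hf' (Z : C) : σ.i ▷ _ ≫ box21 M.act Z ≫ f ▷ Z = k ▷ _ ≫ τ.i ▷ _ ≫ box21 N.act Z := by
        calc
          _ = (σ.i ▷ _ ≫ box21 M.act Z ≫ box12 M.coact Z) ≫ M.X ◁ h ▷ Z ≫ σ.p ▷ _ ≫ k ▷ _ ≫ τ.i ▷ _ ≫
              box21 N.act Z := by
            rw [hf]
            simp only [Category.assoc]
          _ = σ.obj ◁ (box12 ρ Z ≫ B ◁ h ▷ Z) ≫ (σ.i ▷ _ ≫ box21 M.act _ ≫ σ.p ▷ _) ≫ k ▷ _ ≫ τ.i ▷ _ ≫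
              box21 N.act Z := by
            rw [M.isStrongModule.i_act_coact hS]
            simp only [Category.assoc, exchange]
          _ = σ.obj ◁ (box12 ρ Z ≫ B ◁ h ▷ Z ≫ S.p ▷ _) ≫ k ▷ _ ≫ (box21 (coinvAction S τ) _ ≫ τ.i ▷ _) ≫
              box21 N.act Z := by
            rw [M.isStrongModule.i_act_p hS, Category.assoc, reassoc_of% hk]
            simp only [Category.assoc, exchange]
          _ = σ.obj ◁ (box12 ρ Z ≫ B ◁ h ▷ Z ≫ S.p ▷ _) ≫ k ▷ _ ≫ τ.i ▷ _ ≫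
              (N.X ◁ S.i ▷ _ ≫ box21 N.act _ ≫ box21 N.act Z) := by
            rw [N.isStrongModule.coinvAction_i hS]
            simp only [Category.assoc, exchange]
          _ = σ.obj ◁ (box12 ρ Z ≫ B ◁ h ▷ Z ≫ S.p ▷ _ ≫ S.i ▷ _ ≫ box21 (mu B) Z) ≫
              k ▷ _ ≫ τ.i ▷ _ ≫ box21 N.act Z := by
            rw [N.isStrongModule.box_act_coinv]
            simp only [Category.assoc, exchange]
          _ = _ := by
            rw [hS.isStrongModule.coact_i_act hS, whiskerLeft_id, Category.id_comp]
      refine ⟨⟨f, ?_, ?_⟩, RightMod.Hom.ext ?_⟩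
      · refine eq_of_whiskerRight fun Z => ?_
        have e : f ▷ Z ≫ box12 N.coact Z = box12 M.coact Z ≫ f ▷ _ := by
          refine M.isStrongModule.eq_of_i_act hS σ ?_
          rw [reassoc_of% hf', reassoc_of% M.isStrongModule.i_act_coact hS, hf',
            N.isStrongModule.i_act_coact hS, ← whisker_exchange_assoc]
        have e' := congrArg (fun t => t ≫ (α_ _ _ _).inv) e
        simpa [box12] using e'
      · rw [deformedAct_eq hS, deformedAct_eq hS]
        refine eq_of_whiskerRight fun Z => whiskerRight_eq_of_box21 ?_
        rw [box21_whiskerRight_comp, box21_comp]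
        refine M.isStrongModule.eq_of_i_act hS σ ?_
        rw [reassoc_of% hf', reassoc_of% M.isStrongModule.i_act_quasiAct hS, hf',
          N.isStrongModule.i_act_quasiAct hS, ← whisker_exchange_assoc]
      · refine τ.eq_of_comp_i ?_
        change (σ.i ≫ f ≫ τ.p) ≫ τ.i = k ≫ τ.i
        have e : σ.i ≫ f = k ≫ τ.i := by
          refine eq_of_whiskerRight fun Z => ?_
          have e := congrArg (fun t => σ.obj ◁ box01 (eta B) Z ≫ t) (hf' Z)
          rw [whisker_exchange_assoc, reassoc_of% M.isAnchoredModule.box_act_one, whisker_exchange_assoc,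
            whisker_exchange_assoc, N.isAnchoredModule.box_act_one, Category.comp_id] at e
          rw [comp_whiskerRight, e, comp_whiskerRight]
        rw [reassoc_of% e, τ.i_p, Category.comp_id] }

end StrongHopfModule

end DoiHopf

/-! ### Independence of choices, and the Hopf module structure on the balanced tensor product. -/

namespace DoiHopf

section

variable {C : Type u} [Category.{v} C]

theorem Splitting.isoHom_comp {X : C} {q : X ⟶ X} (σ τ : Splitting q) :
    (σ.i ≫ τ.p) ≫ τ.i ≫ σ.p = 𝟙 σ.obj := by
  rw [Category.assoc, reassoc_of% τ.p_i, σ.comp_p, σ.i_p]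

variable [MonoidalCategory.{v} C]

theorem box21_act_act {X B H K L : C} (act : X ⊗ B ⟶ X) (d : H ⟶ K ⊗ L) (f : K ⟶ B) (g : L ⟶ B)
    (Z : C) :
    box21 (X ◁ d ≫ (α_ X K L).inv ≫ ((X ◁ f ≫ act) ⊗ₘ g) ≫ act) Z =
      X ◁ (box12 d Z ≫ K ◁ g ▷ Z ≫ f ▷ (B ⊗ Z)) ≫ box21 act (B ⊗ Z) ≫ box21 act Z := by
  simp [MonoidalCategory.tensorHom_def', box12, box21]

end

variable {C : Type u} [Category.{v} C] [MonoidalCategory.{v} C] [BraidedCategory.{v} C]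
  {H B : C} [WeakHopfQuasigroup H] [UnitalMagmaObj B] {ρ : B ⟶ B ⊗ H} {h : H ⟶ B}
  {S : Coinvariants ρ h}

theorem coinvAction_isoHom {X : C} {act : X ⊗ B ⟶ X} {coact : X ⟶ X ⊗ H}
    (σ τ : Splitting (coinvMap h act coact)) :
    (σ.i ≫ τ.p) ▷ S.obj ≫ coinvAction S τ = coinvAction S σ ≫ σ.i ≫ τ.p := by
  have e₁ : (σ.i ≫ τ.p) ≫ τ.i = σ.i := by rw [Category.assoc, τ.p_i, σ.i_comp]
  have e₂ : σ.p ≫ σ.i ≫ τ.p = τ.p := by rw [reassoc_of% σ.p_i, τ.comp_p]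
  rw [coinvAction, coinvAction, Category.assoc, Category.assoc, e₂, MonoidalCategory.tensorHom_def,
    Category.assoc, ← comp_whiskerRight_assoc, e₁, ← MonoidalCategory.tensorHom_def_assoc]

/-- The module of coinvariants does not depend on the choice of the object of coinvariants. -/
theorem IsStrongModule.nonempty_coinvModule_iso {X : C} {act : X ⊗ B ⟶ X} {coact : X ⟶ X ⊗ H}
    (hX : IsStrongModule S act coact) (hS : IsAnchoredMagma S)
    (σ τ : Splitting (coinvMap h act coact)) :
    letI := hS.monObj
    Nonempty (hX.coinvModule hS σ ≅ hX.coinvModule hS τ) :=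
  letI := hS.monObj
  ⟨{ hom := ⟨σ.i ≫ τ.p, coinvAction_isoHom σ τ⟩
     inv := ⟨τ.i ≫ σ.p, coinvAction_isoHom τ σ⟩
     hom_inv_id := RightMod.Hom.ext (σ.isoHom_comp τ)
     inv_hom_id := RightMod.Hom.ext (τ.isoHom_comp σ) }⟩

section Induction

variable [HasCoequalizers C] (S) {N : C} (a : N ⊗ S.obj ⟶ N)

theorem eq_of_balancedπ_box {W Y : C} [Epi (balancedπ S a ▷ W)]
    {f g : balancedTensor S a ⊗ W ⟶ Y}
    (e : ∀ Z : C, box21 (balancedπ S a) (W ⊗ Z) ≫ box21 f Z =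
      box21 (balancedπ S a) (W ⊗ Z) ≫ box21 g Z) : f = g := by
  rw [← cancel_epi (balancedπ S a ▷ W)]
  refine eq_of_whiskerRight fun Z => ?_
  have e := congrArg (fun t => (α_ (N ⊗ B) W Z).hom ≫ (α_ N B (W ⊗ Z)).hom ≫ t) (e Z)
  simpa [box21] using e

theorem epi_balancedπ_whiskerRight (W : C)
    [PreservesColimitsOfShape WalkingParallelPair (tensorRight W)] :
    Epi (balancedπ S a ▷ W) :=
  epi_map_balancedπ S a (tensorRight W)

/-- Preservation of coequalizers is assumed for `B`, not for its coinvariants. But `S.obj ⊗ B` is a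
retract of `B ⊗ B`, and tensoring twice with `B` keeps the projection epi. -/
theorem epi_balancedπ_whiskerRight_coinvariants
    [PreservesColimitsOfShape WalkingParallelPair (tensorRight B)] :
    Epi (balancedπ S a ▷ (S.obj ⊗ B)) := by
  have e₁ : Epi ((balancedπ S a ▷ B) ▷ B) := epi_map_balancedπ S a (tensorRight B ⋙ tensorRight B)
  have e₂ : Epi (balancedπ S a ▷ (B ⊗ B)) := by
    rw [whiskerRight_tensor]
    exact epi_comp' inferInstance (epi_comp' e₁ inferInstance)
  have e₃ : SplitEpi (balancedTensor S a ◁ S.p ▷ B) :=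
    ⟨balancedTensor S a ◁ S.i ▷ B, by
      rw [← whiskerLeft_comp, S.i_p_whiskerRight, whiskerLeft_id]⟩
  have := e₃.epi
  have e₄ : Epi ((N ⊗ B) ◁ S.p ▷ B ≫ balancedπ S a ▷ (S.obj ⊗ B)) := by
    rw [whisker_exchange]
    infer_instance
  exact epi_of_epi ((N ⊗ B) ◁ S.p ▷ B) _

/-- The coaction of `H` on the balanced tensor product. -/
theorem exists_tensorCoact (hS : IsAnchoredMagma S) :
    ∃ r : balancedTensor S a ⟶ balancedTensor S a ⊗ H, ∀ Z : C,
      box21 (balancedπ S a) Z ≫ box12 r Z =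
        N ◁ box12 ρ Z ≫ box21 (balancedπ S a) (H ⊗ Z) := by
  have e (Z : C) : box21 (N ◁ ρ ≫ (α_ N B H).inv ≫ balancedπ S a ▷ H) Z =
      N ◁ box12 ρ Z ≫ box21 (balancedπ S a) (H ⊗ Z) ≫ (α_ _ _ _).inv := by
    simp [box12, box21]
  obtain ⟨r, hr⟩ := exists_balanced_desc S a
    (N ◁ ρ ≫ (α_ N B H).inv ≫ balancedπ S a ▷ H) (fun Z => by
      rw [e, reassoc_of% box21_exchange, reassoc_of% box_balancedπ]
      -- For `s` in the coinvariants, `i(s)b` coacts as `i(s)b₀ ⊗ b₁`, so the coaction of `B` is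
      -- balanced.
      have e' := hS.isStrongModule.i_act_coact hS S Z
      rw [← whiskerLeft_comp_assoc, ← whiskerLeft_comp_assoc, Category.assoc, e'])
  refine ⟨r, fun Z => ?_⟩
  rw [box12, ← Category.assoc, ← box21_comp, hr, e]
  simp

variable {S a} in
-- On a class of `n ⊗ b` each axiom is the same axiom for `B` acting on itself. Testing on such
-- classes is legitimate because the projection stays epi after tensoring with `B`, `H` and `S.obj ⊗
-- B`.
theorem isStrongModule_balancedTensor (hS : IsAnchoredMagma S)
    [PreservesColimitsOfShape WalkingParallelPair (tensorRight B)]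
    [PreservesColimitsOfShape WalkingParallelPair (tensorRight H)]
    {t : balancedTensor S a ⊗ B ⟶ balancedTensor S a}
    {r : balancedTensor S a ⟶ balancedTensor S a ⊗ H}
    (ht : ∀ Z : C, box21 (balancedπ S a) (B ⊗ Z) ≫ box21 t Z =
      N ◁ box21 (mu B) Z ≫ box21 (balancedπ S a) Z)
    (hr : ∀ Z : C, box21 (balancedπ S a) Z ≫ box12 r Z =
      N ◁ box12 ρ Z ≫ box21 (balancedπ S a) (H ⊗ Z)) :
    IsStrongModule S t r := by
  have hB := hS.isStrongModule
  have eB := epi_balancedπ_whiskerRight S a B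
  have eH := epi_balancedπ_whiskerRight S a H
  have eS := epi_balancedπ_whiskerRight_coinvariants S a
  refine ⟨⟨⟨?_, ?_⟩, ?_, ?_, ?_, ?_⟩, ?_⟩
  · rw [← cancel_mono (ρ_ _).hom, Iso.inv_hom_id]
    refine eq_of_balancedπ S a fun Z => ?_
    have e : box21 (balancedπ S a) Z ≫ box12 r Z ≫ _ ◁ box10 ε[H] Z =
        box21 (balancedπ S a) Z := by
      rw [reassoc_of% hr, box21_exchange, ← whiskerLeft_comp_assoc, hB.box_counit, whiskerLeft_id,
        Category.id_comp]
    simpa [box12, box10] using e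
  · refine eq_of_balancedπ S a fun Z => ?_
    have e : box21 (balancedπ S a) Z ≫ box12 r Z ≫ box12 r (H ⊗ Z) =
        box21 (balancedπ S a) Z ≫ box12 r Z ≫ _ ◁ box12 Δ[H] Z := by
      rw [reassoc_of% hr, reassoc_of% hr, hr, box21_exchange, ← whiskerLeft_comp_assoc,
        ← whiskerLeft_comp_assoc, hB.box_coassoc]
    have e' := congrArg (fun k => k ≫ _ ◁ (α_ H H Z).inv ≫ (α_ _ (H ⊗ H) Z).inv) e
    simpa [box12] using e'
  · rw [← cancel_epi (ρ_ _).inv, Iso.inv_hom_id]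
    refine eq_of_balancedπ S a fun Z => ?_
    have e : box21 (balancedπ S a) Z ≫ _ ◁ box01 (eta B) Z ≫ box21 t Z =
        box21 (balancedπ S a) Z := by
      rw [reassoc_of% box21_exchange, ht, ← whiskerLeft_comp_assoc, box_mul_one, whiskerLeft_id,
        Category.id_comp]
    simpa [box01, box21] using e
  · refine eq_of_balancedπ_box S a fun Z => ?_
    rw [← cancel_mono (α_ _ _ _).hom, Category.assoc, Category.assoc, box21_comp_assoc,
      box21_tensorμ_comp, reassoc_of% ht, hr]
    have e := hB.box_act_coact Z
    simp only [exchange, ht, reassoc_of% hr, e]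
  · refine eq_of_balancedπ_box S a fun Z => ?_
    rw [box21_act_act, box21_whiskerLeft_comp, comp_whiskerRight]
    have e := hB.box_act_piL Z
    simp only [exchange] at e
    simp only [exchange, ht, reassoc_of% ht, e]
  · refine eq_of_balancedπ_box S a fun Z => ?_
    rw [box21_act_act, box21_whiskerLeft_comp, comp_whiskerRight]
    have e := hB.box_act_piR Z
    simp only [exchange] at e
    simp only [exchange, ht, reassoc_of% ht, e]
  · rw [← cancel_epi (α_ _ _ _).inv]
    refine eq_of_balancedπ_box S a fun Z => ?_
    have e : box21 (balancedπ S a) _ ≫ _ ◁ S.i ▷ (B ⊗ Z) ≫ box21 t (B ⊗ Z) ≫ box21 t Z =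
        box21 (balancedπ S a) _ ≫ _ ◁ (S.i ▷ (B ⊗ Z) ≫ box21 (mu B) Z) ≫ box21 t Z := by
      have e := hB.box_act_coinv Z
      simp only [exchange, ht, reassoc_of% ht, e]
    have e' := congrArg (fun k => (α_ (N ⊗ B) S.obj B).inv ▷ Z ≫
      (α_ ((N ⊗ B) ⊗ S.obj) B Z).hom ≫ (α_ (N ⊗ B) S.obj (B ⊗ Z)).hom ≫ (α_ N B _).hom ≫ k) e
    simpa [box21] using e'

end Induction

end DoiHopf

/-! ### Coinvariants of the balanced tensor product; the equivalence. -/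

namespace DoiHopf

/-- An isomorphism of modules. -/
def RightMod.isoMk {C : Type u} [Category.{v} C] [MonoidalCategory.{v} C] {A : C} [MonObj A]
    {M N : RightMod A} (u : M.X ≅ N.X) (hu : u.hom ▷ A ≫ N.act = M.act ≫ u.hom) : M ≅ N where
  hom := ⟨u.hom, hu⟩
  inv := ⟨u.inv, by
    rw [← cancel_epi (u.hom ▷ A), hom_inv_whiskerRight_assoc, reassoc_of% hu, u.hom_inv_id,
      Category.comp_id]⟩
  hom_inv_id := Hom.ext u.hom_inv_id
  inv_hom_id := Hom.ext u.inv_hom_id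

variable {C : Type u} [Category.{v} C] [MonoidalCategory.{v} C] [BraidedCategory.{v} C]
  [HasCoequalizers C]
  {H B : C} [WeakHopfQuasigroup H] [UnitalMagmaObj B] {ρ : B ⟶ B ⊗ H} {h : H ⟶ B}
  {S : Coinvariants ρ h}

/-- The coinvariants of the balanced tensor product of `N` with `B` are `N`. -/
theorem exists_splitting_balancedTensor (hS : IsAnchoredMagma S) {N : C} {a : N ⊗ S.obj ⟶ N}
    (ha : ∀ Z : C, box21 a (S.obj ⊗ Z) ≫ box21 a Z =
      N ◁ box21 (coinvAction S S) Z ≫ box21 a Z)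
    (ha' : ∀ Z : C, N ◁ box01 (eta B ≫ S.p) Z ≫ box21 a Z = 𝟙 (N ⊗ Z))
    {t : balancedTensor S a ⊗ B ⟶ balancedTensor S a}
    {r : balancedTensor S a ⟶ balancedTensor S a ⊗ H}
    (ht : ∀ Z : C, box21 (balancedπ S a) (B ⊗ Z) ≫ box21 t Z =
      N ◁ box21 (mu B) Z ≫ box21 (balancedπ S a) Z)
    (hr : ∀ Z : C, box21 (balancedπ S a) Z ≫ box12 r Z =
      N ◁ box12 ρ Z ≫ box21 (balancedπ S a) (H ⊗ Z)) :
    ∃ τ : Splitting (coinvMap h t r), ∃ u : N ≅ τ.obj,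
      u.hom ▷ S.obj ≫ coinvAction S τ = a ≫ u.hom := by
  have hB := hS.isStrongModule
  -- The projection sends the class of `n ⊗ b` to that of `n ⊗ q_B(b)`.
  have hq (Z : C) : box21 (balancedπ S a) Z ≫ coinvMap h t r ▷ Z =
      N ◁ coinvMap h (mu B) ρ ▷ Z ≫ box21 (balancedπ S a) Z := by
    rw [whiskerRight_coinvMap, whiskerRight_coinvMap, reassoc_of% hr]
    simp only [exchange, ht]
  obtain ⟨w, hw⟩ := exists_balanced_desc S a (N ◁ S.p ≫ a) (fun Z => by
    rw [box21_whiskerLeft_comp, reassoc_of% box21_exchange, ha, ← whiskerLeft_comp_assoc,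
      ← whiskerLeft_comp_assoc, Category.assoc, hB.i_act_p hS])
  have hw' (Z : C) : box21 (balancedπ S a) Z ≫ w ▷ Z = N ◁ S.p ▷ Z ≫ box21 a Z := by
    rw [← box21_comp, hw, box21_whiskerLeft_comp]
  let u : N ⟶ balancedTensor S a := (ρ_ N).inv ≫ N ◁ eta B ≫ balancedπ S a
  have hu (Z : C) : u ▷ Z = N ◁ box01 (eta B) Z ≫ box21 (balancedπ S a) Z := by
    simp [u, box01, box21]
  -- The image of `q` is `N` itself, embedded by `n ↦ n ⊗ 1` and retracted by `n ⊗ b ↦ n·p_B(b)`.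
  let τ : Splitting (coinvMap h t r) :=
    { obj := N
      i := u
      p := w
      p_i := by
        refine eq_of_balancedπ S a fun Z => ?_
        rw [hq, comp_whiskerRight, reassoc_of% hw', hu]
        calc
          _ = N ◁ (S.p ▷ Z ≫ S.obj ◁ box01 (eta B) Z) ≫ box21 a _ ≫ box21 (balancedπ S a) Z := by
            simp only [exchange]
          _ = N ◁ ((S.p ▷ Z ≫ S.i ▷ Z) ≫ B ◁ box01 (eta B) Z ≫ box21 (mu B) Z) ≫
              box21 (balancedπ S a) Z := by
            rw [box_balancedπ]
            simp only [Category.assoc, exchange]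
          _ = _ := by
            rw [box_mul_one, S.p_i_whiskerRight, Category.comp_id]
      i_p := by
        refine eq_of_whiskerRight fun Z => ?_
        rw [comp_whiskerRight, hu, Category.assoc, hw', ← whiskerLeft_comp_assoc, ← box01_comp, ha',
          id_whiskerRight] }
  refine ⟨τ, Iso.refl N, ?_⟩
  refine eq_of_whiskerRight fun Z => whiskerRight_eq_of_box21 ?_
  rw [Iso.refl_hom, id_whiskerRight, Category.id_comp, Category.comp_id]
  rw [box_coinvAction]
  calc
    _ = N ◁ S.i ▷ Z ≫ u ▷ _ ≫ box21 t Z ≫ w ▷ Z := rfl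
    _ = N ◁ (S.i ▷ Z ≫ box01 (eta B) _ ≫ box21 (mu B) Z ≫ S.p ▷ Z) ≫ box21 a Z := by
      rw [hu, Category.assoc, reassoc_of% ht, hw']
      simp only [exchange]
    _ = _ := by
      rw [reassoc_of% box_one_mul, S.i_p_whiskerRight, whiskerLeft_id, Category.id_comp]

variable [PreservesColimitsOfShape WalkingParallelPair (tensorRight B)]
  [PreservesColimitsOfShape WalkingParallelPair (tensorRight H)]

namespace StrongHopfModule

theorem coinvFunctor_essSurj (hS : IsAnchoredMagma S) :
    letI := hS.monObj
    (coinvFunctor hS).EssSurj :=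
  letI := hS.monObj
  { mem_essImage N := by
      have ha (Z : C) : box21 N.act (S.obj ⊗ Z) ≫ box21 N.act Z =
          N.X ◁ box21 (coinvAction S S) Z ≫ box21 N.act Z := by
        have e₀ : N.act ▷ S.obj ≫ N.act = (α_ N.X S.obj S.obj).hom ≫
          N.X ◁ coinvAction S S ≫ N.act := N.act_mul
        have e := congrArg (fun k => N.X ◁ (α_ S.obj S.obj Z).inv ≫
          (α_ N.X (S.obj ⊗ S.obj) Z).inv ≫ (α_ N.X S.obj S.obj).inv ▷ Z ≫ k ▷ Z) e₀
        simpa [box21] using e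
      have ha' (Z : C) : N.X ◁ box01 (eta B ≫ S.p) Z ≫ box21 N.act Z = 𝟙 (N.X ⊗ Z) := by
        have e₀ : N.X ◁ (eta B ≫ S.p) ≫ N.act = (ρ_ N.X).hom := N.act_one
        have e := congrArg (fun k => (ρ_ N.X).inv ▷ Z ≫ k ▷ Z) e₀
        simpa [box21, box01] using e
      obtain ⟨t, ht⟩ := exists_tensorAct S N.act hS
      obtain ⟨r, hr⟩ := exists_tensorCoact S N.act hS
      have ht' (Z : C) : box21 (balancedπ S N.act) (B ⊗ Z) ≫ box21 t Z =
          N.X ◁ box21 (mu B) Z ≫ box21 (balancedπ S N.act) Z := by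
        have e := congrArg (fun k => N.X ◁ (α_ B B Z).inv ≫ (α_ N.X (B ⊗ B) Z).inv ≫
          (α_ N.X B B).inv ▷ Z ≫ k ▷ Z) ht
        simpa [box21] using e
      have hQ := isStrongModule_balancedTensor hS ht' hr
      let Q : StrongHopfModule S :=
        { X := balancedTensor S N.act
          act := t
          coact := r
          comodule := hQ.comodule
          act_one := hQ.act_one
          act_coinv := hQ.act_coinv
          act_coact := hQ.act_coact
          act_piL := hQ.act_piL
          act_piR := hQ.act_piR }
      obtain ⟨τ, u, hu⟩ := exists_splitting_balancedTensor hS ha ha' ht' hr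
      -- The functor uses an arbitrary choice of coinvariants, which has to be compared with the
      -- explicit splitting `τ`.
      obtain ⟨w⟩ := Q.isStrongModule.nonempty_coinvModule_iso hS (Q.coinv hS) τ
      exact ⟨Q, ⟨w ≪≫ (RightMod.isoMk (N := Q.isStrongModule.coinvModule hS τ) u hu).symm⟩⟩ }

theorem coinvFunctor_isEquivalence (hS : IsAnchoredMagma S) :
    letI := hS.monObj
    (coinvFunctor hS).IsEquivalence :=
  letI := hS.monObj
  { faithful := coinvFunctor_faithful hS
    full := coinvFunctor_full hS
    essSurj := coinvFunctor_essSurj hS }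

/-- The equivalence between strong Hopf modules and modules over the coinvariants. -/
theorem nonempty_equivalence (hS : IsAnchoredMagma S) :
    letI := hS.monObj
    Nonempty (StrongHopfModule S ≌ RightMod S.obj) :=
  letI := hS.monObj
  haveI := coinvFunctor_isEquivalence hS
  ⟨(coinvFunctor hS).asEquivalence⟩

end StrongHopfModule

end DoiHopf

/-! ### Change of monoid, and the case `B = H`. -/

namespace DoiHopf

namespace RightMod

variable {C : Type u} [Category.{v} C] [MonoidalCategory.{v} C] {A A' : C} [MonObj A] [MonObj A']

/-- Restriction of scalars. -/
def restrict (f : A ⟶ A') (hf : MonObj.one ≫ f = MonObj.one)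
    (hf' : MonObj.mul ≫ f = (f ⊗ₘ f) ≫ MonObj.mul) : RightMod A' ⥤ RightMod A where
  obj M :=
    { X := M.X
      act := M.X ◁ f ≫ M.act
      act_one := by rw [← whiskerLeft_comp_assoc, hf, M.act_one]
      act_mul := by
        rw [← whiskerLeft_comp_assoc, hf', comp_whiskerRight, Category.assoc,
          ← whisker_exchange_assoc, M.act_mul]
        simp [MonoidalCategory.tensorHom_def] }
  map {M N} g := ⟨g.hom, by
    change g.hom ▷ A ≫ N.X ◁ f ≫ N.act = (M.X ◁ f ≫ M.act) ≫ g.hom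
    rw [← whisker_exchange_assoc, g.act_hom, Category.assoc]⟩

/-- Isomorphic monoids have equivalent categories of modules. -/
theorem nonempty_equivalence_of_iso (e : A ≅ A') (he : MonObj.one ≫ e.hom = MonObj.one)
    (he' : MonObj.mul ≫ e.hom = (e.hom ⊗ₘ e.hom) ≫ MonObj.mul) :
    Nonempty (RightMod A ≌ RightMod A') := by
  have hi : MonObj.one ≫ e.inv = MonObj.one := by rw [← he, Category.assoc, e.hom_inv_id,
    Category.comp_id]
  have hi' : MonObj.mul ≫ e.inv = (e.inv ⊗ₘ e.inv) ≫ MonObj.mul := by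
    rw [← cancel_mono e.hom, Category.assoc, e.inv_hom_id, Category.assoc, he']
    simp
  exact ⟨{
    functor := restrict e.inv hi hi'
    inverse := restrict e.hom he he'
    unitIso := NatIso.ofComponents
      (fun M => isoMk (Iso.refl M.X) (by simp [restrict]))
      (fun f => Hom.ext ((Category.comp_id _).trans (Category.id_comp _).symm))
    counitIso := NatIso.ofComponents
      (fun M => isoMk (Iso.refl M.X) (by simp [restrict]))
      (fun f => Hom.ext ((Category.comp_id _).trans (Category.id_comp _).symm))
    functor_unitIso_comp := fun M => Hom.ext (Category.comp_id _) }⟩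

/-- Modules over a monoid whose unit is an isomorphism are just objects. -/
theorem nonempty_equivalence_of_isIso_one (e : 𝟙_ C ≅ A) (he : e.hom = MonObj.one) :
    Nonempty (RightMod A ≌ C) := by
  -- The unit law determines the action, so modules carry no structure and every morphism is linear.
  have h₁ (M : RightMod A) : M.act = M.X ◁ e.inv ≫ (ρ_ M.X).hom := by
    rw [← M.act_one, ← he, whiskerLeft_inv_hom_assoc]
  have h₂ : (MonObj.mul : A ⊗ A ⟶ A) = e.inv ▷ A ≫ (λ_ A).hom := by
    rw [← MonObj.one_mul, ← he, inv_hom_whiskerRight_assoc]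
  let F : RightMod A ⥤ C := { obj M := M.X, map f := f.hom }
  have : F.Faithful := ⟨fun e => Hom.ext e⟩
  have : F.Full := ⟨fun {M N} f => ⟨⟨f, by
    rw [h₁ M, h₁ N, ← whisker_exchange_assoc, rightUnitor_naturality, Category.assoc]⟩, rfl⟩⟩
  have : F.EssSurj := ⟨fun X => ⟨{
    X := X
    act := X ◁ e.inv ≫ (ρ_ X).hom
    act_one := by rw [← he, whiskerLeft_hom_inv_assoc]
    act_mul := by simp [h₂] }, ⟨Iso.refl X⟩⟩⟩
  have : F.IsEquivalence := {}
  exact ⟨F.asEquivalence⟩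

end RightMod

variable {C : Type u} [Category.{v} C] [MonoidalCategory.{v} C] {H : C}

theorem coinvMap_id_comul [HopfSignature H] : coinvMap (𝟙 H) (mu H) Δ[H] = PiL H := by
  simp [coinvMap, PiL, conv]

section

variable [BraidedCategory.{v} C] [WeakHopfQuasigroup H]

theorem isComoduleMagma_comul : IsComoduleMagma Δ[H] where
  comodule := isComodule_comul
  mul_coact := WeakHopfQuasigroup.mul_comul
  one_coact := eq_of_whiskerRight fun Z => by
    have e := congrArg (fun k => (λ_ Z).hom ≫ k ≫ (α_ H H Z).inv)
      (WeakHopfQuasigroup.one_comul_piL H Z)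
    simpa [box01, box12] using e

theorem isAnchor_id : IsAnchor Δ[H] (𝟙 H) where
  colinear := by simp
  one_hom := by simp
  mul_hom := by simp
  mul_piL := by simpa using WeakHopfQuasigroup.mul_mul_antipode (H := H)
  mul_piR := by simpa using WeakHopfQuasigroup.mul_antipode_mul' (H := H)

theorem Splitting.i_comp_piL (S : Coinvariants Δ[H] (𝟙 H)) (Z : C) :
    S.i ▷ Z ≫ PiL H ▷ Z = S.i ▷ Z := by
  rw [← coinvMap_id_comul, S.i_comp_whiskerRight]

/-- For `B = H` the coinvariants are fixed by `Π^L`, so `mul_piL_mul` and `piL_mul_mul` restrict to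
them. -/
theorem coinvariantsAssociate_id (S : Coinvariants Δ[H] (𝟙 H)) : CoinvariantsAssociate S where
  middle := eq_of_whiskerRight fun Z => assoc_of_box (by
    rw [box21_whiskerLeft_comp, box21_whiskerRight_comp, Category.assoc]
    have e := congrArg (fun k => H ◁ S.i ▷ (H ⊗ Z) ≫ k) (WeakHopfQuasigroup.mul_piL_mul H Z)
    rwa [← whiskerLeft_comp_assoc, S.i_comp_piL, ← whiskerLeft_comp_assoc,
      reassoc_of% S.i_comp_piL] at e)
  left := by
    rw [MonoidalCategory.tensorHom_def', Category.assoc]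
    refine (eq_of_whiskerRight fun Z => assoc_of_box ?_).symm
    rw [box21_whiskerRight_comp, box21_whiskerRight_comp, Category.assoc]
    have e := congrArg (fun k => S.i ▷ (H ⊗ (H ⊗ Z)) ≫ k) (WeakHopfQuasigroup.piL_mul_mul H Z)
    rwa [reassoc_of% S.i_comp_piL, ← whisker_exchange_assoc, reassoc_of% S.i_comp_piL] at e

theorem isAnchoredMagma_id (S : Coinvariants Δ[H] (𝟙 H)) : IsAnchoredMagma S :=
  ⟨isComoduleMagma_comul, isAnchor_id, coinvariantsAssociate_id S⟩

variable [HasCoequalizers C]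

theorem nonempty_splitting_piL : Nonempty (Splitting (PiL H)) := by
  rw [← coinvMap_id_comul]
  exact (isAnchor_id.isAnchoredModule isComoduleMagma_comul).nonempty_splitting
    isAnchor_id.toIsMultiplicativeTotalIntegral isComodule_comul

variable [PreservesColimitsOfShape WalkingParallelPair (tensorRight H)]

/-- Strong Hopf modules over `H` are modules over the target object `H_L`. -/
theorem exists_monObj_equivalence_piL (S : Coinvariants Δ[H] (𝟙 H)) (L : Splitting (PiL H)) :
    ∃ _ : MonObj L.obj,
      MonObj.one = eta H ≫ L.p ∧ MonObj.mul = (L.i ⊗ₘ L.i) ≫ mu H ≫ L.p ∧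
      Nonempty (StrongHopfModule S ≌ RightMod L.obj) := by
  -- As `q_H = Π^L`, the given splitting is another choice of coinvariants; the two resulting
  -- monoids are isomorphic.
  let L' : Coinvariants Δ[H] (𝟙 H) :=
    ⟨L.obj, L.i, L.p, L.p_i.trans coinvMap_id_comul.symm, L.i_p⟩
  let := (isAnchoredMagma_id S).monObj
  let := (isAnchoredMagma_id L').monObj
  obtain ⟨E⟩ := StrongHopfModule.nonempty_equivalence (isAnchoredMagma_id S)
  have e : S.p ≫ S.i ≫ L'.p = L'.p := by rw [reassoc_of% S.p_i, L'.comp_p]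
  have e' : (S.i ≫ L'.p) ≫ L'.i = S.i := by rw [Category.assoc, L'.p_i, S.i_comp]
  obtain ⟨E'⟩ := RightMod.nonempty_equivalence_of_iso
    (⟨S.i ≫ L'.p, L'.i ≫ S.p, S.isoHom_comp L', L'.isoHom_comp S⟩ : S.obj ≅ L'.obj)
    (by
      change (eta H ≫ S.p) ≫ S.i ≫ L'.p = eta H ≫ L'.p
      rw [Category.assoc, e])
    (by
      change ((S.i ⊗ₘ S.i) ≫ mu H ≫ S.p) ≫ S.i ≫ L'.p =
        ((S.i ≫ L'.p) ⊗ₘ (S.i ≫ L'.p)) ≫ (L'.i ⊗ₘ L'.i) ≫ mu H ≫ L'.p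
      rw [Category.assoc, Category.assoc, e, tensorHom_comp_tensorHom_assoc, e'])
  exact ⟨(isAnchoredMagma_id L').monObj, rfl, rfl, ⟨E.trans E'⟩⟩

end

end DoiHopf

/-! ### Associative comodule monoids. -/

namespace DoiHopf

variable {C : Type u} [Category.{v} C] [MonoidalCategory.{v} C]

theorem box_assoc {A B D E F G : C} {f : A ⊗ B ⟶ D} {g : D ⊗ E ⟶ F} {k : B ⊗ E ⟶ G}
    {l : A ⊗ G ⟶ F} (e : f ▷ E ≫ g = (α_ A B E).hom ≫ A ◁ k ≫ l) (Z : C) :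
    box21 f (E ⊗ Z) ≫ box21 g Z = A ◁ box21 k Z ≫ box21 l Z := by
  have e := congrArg (fun t => A ◁ (α_ B E Z).inv ≫ (α_ A (B ⊗ E) Z).inv ≫
    (α_ A B E).inv ▷ Z ≫ t ▷ Z) e
  simpa [box21] using e

theorem act_coinv_of_assoc {H B X : C} [HopfSignature H] [UnitalMagmaObj B] {ρ : B ⟶ B ⊗ H}
    {h : H ⟶ B} {act : X ⊗ B ⟶ X} (S : Coinvariants ρ h)
    (ha : act ▷ B ≫ act = (α_ X B B).hom ≫ X ◁ mu B ≫ act) :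
    (X ◁ S.i ≫ act) ▷ B ≫ act = (α_ X S.obj B).hom ≫ X ◁ (S.i ▷ B ≫ mu B) ≫ act := by
  rw [comp_whiskerRight, Category.assoc, ha]
  simp

theorem coinvariantsAssociate_of_assoc {H B : C} [HopfSignature H] [UnitalMagmaObj B]
    {ρ : B ⟶ B ⊗ H} {h : H ⟶ B} (hB : mu B ▷ B ≫ mu B = (α_ B B B).hom ≫ B ◁ mu B ≫ mu B)
    (S : Coinvariants ρ h) : CoinvariantsAssociate S where
  middle := act_coinv_of_assoc S hB
  left := by
    rw [comp_whiskerRight, Category.assoc, hB]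
    simp [MonoidalCategory.tensorHom_def]

variable [BraidedCategory.{v} C] {H B : C}

section

variable [HopfSignature H] [UnitalMagmaObj B] {ρ : B ⟶ B ⊗ H} {h : H ⟶ B} {X : C}
  {act : X ⊗ B ⟶ X} {coact : X ⟶ X ⊗ H}

/-- Associativity gathers the two actions into a product in `B`, which `h` pulls back to a
convolution in `H`. Both anchor identities are instances of this. -/
theorem box_act_act_antipode (hh : IsMultiplicativeTotalIntegral ρ h)
    (ha : act ▷ B ≫ act = (α_ X B B).hom ≫ X ◁ mu B ≫ act) (f g : H ⟶ H) (Z : C) :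
    X ◁ (box12 Δ[H] Z ≫ H ◁ (g ≫ h) ▷ Z ≫ (f ≫ h) ▷ (B ⊗ Z)) ≫ box21 act (B ⊗ Z) ≫ box21 act Z =
      X ◁ (conv f g ≫ h) ▷ Z ≫ box21 act Z := by
  rw [comp_whiskerRight (conv f g) h, whiskerRight_conv, box_assoc ha]
  simp only [Category.assoc, hh.box_mul]
  simp only [Category.assoc, exchange]

theorem IsMultiplicativeTotalIntegral.isAnchoredModule (hh : IsMultiplicativeTotalIntegral ρ h)
    (hc : IsComodule H coact) (h₁ : X ◁ eta B ≫ act = (ρ_ X).hom)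
    (ha : act ▷ B ≫ act = (α_ X B B).hom ≫ X ◁ mu B ≫ act)
    (hr : act ≫ coact = (coact ⊗ₘ ρ) ≫ tensorμ X H B H ≫ (act ⊗ₘ mu H)) :
    IsAnchoredModule ρ h act coact where
  comodule := hc
  act_one := h₁
  act_coact := hr
  act_piL := eq_of_whiskerRight fun Z => whiskerRight_eq_of_box21 (by
    rw [box21_act_act, box21_whiskerLeft_comp, PiL, ← box_act_act_antipode hh ha, Category.id_comp])
  act_piR := eq_of_whiskerRight fun Z => whiskerRight_eq_of_box21 (by
    rw [box21_act_act, box21_whiskerLeft_comp, PiR, ← box_act_act_antipode hh ha, Category.id_comp])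

variable (hB : mu B ▷ B ≫ mu B = (α_ B B B).hom ≫ B ◁ mu B ≫ mu B)

include hB

theorem IsMultiplicativeTotalIntegral.isAnchor (hh : IsMultiplicativeTotalIntegral ρ h)
    (hρ : IsComoduleMagma ρ) : IsAnchor ρ h :=
  have e := hh.isAnchoredModule hρ.comodule UnitalMagmaObj.mul_one hB hρ.mul_coact
  ⟨hh, e.act_piL, e.act_piR⟩

theorem IsMultiplicativeTotalIntegral.isAnchoredMagma (hh : IsMultiplicativeTotalIntegral ρ h)
    (hρ : IsComoduleMagma ρ) (S : Coinvariants ρ h) : IsAnchoredMagma S :=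
  ⟨hρ, hh.isAnchor hB hρ, coinvariantsAssociate_of_assoc hB S⟩

end

variable [WeakHopfQuasigroup H] [UnitalMagmaObj B] {ρ : B ⟶ B ⊗ H} {h : H ⟶ B}
  {S : Coinvariants ρ h}

/-- The deformed action of an associative action is the action itself. -/
theorem IsAnchoredModule.quasiAct_eq {X : C} {act : X ⊗ B ⟶ X} {coact : X ⟶ X ⊗ H}
    (hX : IsAnchoredModule ρ h act coact) (hh : IsMultiplicativeTotalIntegral ρ h)
    (ha : act ▷ B ≫ act = (α_ X B B).hom ≫ X ◁ mu B ≫ act) : quasiAct h act coact = act := by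
  refine eq_of_whiskerRight fun Z => whiskerRight_eq_of_box21 ?_
  calc
    _ = box12 coact (B ⊗ Z) ≫ X ◁ h ▷ (B ⊗ Z) ≫ coinvMap h act coact ▷ _ ≫
        X ◁ box21 (mu B) Z ≫ box21 act Z := by
      rw [box_quasiAct]
      simp only [exchange]
    _ = _ := by
      rw [← box_assoc ha, reassoc_of% hX.coact_coinvMap_act hh]

/-- A strong Hopf module with its deformed action is a Hopf module. -/
def IsStrongModule.deformedHopfModule {X : C} {act : X ⊗ B ⟶ X} {coact : X ⟶ X ⊗ H}
    (hX : IsStrongModule S act coact) (hS : IsAnchoredMagma S)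
    (hB : mu B ▷ B ≫ mu B = (α_ B B B).hom ≫ B ◁ mu B ≫ mu B)
    (σ : Splitting (coinvMap h act coact)) : HopfModule ρ where
  X := X
  act := quasiAct h act coact
  coact := coact
  comodule := hX.comodule
  act_one := eq_of_whiskerRight fun Z => act_one_of_box (hX.eq_of_i_act hS σ (by
    have e := hX.i_act_quasiAct hS σ Z
    have e' := congrArg (fun k => σ.obj ◁ B ◁ box01 (eta B) Z ≫ k) e
    rw [← whiskerLeft_comp_assoc, box_mul_one, whiskerLeft_id, Category.id_comp] at e'
    rw [Category.comp_id, ← e']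
    simp only [exchange]))
  -- On `i(n)·b` the deformed action is right multiplication in `B`, so its associativity is that of
  -- `B`.
  act_mul := eq_of_whiskerRight fun Z => assoc_of_box (hX.eq_of_i_act hS σ (by
    rw [reassoc_of% hX.i_act_quasiAct hS, hX.i_act_quasiAct hS, ← whiskerLeft_comp_assoc, box_assoc hB,
      reassoc_of% box21_exchange, ← whisker_exchange_assoc, hX.i_act_quasiAct hS, whiskerLeft_comp_assoc]))
  act_coact := eq_of_whiskerRight fun Z => whiskerRight_eq_of_box21 (by
    rw [← cancel_mono (α_ _ _ _).hom, box21_comp_assoc, box21_tensorμ_comp]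
    refine hX.eq_of_i_act hS σ ?_
    have e := hS.isStrongModule.box_act_coact Z
    rw [reassoc_of% hX.i_act_quasiAct hS, hX.i_act_coact hS, ← whiskerLeft_comp_assoc, e,
      reassoc_of% box21_exchange, ← whisker_exchange_assoc, reassoc_of% hX.i_act_coact hS]
    simp only [exchange, hX.i_act_quasiAct hS])

/-- An isomorphism of strong Hopf modules. -/
def StrongHopfModule.isoMk [HasCoequalizers C] {M N : StrongHopfModule S} (u : M.X ≅ N.X)
    (hc : u.hom ≫ N.coact = M.coact ≫ u.hom ▷ H)
    (hq : u.hom ▷ B ≫ N.deformedAct = M.deformedAct ≫ u.hom) : M ≅ N where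
  hom := ⟨u.hom, hc, hq⟩
  inv := ⟨u.inv, by
    rw [← cancel_epi u.hom, u.hom_inv_id_assoc, reassoc_of% hc, hom_inv_whiskerRight,
      Category.comp_id], by
    rw [← cancel_epi (u.hom ▷ B), hom_inv_whiskerRight_assoc, reassoc_of% hq, u.hom_inv_id,
      Category.comp_id]⟩
  hom_inv_id := Hom.ext u.hom_inv_id
  inv_hom_id := Hom.ext u.inv_hom_id

namespace HopfModule

theorem isAnchoredModule (hh : IsMultiplicativeTotalIntegral ρ h) (M : HopfModule ρ) :
    IsAnchoredModule ρ h M.act M.coact :=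
  hh.isAnchoredModule M.comodule M.act_one M.act_mul M.act_coact

/-- A Hopf module over an associative `B` as a strong Hopf module. -/
def strong (hh : IsMultiplicativeTotalIntegral ρ h) (S : Coinvariants ρ h) (M : HopfModule ρ) :
    StrongHopfModule S where
  toTriple := M.toTriple
  comodule := M.comodule
  act_one := M.act_one
  act_coinv := act_coinv_of_assoc S M.act_mul
  act_coact := M.act_coact
  act_piL := (M.isAnchoredModule hh).act_piL
  act_piR := (M.isAnchoredModule hh).act_piR

variable [HasCoequalizers C] [PreservesColimitsOfShape WalkingParallelPair (tensorRight B)]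

theorem deformedAct_strong (hS : IsAnchoredMagma S) (M : HopfModule ρ) :
    (M.strong hS.anchor.toIsMultiplicativeTotalIntegral S).deformedAct = M.act := by
  rw [StrongHopfModule.deformedAct_eq hS]
  exact (M.isAnchoredModule hS.anchor.toIsMultiplicativeTotalIntegral).quasiAct_eq
    hS.anchor.toIsMultiplicativeTotalIntegral M.act_mul

/-- The inclusion of the Hopf modules into the strong Hopf modules. -/
noncomputable def strongFunctor (hS : IsAnchoredMagma S) : HopfModule ρ ⥤ StrongHopfModule S where
  obj M := M.strong hS.anchor.toIsMultiplicativeTotalIntegral S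
  map {M N} f :=
    { hom := f.hom
      colinear := f.colinear
      quasilinear := by
        rw [deformedAct_strong hS, deformedAct_strong hS]
        exact f.linear }

/-- Full faithfulness holds because an associative action is its own deformation. A strong Hopf
module need not have an associative action, but replacing that action by the deformed one changes
neither its coaction nor its deformed action. -/
theorem strongFunctor_isEquivalence (hS : IsAnchoredMagma S)
    (hB : mu B ▷ B ≫ mu B = (α_ B B B).hom ≫ B ◁ mu B ≫ mu B) :
    (strongFunctor hS).IsEquivalence where
  faithful := ⟨fun e => Hom.ext (congrArg StrongHopfModule.Hom.hom e)⟩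
  full := ⟨fun {M N} f => ⟨⟨f.hom, f.colinear, by
    rw [← deformedAct_strong hS, ← deformedAct_strong hS]
    exact f.quasilinear⟩, rfl⟩⟩
  essSurj := ⟨fun M => by
    let M' := M.isStrongModule.deformedHopfModule hS hB (M.coinv hS)
    have e : ((strongFunctor hS).obj M').deformedAct = M.deformedAct := by
      rw [M.deformedAct_eq hS]
      exact M'.deformedAct_strong hS
    have e₁ : 𝟙 M.X ≫ M.coact = M.coact ≫ 𝟙 M.X ▷ H := by simp
    have e₂ : 𝟙 M.X ▷ B ≫ M.deformedAct = M.deformedAct ≫ 𝟙 M.X := by simp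
    exact ⟨M', ⟨StrongHopfModule.isoMk (M := (strongFunctor hS).obj M') (Iso.refl M.X) e₁
      (e₂.trans (congrArg (· ≫ 𝟙 M.X) e.symm))⟩⟩⟩

theorem nonempty_equivalence (hS : IsAnchoredMagma S)
    (hB : mu B ▷ B ≫ mu B = (α_ B B B).hom ≫ B ◁ mu B ≫ mu B) :
    Nonempty (HopfModule ρ ≌ StrongHopfModule S) :=
  have := strongFunctor_isEquivalence hS hB
  ⟨(strongFunctor hS).asEquivalence⟩

end HopfModule


end DoiHopf

/-! ### Hopf quasigroups as weak Hopf quasigroups. -/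

namespace DoiHopf

section

variable {C : Type u} [Category.{v} C] [MonoidalCategory.{v} C]

theorem box_counit_mul_mul {A : C} (d : A ⟶ A ⊗ A) (m : A ⊗ A ⟶ A) (e : A ⟶ 𝟙_ C) (Z : C) :
    ((A ◁ d) ▷ A ≫ (α_ A A A).inv ▷ A ≫ (α_ (A ⊗ A) A A).hom ≫ ((m ≫ e) ⊗ₘ (m ≫ e)) ≫
        (λ_ (𝟙_ C)).hom) ▷ Z ≫ (λ_ Z).hom =
      (α_ _ _ _).hom ≫ (α_ _ _ _).hom ≫ A ◁ box12 d (A ⊗ Z) ≫ box21 m (A ⊗ (A ⊗ Z)) ≫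
        box10 e (A ⊗ (A ⊗ Z)) ≫ box21 m Z ≫ box10 e Z := by
  simp [MonoidalCategory.tensorHom_def, box12, box21, box10]
  monoidal

theorem box_one_comul_mul {A : C} (f : 𝟙_ C ⟶ A ⊗ A) (m : A ⊗ A ⟶ A) (Z : C) :
    (λ_ Z).inv ≫ ((λ_ (𝟙_ C)).inv ≫ (f ⊗ₘ f) ≫ (α_ (A ⊗ A) A A).inv ≫ (α_ A A A).hom ▷ A ≫
        (A ◁ m) ▷ A) ▷ Z ≫ (α_ (A ⊗ A) A Z).hom ≫ (α_ A A (A ⊗ Z)).hom =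
      box01 f Z ≫ (α_ A A Z).hom ≫ box01 f (A ⊗ (A ⊗ Z)) ≫ (α_ A A _).hom ≫
        A ◁ box21 m (A ⊗ Z) := by
  simp [MonoidalCategory.tensorHom_def', box01, box21]
  monoidal

variable [BraidedCategory.{v} C]

theorem braidInv_box10 {A : C} (f : A ⟶ 𝟙_ C) (B Z : C) :
    braidInv A B Z ≫ box10 f (B ⊗ Z) = B ◁ box10 f Z := by
  rw [← braid_whiskerLeft_box10, reassoc_of% inv_braid]

theorem box01_braidInv {B : C} (f : 𝟙_ C ⟶ B) (A Z : C) :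
    box01 f (A ⊗ Z) ≫ braidInv A B Z = A ◁ box01 f Z := by
  rw [← whiskerLeft_box01_braid, Category.assoc, braid_inv, Category.comp_id]

end

namespace HopfQuasigroup

variable {C : Type u} [Category.{v} C] [MonoidalCategory.{v} C] [BraidedCategory.{v} C]
  {H : C} [HopfQuasigroup H]

theorem box_mul_counit (Z : C) :
    box21 (mu H) Z ≫ box10 ε[H] Z = H ◁ box10 ε[H] Z ≫ box10 ε[H] Z := by
  rw [box21, box10, Category.assoc, ← comp_whiskerRight_assoc, mul_counit]
  simp [MonoidalCategory.tensorHom_def']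

theorem box_one_comul (Z : C) :
    box01 (eta H) Z ≫ box12 Δ[H] Z = box01 (eta H) Z ≫ box01 (eta H) (H ⊗ Z) := by
  rw [box01, box12, Category.assoc, ← comp_whiskerRight_assoc, one_comul]
  simp [MonoidalCategory.tensorHom_def', box01]

theorem box_counit_one (Z : C) : (ε[H] ≫ eta H) ▷ Z = box10 ε[H] Z ≫ box01 (eta H) Z := by
  simp [box10, box01]

/-- The quasigroup identity `(yx₁)λ(x₂) = yε(x)` at `y = 1`. -/
theorem piL_eq_counit_one : PiL H = ε[H] ≫ eta H := by
  refine eq_of_whiskerRight fun Z => ?_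
  have e : H ◁ (box12 Δ[H] Z ≫ H ◁ lam H ▷ Z) ≫ box21 (mu H) _ ≫ box21 (mu H) Z =
      H ◁ box10 ε[H] Z := by
    have e := congrArg (fun f => (α_ H H Z).inv ≫ f ▷ Z) (mul_mul_antipode (H := H))
    simpa [box12, box21, box10, MonoidalCategory.tensorHom_def'] using e
  have e' := congrArg (fun k => box01 (eta H) _ ≫ k) e
  simp only [exchange, reassoc_of% box_one_mul, Category.assoc] at e'
  rw [box_counit_one, box10_exchange, ← e', WeakHopfQuasigroup.whiskerRight_piL]

theorem piR_eq_counit_one : PiR H = ε[H] ≫ eta H := by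
  refine eq_of_whiskerRight fun Z => ?_
  have e : H ◁ (box12 Δ[H] Z ≫ lam H ▷ (H ⊗ Z)) ≫ box21 (mu H) _ ≫ box21 (mu H) Z =
      H ◁ box10 ε[H] Z := by
    have e := congrArg (fun f => (α_ H H Z).inv ≫ f ▷ Z) (mul_antipode_mul' (H := H))
    simpa [box12, box21, box10, MonoidalCategory.tensorHom_def'] using e
  have e' := congrArg (fun k => box01 (eta H) _ ≫ k) e
  simp only [exchange, reassoc_of% box_one_mul, Category.assoc] at e'
  rw [box_counit_one, box10_exchange, ← e', PiR, whiskerRight_conv, id_whiskerRight, whiskerLeft_id,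
    Category.id_comp]

theorem box_mul_mul_counit (Z : C) : box21 (mu H) (H ⊗ Z) ≫ box21 (mu H) Z ≫ box10 ε[H] Z =
    H ◁ box21 (mu H) Z ≫ box21 (mu H) Z ≫ box10 ε[H] Z := by
  simp only [exchange, box_mul_counit]

variable (H) in
/-- A Hopf quasigroup is a weak Hopf quasigroup. -/
abbrev toWeakHopfQuasigroup : WeakHopfQuasigroup H where
  mul_comul := mul_comul
  counit_mul_assoc := eq_of_whiskerRight fun Z => by
    have e' := congrArg (fun k => (α_ (H ⊗ H) H Z).hom ≫ (α_ H H (H ⊗ Z)).hom ≫ k ≫ (λ_ Z).inv)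
      (box_mul_mul_counit Z)
    simpa [box21, box10] using e'
  counit_mul_mul := eq_of_whiskerRight fun Z => by
    rw [← cancel_mono (λ_ Z).hom, box_counit_mul_mul]
    have e : box21 (mu H) (H ⊗ Z) ≫ box21 (mu H) Z ≫ box10 ε[H] Z =
        H ◁ box12 Δ[H] (H ⊗ Z) ≫ box21 (mu H) _ ≫ box10 ε[H] _ ≫ box21 (mu H) Z ≫
          box10 ε[H] Z := by
      rw [box_mul_mul_counit, reassoc_of% box_mul_counit, ← whiskerLeft_comp_assoc, box_counit_comul,
        whiskerLeft_id, Category.id_comp, box10_exchange _ (box21 (mu H) Z ≫ box10 ε[H] Z),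
        whiskerLeft_comp_assoc, box_mul_counit]
    rw [← e]
    simp [box21, box10]
  counit_mul_mul_braid := eq_of_whiskerRight fun Z => by
    rw [← cancel_mono (λ_ Z).hom, box_counit_mul_mul]
    have e : box21 (mu H) (H ⊗ Z) ≫ box21 (mu H) Z ≫ box10 ε[H] Z =
        H ◁ box12 (Δ[H] ≫ (β_ H H).inv) (H ⊗ Z) ≫ box21 (mu H) _ ≫ box10 ε[H] _ ≫
          box21 (mu H) Z ≫ box10 ε[H] Z := by
      have e₁ : box12 (Δ[H] ≫ (β_ H H).inv) (H ⊗ Z) = box12 Δ[H] (H ⊗ Z) ≫ braidInv H H _ := by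
        simp [box12, braidInv]
      rw [e₁, box_mul_mul_counit, reassoc_of% box_mul_counit, ← whiskerLeft_comp_assoc, Category.assoc,
        braidInv_box10, box_comul_counit, whiskerLeft_id, Category.id_comp,
        box10_exchange _ (box21 (mu H) Z ≫ box10 ε[H] Z), whiskerLeft_comp_assoc, box_mul_counit]
    rw [← e]
    simp [box21, box10]
  one_comul_comul := eq_of_whiskerRight fun Z => by
    rw [← cancel_mono (α_ _ _ _).hom, ← cancel_mono (α_ _ _ _).hom, ← cancel_epi (λ_ _).inv,
      Category.assoc, Category.assoc, box_one_comul_mul]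
    have e : box01 (eta H) Z ≫ box12 Δ[H] Z ≫ box12 Δ[H] (H ⊗ Z) =
      box01 (eta H) Z ≫ box12 Δ[H] Z ≫ box01 (eta H) (H ⊗ (H ⊗ Z)) ≫ box12 Δ[H] (H ⊗ (H ⊗ Z)) ≫
        H ◁ box21 (mu H) (H ⊗ Z) := by
      simp only [box_one_comul, reassoc_of% box_one_comul, box01_exchange, reassoc_of% box_one_mul]
    simpa [box01, box12] using e
  one_comul_comul_braid := eq_of_whiskerRight fun Z => by
    rw [← cancel_mono (α_ _ _ _).hom, ← cancel_mono (α_ _ _ _).hom, ← cancel_epi (λ_ _).inv,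
      Category.assoc, Category.assoc, box_one_comul_mul]
    have e : box01 (eta H) Z ≫ box12 Δ[H] Z ≫ box12 Δ[H] (H ⊗ Z) =
      box01 (eta H) Z ≫ box12 Δ[H] Z ≫ box01 (eta H) (H ⊗ (H ⊗ Z)) ≫ box12 Δ[H] (H ⊗ (H ⊗ Z)) ≫
        H ◁ (braidInv H H _ ≫ box21 (mu H) (H ⊗ Z)) := by
      simp only [box_one_comul, reassoc_of% box_one_comul, box01_exchange, Category.assoc]
      rw [reassoc_of% box01_braidInv (eta H), reassoc_of% box_mul_one]
    simpa [box01, box12, braidInv, box21] using e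
  piL_eq := by
    rw [piL_eq_counit_one]
    refine eq_of_whiskerRight fun Z => ?_
    have e : box10 ε[H] Z ≫ box01 (eta H) Z =
        box01 (eta H) (H ⊗ Z) ≫ box21 (WeakHopfQuasigroup.counitL H) Z := by
      rw [WeakHopfQuasigroup.box_counitL, reassoc_of% box_one_comul, reassoc_of% box01_exchange,
        reassoc_of% box_one_mul, reassoc_of% box01_braid, box10_exchange]
    rw [box_counit_one, e]
    simp [box01, box21, WeakHopfQuasigroup.counitL]
  piR_eq := by
    rw [piR_eq_counit_one]
    refine eq_of_whiskerRight fun Z => ?_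
    have e : box10 ε[H] Z ≫ box01 (eta H) Z =
        H ◁ box01 (eta H) Z ≫ box21 (WeakHopfQuasigroup.counitR H) Z := by
      rw [WeakHopfQuasigroup.box_counitR, ← whiskerLeft_comp_assoc, box_one_comul,
        whiskerLeft_comp_assoc, reassoc_of% whiskerLeft_box01_braid, box01_exchange, Category.assoc,
        reassoc_of% box_mul_one]
    rw [box_counit_one, e]
    simp [box01, box21, WeakHopfQuasigroup.counitR]
  antipode_conv_piL := by
    rw [piL_eq_counit_one]
    refine eq_of_whiskerRight fun Z => ?_
    rw [whiskerRight_conv, box_counit_one, whiskerLeft_comp_assoc, reassoc_of% box_comul_counit,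
      whisker_exchange_assoc, box_mul_one, Category.comp_id]
  piR_conv_antipode := by
    rw [piR_eq_counit_one]
    refine eq_of_whiskerRight fun Z => ?_
    rw [whiskerRight_conv, box_counit_one, Category.assoc, box_one_mul, Category.comp_id,
      ← box10_exchange, reassoc_of% box_counit_comul]
  antipode_mul_mul := by
    rw [antipode_mul_mul, piR_eq_counit_one, comp_whiskerRight, Category.assoc,
      UnitalMagmaObj.one_mul]
  mul_antipode_mul := by
    rw [mul_antipode_mul, piL_eq_counit_one, comp_whiskerRight, Category.assoc,
      UnitalMagmaObj.one_mul]
  mul_mul_antipode := by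
    rw [mul_mul_antipode, piL_eq_counit_one, whiskerLeft_comp, Category.assoc,
      UnitalMagmaObj.mul_one]
  mul_antipode_mul' := by
    rw [mul_antipode_mul', piR_eq_counit_one, whiskerLeft_comp, Category.assoc,
      UnitalMagmaObj.mul_one]

end HopfQuasigroup

end DoiHopf

/-! ### Hopf modules over Hopf quasigroups and Hopf algebras. -/

namespace DoiHopf

variable {C : Type u} [Category.{v} C] [MonoidalCategory.{v} C] [BraidedCategory.{v} C]
  {H B : C}

namespace HopfQuasigroup

attribute [local instance] toWeakHopfQuasigroup

variable [HopfQuasigroup H]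

theorem one_piL : eta H ≫ PiL H = eta H := by
  rw [piL_eq_counit_one, reassoc_of% one_counit]

theorem isComoduleMagma [UnitalMagmaObj B] {ρ : B ⟶ B ⊗ H} (hρ : IsHopfComoduleMagma ρ) :
    IsComoduleMagma ρ where
  comodule := hρ.comodule
  mul_coact := hρ.mul_coact
  one_coact := by
    rw [reassoc_of% hρ.one_coact, hρ.one_coact, MonoidalCategory.tensorHom_def, Category.assoc,
      ← whiskerLeft_comp, one_piL]

variable (S : Coinvariants Δ[H] (𝟙 H))

/-- Coinvariants are fixed by `Π^L = ηε`, hence are scalar multiples of `1`. -/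
theorem coinvariants_i : S.i = (S.i ≫ ε[H]) ≫ eta H := by
  have e : S.i ≫ PiL H = S.i := by
    rw [← coinvMap_id_comul, S.i_comp]
  rw [Category.assoc, ← piL_eq_counit_one, e]

/-- The coinvariants of a Hopf quasigroup are trivial. -/
def oneIso : 𝟙_ C ≅ S.obj where
  hom := eta H ≫ S.p
  inv := S.i ≫ ε[H]
  hom_inv_id := by
    rw [Category.assoc, reassoc_of% S.p_i, coinvMap_id_comul, reassoc_of% one_piL (H := H),
      one_counit]
  inv_hom_id := by
    rw [← Category.assoc, ← coinvariants_i, S.i_p]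

variable [HasCoequalizers C] [PreservesColimitsOfShape WalkingParallelPair (tensorRight H)]

theorem nonempty_equivalence : Nonempty (StrongHopfModule S ≌ C) := by
  let := (isAnchoredMagma_id S).monObj
  obtain ⟨E⟩ := StrongHopfModule.nonempty_equivalence (isAnchoredMagma_id S)
  obtain ⟨E'⟩ := RightMod.nonempty_equivalence_of_isIso_one (oneIso S) rfl
  exact ⟨E.trans E'⟩

/-- Hopf modules over a Hopf quasigroup as strong Hopf modules. -/
def strong (M : QuasigroupHopfModule H) : StrongHopfModule S where
  toTriple := M.toTriple
  comodule := M.comodule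
  act_one := M.act_one
  -- Associativity along scalar multiples of `1` is only the unit law.
  act_coinv := by
    rw [coinvariants_i S, whiskerLeft_comp, Category.assoc, M.act_one, comp_whiskerRight,
      comp_whiskerRight _ (eta H), Category.assoc, Category.assoc, UnitalMagmaObj.one_mul]
    simp
  act_coact := M.act_coact
  act_piL := by
    rw [piL_eq_counit_one]
    simpa [M.act_one] using M.act_antipode
  act_piR := by
    rw [piR_eq_counit_one]
    simpa [M.act_one] using M.antipode_act

/-- Strong Hopf modules over a Hopf quasigroup as Hopf modules. -/
def unstrong (M : StrongHopfModule S) : QuasigroupHopfModule H where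
  toTriple := M.toTriple
  comodule := M.comodule
  act_one := M.act_one
  act_coact := M.act_coact
  act_antipode := by
    have e := M.act_piL
    rw [piL_eq_counit_one] at e
    simpa [M.act_one] using e
  antipode_act := by
    have e := M.act_piR
    rw [piR_eq_counit_one] at e
    simpa [M.act_one] using e

theorem deformedAct_eq (M : StrongHopfModule S) : M.deformedAct = (unstrong S M).quasiAct := by
  rw [StrongHopfModule.deformedAct_eq (isAnchoredMagma_id S), quasiAct, id_whiskerRight,
    Category.id_comp]
  rfl

/-- The two notions of Hopf modules over a Hopf quasigroup coincide. -/
def strongEquivalence : QuasigroupHopfModule H ≌ StrongHopfModule S where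
  functor :=
    { obj M := strong S M
      map {M N} f := ⟨f.hom, f.colinear, by
        rw [deformedAct_eq, deformedAct_eq]
        exact f.quasilinear⟩ }
  inverse :=
    { obj M := unstrong S M
      map {M N} f := ⟨f.hom, f.colinear, by
        rw [← deformedAct_eq, ← deformedAct_eq]
        exact f.quasilinear⟩ }
  unitIso := Iso.refl _
  counitIso := Iso.refl _
  functor_unitIso_comp M := StrongHopfModule.Hom.ext (Category.id_comp _)

end HopfQuasigroup

section

variable [HopfObj H]

theorem mu_assoc_of_hopfObj : mu H ▷ H ≫ mu H = (α_ H H H).hom ≫ H ◁ mu H ≫ mu H :=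
  MonObj.mul_assoc H

theorem antipode_conv_of_hopfObj : Δ[H] ≫ lam H ▷ H ≫ mu H = ε[H] ≫ eta H :=
  HopfObj.antipode_left H

theorem conv_antipode_of_hopfObj : Δ[H] ≫ H ◁ lam H ≫ mu H = ε[H] ≫ eta H :=
  HopfObj.antipode_right H

variable (H) in
/-- A Hopf algebra is a Hopf quasigroup. -/
abbrev hopfQuasigroupOfHopfObj : HopfQuasigroup H where
  toHopfSignature := HopfSignature.ofHopfObj H
  one_counit := BimonObj.one_counit H
  mul_counit := BimonObj.mul_counit H
  one_comul := BimonObj.one_comul H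
  mul_comul := BimonObj.mul_comul H
  antipode_mul_mul := by
    rw [← UnitalMagmaObj.one_mul, ← comp_whiskerRight_assoc, ← antipode_conv_of_hopfObj]
    simp [MonoidalCategory.tensorHom_def, mu_assoc_of_hopfObj]
  mul_antipode_mul := by
    rw [← UnitalMagmaObj.one_mul, ← comp_whiskerRight_assoc, ← conv_antipode_of_hopfObj]
    simp [mu_assoc_of_hopfObj]
  mul_antipode_mul' := by
    rw [← UnitalMagmaObj.mul_one, ← whiskerLeft_comp_assoc, ← antipode_conv_of_hopfObj]
    simp [mu_assoc_of_hopfObj]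
  mul_mul_antipode := by
    rw [← UnitalMagmaObj.mul_one, ← whiskerLeft_comp_assoc, ← conv_antipode_of_hopfObj]
    simp [MonoidalCategory.tensorHom_def', mu_assoc_of_hopfObj]

end

end DoiHopf

/-! ### Assembly of the cases. -/

namespace DoiHopf

section

variable {C : Type u} [Category.{v} C] [MonoidalCategory.{v} C] [BraidedCategory.{v} C]
  [HasCoequalizers C] {H B : C} [WeakHopfQuasigroup H]

theorem IsAnchoredMagma.exists_monObj_equivalence [UnitalMagmaObj B]
    [PreservesColimitsOfShape WalkingParallelPair (tensorRight B)]
    [PreservesColimitsOfShape WalkingParallelPair (tensorRight H)]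
    {ρ : B ⟶ B ⊗ H} {h : H ⟶ B} {S : Coinvariants ρ h} (hS : IsAnchoredMagma S) :
    ∃ _ : MonObj S.obj, MonObj.one ≫ S.i = eta B ∧ MonObj.mul ≫ S.i = (S.i ⊗ₘ S.i) ≫ mu B ∧
      Nonempty (StrongHopfModule S ≌ RightMod S.obj) :=
  ⟨hS.monObj, hS.one_i, hS.isStrongModule.coinvAction_comp_i hS S,
    StrongHopfModule.nonempty_equivalence hS⟩

theorem IsAnchor.nonempty_coinvariants [UnitalMagmaObj B] {ρ : B ⟶ B ⊗ H} {h : H ⟶ B}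
    (hh : IsAnchor ρ h) (hρ : IsComoduleMagma ρ) : Nonempty (Coinvariants ρ h) :=
  (hh.isAnchoredModule hρ).nonempty_splitting hh.toIsMultiplicativeTotalIntegral hρ.comodule

theorem equivalences_of_mul_assoc [UnitalMagmaObj B]
    [PreservesColimitsOfShape WalkingParallelPair (tensorRight B)]
    [PreservesColimitsOfShape WalkingParallelPair (tensorRight H)]
    {ρ : B ⟶ B ⊗ H} {h : H ⟶ B}
    (hB : mu B ▷ B ≫ mu B = (α_ B B B).hom ≫ B ◁ mu B ≫ mu B)
    (hρ : IsComoduleMagma ρ) (hh : IsMultiplicativeTotalIntegral ρ h) :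
    Nonempty (Coinvariants ρ h) ∧ ∀ S : Coinvariants ρ h,
      (∀ M : StrongHopfModule S, ∃! ψ, M.IsDeformedAction ψ) ∧
      Nonempty (HopfModule ρ ≌ StrongHopfModule S) ∧
      ∃ _ : MonObj S.obj, MonObj.one ≫ S.i = eta B ∧ MonObj.mul ≫ S.i = (S.i ⊗ₘ S.i) ≫ mu B ∧
        Nonempty (StrongHopfModule S ≌ RightMod S.obj) :=
  ⟨(hh.isAnchor hB hρ).nonempty_coinvariants hρ, fun S =>
    have hS := hh.isAnchoredMagma hB hρ S
    ⟨fun M => M.existsUnique_isDeformedAction hS, HopfModule.nonempty_equivalence hS hB,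
      hS.exists_monObj_equivalence⟩⟩

variable (H) in
theorem nonempty_coinvariants_id : Nonempty (Coinvariants Δ[H] (𝟙 H)) :=
  isAnchor_id.nonempty_coinvariants isComoduleMagma_comul

end

end DoiHopf

theorem mainTheorem3 {C : Type u} [Category.{v} C] [MonoidalCategory.{v} C]
    [BraidedCategory.{v} C] [HasCoequalizers C] :
    -- (i) Hopf algebras
    (∀ (H B : C) [HopfObj H] [MonObj B]
        [PreservesColimitsOfShape WalkingParallelPair (tensorRight B)]
        [PreservesColimitsOfShape WalkingParallelPair (tensorRight H)]
        (ρ : B ⟶ B ⊗ H) (h : H ⟶ B),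
      IsHopfComoduleMagma ρ → IsMultiplicativeTotalIntegral ρ h →
        Nonempty (Coinvariants ρ h) ∧ ∀ S : Coinvariants ρ h,
          (∀ M : StrongHopfModule S, ∃! ψ, M.IsDeformedAction ψ) ∧
          Nonempty (HopfModule ρ ≌ StrongHopfModule S) ∧
          ∃ _ : MonObj S.obj,
            MonObj.one ≫ S.i = eta B ∧
            MonObj.mul ≫ S.i = (S.i ⊗ₘ S.i) ≫ mu B ∧
            Nonempty (StrongHopfModule S ≌ RightMod S.obj)) ∧
    -- (i), the case `B = H`
    (∀ (H : C) [HopfObj H] [PreservesColimitsOfShape WalkingParallelPair (tensorRight H)],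
      Nonempty (Coinvariants Δ[H] (𝟙 H)) ∧ ∀ S : Coinvariants Δ[H] (𝟙 H),
        (∀ M : StrongHopfModule S, ∃! ψ, M.IsDeformedAction ψ) ∧
        Nonempty (HopfModule Δ[H] ≌ StrongHopfModule S) ∧
        Nonempty (StrongHopfModule S ≌ C)) ∧
    -- (ii) weak Hopf algebras
    (∀ (H B : C) [WeakHopfAlgebra H] [MonObj B]
        [PreservesColimitsOfShape WalkingParallelPair (tensorRight B)]
        [PreservesColimitsOfShape WalkingParallelPair (tensorRight H)]
        (ρ : B ⟶ B ⊗ H) (h : H ⟶ B),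
      IsComoduleMagma ρ → IsMultiplicativeTotalIntegral ρ h →
        Nonempty (Coinvariants ρ h) ∧ ∀ S : Coinvariants ρ h,
          (∀ M : StrongHopfModule S, ∃! ψ, M.IsDeformedAction ψ) ∧
          Nonempty (HopfModule ρ ≌ StrongHopfModule S) ∧
          ∃ _ : MonObj S.obj,
            MonObj.one ≫ S.i = eta B ∧
            MonObj.mul ≫ S.i = (S.i ⊗ₘ S.i) ≫ mu B ∧
            Nonempty (StrongHopfModule S ≌ RightMod S.obj)) ∧
    -- (ii), the case `B = H`
    (∀ (H : C) [WeakHopfAlgebra H]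
        [PreservesColimitsOfShape WalkingParallelPair (tensorRight H)],
      Nonempty (Coinvariants Δ[H] (𝟙 H)) ∧ Nonempty (Splitting (PiL H)) ∧
        ∀ (S : Coinvariants Δ[H] (𝟙 H)) (L : Splitting (PiL H)),
          (∀ M : StrongHopfModule S, ∃! ψ, M.IsDeformedAction ψ) ∧
          Nonempty (HopfModule Δ[H] ≌ StrongHopfModule S) ∧
          ∃ _ : MonObj L.obj,
            MonObj.one = eta H ≫ L.p ∧
            MonObj.mul = (L.i ⊗ₘ L.i) ≫ mu H ≫ L.p ∧
            Nonempty (StrongHopfModule S ≌ RightMod L.obj)) ∧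
    -- (iii) Hopf quasigroups
    (∀ (H B : C) [HopfQuasigroup H] [UnitalMagmaObj B]
        [PreservesColimitsOfShape WalkingParallelPair (tensorRight B)]
        [PreservesColimitsOfShape WalkingParallelPair (tensorRight H)]
        (ρ : B ⟶ B ⊗ H) (h : H ⟶ B),
      IsHopfComoduleMagma ρ → IsAnchor ρ h →
        Nonempty (Coinvariants ρ h) ∧ ∀ S : Coinvariants ρ h, CoinvariantsAssociate S →
          (∀ M : StrongHopfModule S, ∃! ψ, M.IsDeformedAction ψ) ∧
          ∃ _ : MonObj S.obj,
            MonObj.one ≫ S.i = eta B ∧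
            MonObj.mul ≫ S.i = (S.i ⊗ₘ S.i) ≫ mu B ∧
            Nonempty (StrongHopfModule S ≌ RightMod S.obj)) ∧
    -- (iii), the case `B = H`
    (∀ (H : C) [HopfQuasigroup H]
        [PreservesColimitsOfShape WalkingParallelPair (tensorRight H)],
      Nonempty (Coinvariants Δ[H] (𝟙 H)) ∧ ∀ S : Coinvariants Δ[H] (𝟙 H),
        (∀ M : StrongHopfModule S, ∃! ψ, M.IsDeformedAction ψ) ∧
        (∃ e : QuasigroupHopfModule H ≌ StrongHopfModule S,
          e.functor ⋙ StrongHopfModule.forget S = QuasigroupHopfModule.forget H ∧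
          (∀ M, (e.functor.obj M).toTriple = M.toTriple) ∧
          (∀ N, (e.inverse.obj N).toTriple = N.toTriple)) ∧
        Nonempty (StrongHopfModule S ≌ C)) ∧
    -- (iv) weak Hopf quasigroups
    (∀ (H : C) [WeakHopfQuasigroup H]
        [PreservesColimitsOfShape WalkingParallelPair (tensorRight H)],
      Nonempty (Coinvariants Δ[H] (𝟙 H)) ∧ Nonempty (Splitting (PiL H)) ∧
        ∀ (S : Coinvariants Δ[H] (𝟙 H)) (L : Splitting (PiL H)),
          (∀ M : StrongHopfModule S, ∃! ψ, M.IsDeformedAction ψ) ∧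
          ∃ _ : MonObj L.obj,
            MonObj.one = eta H ≫ L.p ∧
            MonObj.mul = (L.i ⊗ₘ L.i) ≫ mu H ≫ L.p ∧
            Nonempty (StrongHopfModule S ≌ RightMod L.obj)) := by
  refine ⟨?_, ?_, ?_, ?_, ?_, ?_, ?_⟩
  · intro H B _ _ _ _ ρ h hρ hh
    let := hopfQuasigroupOfHopfObj H
    let := HopfQuasigroup.toWeakHopfQuasigroup H
    exact equivalences_of_mul_assoc (MonObj.mul_assoc B) (HopfQuasigroup.isComoduleMagma hρ) hh
  · intro H _ _
    let := hopfQuasigroupOfHopfObj H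
    let := HopfQuasigroup.toWeakHopfQuasigroup H
    exact ⟨nonempty_coinvariants_id H, fun S =>
      ⟨fun M => M.existsUnique_isDeformedAction (isAnchoredMagma_id S),
        HopfModule.nonempty_equivalence (isAnchoredMagma_id S) mu_assoc_of_hopfObj,
        HopfQuasigroup.nonempty_equivalence S⟩⟩
  · intro H B _ _ _ _ ρ h hρ hh
    exact equivalences_of_mul_assoc (MonObj.mul_assoc B) hρ hh
  · intro H _ _
    exact ⟨nonempty_coinvariants_id H, nonempty_splitting_piL, fun S L =>
      ⟨fun M => M.existsUnique_isDeformedAction (isAnchoredMagma_id S),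
        HopfModule.nonempty_equivalence (isAnchoredMagma_id S) WeakHopfAlgebra.mul_assoc,
        exists_monObj_equivalence_piL S L⟩⟩
  · intro H B _ _ _ _ ρ h hρ hh
    let := HopfQuasigroup.toWeakHopfQuasigroup H
    have hρ' := HopfQuasigroup.isComoduleMagma hρ
    exact ⟨IsAnchor.nonempty_coinvariants hh hρ', fun S hS =>
      have hS' : IsAnchoredMagma S := ⟨hρ', hh, hS⟩
      ⟨fun M => M.existsUnique_isDeformedAction hS', hS'.exists_monObj_equivalence⟩⟩
  · intro H _ _
    let := HopfQuasigroup.toWeakHopfQuasigroup H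
    exact ⟨nonempty_coinvariants_id H, fun S =>
      ⟨fun M => M.existsUnique_isDeformedAction (isAnchoredMagma_id S),
        ⟨HopfQuasigroup.strongEquivalence S, rfl, fun _ => rfl, fun _ => rfl⟩,
        HopfQuasigroup.nonempty_equivalence S⟩⟩
  · intro H _ _
    exact ⟨nonempty_coinvariants_id H, nonempty_splitting_piL, fun S L =>
      ⟨fun M => M.existsUnique_isDeformedAction (isAnchoredMagma_id S),
        exists_monObj_equivalence_piL S L⟩⟩
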